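/- **Theorem 1.2 (Large-time behavior).** Let $\mathbb T^3=\mathbb R^3/\mathbb Z^3$, $\mu>0$ and $\frac65\le p<\infty$. Write $Du=\frac12(\nabla_x u+\nabla_x^T u)$ and $\tau(Du)=\mu|Du|^{p-2}Du$. Let $(f,u)$, with $f=f(t,x,v)\ge 0$ and pressure $\pi=\pi(t,x)$, be a sufficiently regular global solution on $[0,\infty)\times\mathbb T^3\times\mathbb R^3$ of $$ \begin{aligned} &\partial_t f+v\cdot\nabla_x f+\nabla_v\cdot((u-v)f)=0,\\ &\partial_t u+(u\cdot\nabla_x)u+\nabla_x\pi-\operatorname{div}_x\tau(Du)=-\int_{\mathbb R^3}(u-v)f\,dv,\\ &\operatorname{div}_x u=0, \end{aligned} $$ with unit total mass $\iint_{\mathbb T^3\times\mathbb R^3} f(0,x,v)\,dx\,dv=1$. Here "sufficiently regular" means: $f$ and $u$ are continuous on $t\ge0$ and $C^1$ on $t>0$; for each $t>0$, $\pi(t,\cdot)$ and $\tau(Du(t,\cdot))$ are $C^1$ in $x$ and the equations hold pointwise; $\int_{\mathbb R^3}(1+|v|)f(t,x,v)\,dv<\infty$ for all $t>0$ and $x$;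 and $(1+|v|^2)f(t)$ is integrable on $\mathbb T^3\times\mathbb R^3$ for each $t\ge0$, with integral bounded on each interval $0\le t\le T$. Assume that $\rho_f:=\int_{\mathbb R^3}f\,dv$ satisfies $$ \rho_f\in L^\infty(0,\infty;L^r(\mathbb T^3))\quad\text{for some } r\in \begin{cases} [\frac{6}{5p-6},\infty] & \text{if } \frac65\le p<2,\\ [\frac{3p}{5p-6},\infty] & \text{if } 2\le p<3,\\ (1,\infty] & \text{if } p=3,\\ [1,\infty] & \text{if } p>3, \end{cases} $$ where $\frac{6}{5p-6}:=\infty$ if $p=\frac65$. Set $v_c(t):=\iint_{\mathbb T^3\times\mathbb R^3} vf\,dx\,dv$, $u_c(t):=\int_{\mathbb T^3}u\,dx$, and $$ \mathcal E(t):=\frac12\iint_{\mathbb T^3\times\mathbb R^3}|v-v_c|^2f\,dx\,dv+\frac12\int_{\mathbb T^3}|u-u_c|^2\,dx+\frac14|u_c-v_c|^2 . $$ Then there is a constant $C_0>0$, independent of $t$, such that for all $t\ge0$ $$ \mathcal E(t)\le \begin{cases} \left(\mathcal E(0)^{\frac{2-p}{2}}+C_0\left(\frac p2-1\right)t\right)^{-\frac{2}{p-2}}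 & \text{if } p>2,\\ \mathcal E(0)e^{-C_0t} & \text{if } \frac65\le p\le2, \end{cases} $$ where, if $p>2$ and $\mathcal E(0)=0$, the estimate means $\mathcal E(t)=0$. -/

import Mathlib

open MeasureTheory Set
open scoped ENNReal NNReal

noncomputable section

namespace VlasovPowerLaw

/-- Euclidean space `ℝ³`. -/
abbrev E3 : Type := EuclideanSpace ℝ (Fin 3)

/-- The fundamental domain `[0,1)³` of the torus `𝕋³ = ℝ³ / ℤ³`. Functions on `𝕋³` are
`ℤ³`-periodic functions on `ℝ³`, and integrals over `𝕋³` are integrals over this cube. -/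
def cube : Set E3 := {x | ∀ i, x i ∈ Ico (0 : ℝ) 1}

/-- The Lebesgue measure of `𝕋³` (total mass one), carried by the fundamental domain. -/
def torusMeasure : Measure E3 := volume.restrict cube

/-- The Lebesgue measure `dx dv` of `𝕋³ × ℝ³`. -/
def phaseMeasure : Measure (E3 × E3) := torusMeasure.prod volume

/-- `ℤ³`-periodicity. -/
def IsPeriodic {F : Type*} (g : E3 → F) : Prop :=
  ∀ (x : E3) (i : Fin 3), g (x + EuclideanSpace.single i 1) = g x

/-- The partial derivative `∂_j g (x)`. -/
def partialD {F : Type*} [NormedAddCommGroup F] [NormedSpace ℝ F]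
    (j : Fin 3) (g : E3 → F) (x : E3) : F :=
  fderiv ℝ g x (EuclideanSpace.single j 1)

/-- The divergence `∑ i, ∂_i w_i (x)` of a vector field. -/
def divergence (w : E3 → E3) (x : E3) : ℝ := ∑ i, (partialD i w x) i

/-- The symmetric gradient `Dw = (∇w + (∇w)ᵀ) / 2`. -/
def symGrad (w : E3 → E3) (x : E3) : Matrix (Fin 3) (Fin 3) ℝ :=
  Matrix.of fun i j => ((partialD j w x) i + (partialD i w x) j) / 2

/-- The Euclidean (Frobenius) norm `|K|` of a matrix. -/
def frob (K : Matrix (Fin 3) (Fin 3) ℝ) : ℝ := √(∑ i, ∑ j, K i j ^ 2)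

/-- The power-law stress tensor `τ(K) = μ |K|^(p-2) K` (with `τ(0) = 0`). -/
def stress (μ p : ℝ) (K : Matrix (Fin 3) (Fin 3) ℝ) : Matrix (Fin 3) (Fin 3) ℝ :=
  (μ * frob K ^ (p - 2)) • K

/-- The macroscopic particle density `ρ_f(t,x) = ∫ f(t,x,v) dv`. -/
def density (f : ℝ → E3 → E3 → ℝ) (t : ℝ) (x : E3) : ℝ := ∫ v, f t x v

/-- A global classical solution `(f,u)`, with pressure `π`, of
`∂ₜf + v·∇ₓf + ∇ᵥ·((u-v)f) = 0`,
`∂ₜu + (u·∇)u + ∇π - div τ(Du) = -∫ (u-v) f dv`,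
`div u = 0` on `𝕋³ × ℝ³`, with locally (in time) bounded second velocity moment. -/
structure IsRegularSolution (μ p : ℝ) (f : ℝ → E3 → E3 → ℝ) (u : ℝ → E3 → E3)
    (π : ℝ → E3 → ℝ) : Prop where
  /-- `f`, `u`, `π` are functions on the torus in the variable `x`. -/
  periodic_f : ∀ t, 0 ≤ t → ∀ v, IsPeriodic fun x => f t x v
  periodic_u : ∀ t, 0 ≤ t → IsPeriodic (u t)
  periodic_pressure : ∀ t, 0 < t → IsPeriodic (π t)
  /-- `f` is a particle distribution function. -/
  nonneg_f : ∀ t, 0 ≤ t → ∀ x v, 0 ≤ f t x v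
  /-- `f` and `u` are continuous up to the initial time and `C¹` for positive times. -/
  continuous_f : ContinuousOn (fun z : ℝ × E3 × E3 => f z.1 z.2.1 z.2.2) (Ici 0 ×ˢ univ)
  contDiff_f : ContDiffOn ℝ 1 (fun z : ℝ × E3 × E3 => f z.1 z.2.1 z.2.2) (Ioi 0 ×ˢ univ)
  continuous_u : ContinuousOn (fun z : ℝ × E3 => u z.1 z.2) (Ici 0 ×ˢ univ)
  contDiff_u : ContDiffOn ℝ 1 (fun z : ℝ × E3 => u z.1 z.2) (Ioi 0 ×ˢ univ)
  /-- The pressure and the stress are `C¹` in space. -/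
  contDiff_pressure : ∀ t, 0 < t → ContDiff ℝ 1 (π t)
  contDiff_stress : ∀ t, 0 < t → ∀ i j,
    ContDiff ℝ 1 fun x => stress μ p (symGrad (u t) x) i j
  /-- `ρ_f(t,x)` and `∫ v f(t,x,v) dv` are well defined. -/
  integrable_slice : ∀ t, 0 < t → ∀ x, Integrable fun v => (1 + ‖v‖) * f t x v
  /-- `(1 + |v|²) f` is in `L^∞(0,T; L¹(𝕋³ × ℝ³))` for every `T`. -/
  integrable_moment : ∀ t, 0 ≤ t →
    Integrable (fun z : E3 × E3 => (1 + ‖z.2‖ ^ 2) * f t z.1 z.2) phaseMeasure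
  bounded_moment : ∀ T : ℝ, ∃ C : ℝ, ∀ t, 0 ≤ t → t ≤ T →
    ∫ z, (1 + ‖z.2‖ ^ 2) * f t z.1 z.2 ∂phaseMeasure ≤ C
  /-- The Vlasov equation. -/
  kinetic : ∀ t, 0 < t → ∀ x v,
    deriv (fun s => f s x v) t + fderiv ℝ (fun y => f t y v) x v
      + divergence (fun w => f t x w • (u t x - w)) v = 0
  /-- The momentum equation, componentwise. -/
  momentum : ∀ t, 0 < t → ∀ x i,
    (deriv (fun s => u s x) t) i + (fderiv ℝ (u t) x (u t x)) i + partialD i (π t) x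
      - ∑ j, partialD j (fun y => stress μ p (symGrad (u t) y) i j) x
      = - (∫ v, f t x v • (u t x - v)) i
  /-- Incompressibility. -/
  incompressible : ∀ t, 0 < t → ∀ x, divergence (u t) x = 0

/-- `v_c(t) = ∬ v f dx dv`. -/
def particleMean (f : ℝ → E3 → E3 → ℝ) (t : ℝ) : E3 :=
  ∫ z, f t z.1 z.2 • z.2 ∂phaseMeasure

/-- `u_c(t) = ∫ u dx`. -/
def fluidMean (u : ℝ → E3 → E3) (t : ℝ) : E3 := ∫ x, u t x ∂torusMeasure

/-- The modulated energy
`½ ∬ |v - v_c|² f dx dv + ½ ∫ |u - u_c|² dx + ¼ |u_c - v_c|²`. -/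
def modulatedEnergy (f : ℝ → E3 → E3 → ℝ) (u : ℝ → E3 → E3) (t : ℝ) : ℝ :=
  1 / 2 * ∫ z, ‖z.2 - particleMean f t‖ ^ 2 * f t z.1 z.2 ∂phaseMeasure
    + 1 / 2 * ∫ x, ‖u t x - fluidMean u t‖ ^ 2 ∂torusMeasure
    + 1 / 4 * ‖fluidMean u t - particleMean f t‖ ^ 2

/-- The admissible range of the integrability exponent `r ∈ [1,∞]` of the density. The quotients
are taken in `[0,∞]`, so that `6 / (5p - 6) = ∞` for `p = 6/5`. -/
def AdmissibleExponent (p : ℝ) (r : ℝ≥0∞) : Prop :=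
  (p < 2 → 6 / ENNReal.ofReal (5 * p - 6) ≤ r) ∧
  (2 ≤ p → p < 3 → ENNReal.ofReal (3 * p) / ENNReal.ofReal (5 * p - 6) ≤ r) ∧
  (p = 3 → 1 < r) ∧
  (3 < p → 1 ≤ r)

/-- `ρ_f ∈ L^∞(0,∞; L^r(𝕋³))`. -/
def DensityBounded (f : ℝ → E3 → E3 → ℝ) (r : ℝ≥0∞) : Prop :=
  ∃ M : ℝ≥0, ∀ᵐ t ∂(volume.restrict (Ioi (0 : ℝ))),
    eLpNorm (density f t) r torusMeasure ≤ M

end VlasovPowerLaw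

end

open VlasovPowerLaw

/-! ### Periodic functions and integration over the torus -/

namespace VlasovPowerLaw

section Periodic

open scoped Pointwise

/-! Since the mass is one and total momentum is conserved, the modulated energy `E` is the kinetic
energy of particles and fluid minus the constant `¼|v_c + u_c|²`. It therefore satisfies `E' = -D`
with `D = μ∫|Du|^p + ∬|u-v|² f`, and the theorem reduces to a lower bound for `D` by a power of `E`.
The energy law is used only integrated over `0 < s ≤ t` (`modulatedEnergy_sub`), together with
continuity of `E` at time zero.

Coercivity. Recentring the particle variance at `u_c` gives `E ≤ ∬|u-v|² f + ∫|u-u_c|² ρ_f +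
½∫|u-u_c|²` (`modulatedEnergy_le`). Hölder's inequality bounds the weighted term by `‖ρ_f‖_{L^r}`
times the square of the `L^{2r'}` norm of `u-u_c`, and the admissible range of `r` is what makes
that norm controlled by `‖Du‖_{L^p}`: a Korn–Sobolev inequality, replaced by Korn–Morrey when `r =
1` and `p > 3` (`exists_lintegral_sq_mul_le`). Hence `E ≤ ∬|u-v|² f + K (∫|Du|^p)^(2/p)`. Raising
this to the power `a = max(1, p/2)` and absorbing surplus powers of `E` by `E ≤ E(0)` gives `E^a ≤ κ
D`. As `E` is nonincreasing, `E(t) + c(t-s)E(t)^a ≤ E(s)` (`exists_decrement`), and comparison with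
an explicit ODE solution yields the two decay rates.

The Korn inequalities are proved without singular integrals. The form `⟨∇u ξ, ξ⟩` sees only `Du`, so
`Du` controls the variation of the component `⟨u, ξ⟩` along lines in the direction `ξ`. On the
torus, the two segments from `x` to `x+z` and to `x+z+e_i` end at the same point, and subtracting
their estimates isolates the `i`-th component of the oscillation (`enorm_sub_mean_le`). Averaging
over segments gives Poincaré and Morrey bounds. For the Sobolev bound, the Gagliardo–Nirenberg
argument runs along the axes of an orthonormal frame and controls only the product of the three
components; finitely many frames recover the full norm (`exists_finset_frames`).

The energy law needs the Vlasov equation tested against `1`, `v_i` and `|v|²`. It is first tested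
against compactly supported functions of `v`, then truncation is removed using the second moment
bound (`integral_sub_eq`). -/

lemma cube_eq_fundamentalDomain :
    cube = ZSpan.fundamentalDomain (EuclideanSpace.basisFun (Fin 3) ℝ).toBasis := by
  ext x
  simp [cube, ZSpan.mem_fundamentalDomain]

lemma measurableSet_cube : MeasurableSet cube := by
  rw [cube_eq_fundamentalDomain]
  exact ZSpan.fundamentalDomain_measurableSet _

/-- The lattice `ℤ³`. -/
abbrev lattice : Submodule ℤ E3 :=
  Submodule.span ℤ (range (EuclideanSpace.basisFun (Fin 3) ℝ).toBasis)

lemma isAddFundamentalDomain_cube : IsAddFundamentalDomain lattice cube (volume : Measure E3) := by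
  rw [cube_eq_fundamentalDomain]
  exact ZSpan.isAddFundamentalDomain _ _

lemma IsPeriodic.add_lattice {F : Type*} {g : E3 → F} (hg : IsPeriodic g) {l : E3}
    (hl : l ∈ lattice) (x : E3) : g (x + l) = g x := by
  induction hl using Submodule.span_induction generalizing x with
  | mem y hy =>
    obtain ⟨i, rfl⟩ := hy
    simpa using hg x i
  | zero => simp
  | add y z _ _ hy hz => rw [← add_assoc, hz, hy]
  | smul a y _ hy =>
    have hn : ∀ (n : ℕ) (x : E3), g (x + n • y) = g x := fun n => by
      induction n with
      | zero => simp
      | succ n ih => intro x; rw [succ_nsmul, ← add_assoc, hy, ih]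
    rcases Int.eq_nat_or_neg a with ⟨n, rfl | rfl⟩
    · simpa using hn n x
    · have := hn n (x + (-(n : ℤ)) • y)
      rw [← this]
      simp

lemma IsPeriodic.comp {F F' : Type*} {g : E3 → F} (hg : IsPeriodic g) (h : F → F') :
    IsPeriodic fun x => h (g x) := fun x i => congrArg h (hg x i)

lemma IsPeriodic.add_right {F : Type*} {g : E3 → F} (hg : IsPeriodic g) (y : E3) :
    IsPeriodic fun x => g (x + y) := fun x i => by
  simpa only [add_right_comm] using hg (x + y) i

lemma IsPeriodic.fderiv {F : Type*} [NormedAddCommGroup F] [NormedSpace ℝ F] {g : E3 → F}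
    (hg : IsPeriodic g) : IsPeriodic (_root_.fderiv ℝ g) := fun x i => by
  rw [← fderiv_comp_add_right, (funext fun y => hg y i :
    (fun y => g (y + EuclideanSpace.single i 1)) = g)]

instance : VAddCommClass E3 lattice E3 :=
  ⟨fun a b c => by simp only [vadd_eq_add, Submodule.vadd_def]; abel⟩

instance : VAddInvariantMeasure lattice E3 (volume : Measure E3) :=
  inferInstanceAs (VAddInvariantMeasure lattice.toAddSubgroup E3 (volume : Measure E3))

lemma isAddFundamentalDomain_vadd_cube (y : E3) :
    IsAddFundamentalDomain lattice (y +ᵥ cube) (volume : Measure E3) :=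
  isAddFundamentalDomain_cube.vadd_of_comm y

lemma preimage_vadd_cube (y : E3) : (fun x : E3 => x + y) ⁻¹' (y +ᵥ cube) = cube := by
  ext x
  simp [Set.mem_vadd_set, add_comm y]

/-- A translate of the cube is again a fundamental domain of the lattice, and an invariant function
has the same integral over all of them. -/
lemma lintegral_torus_add_right {g : E3 → ℝ≥0∞} (hg : IsPeriodic g) (y : E3) :
    ∫⁻ x, g (x + y) ∂torusMeasure = ∫⁻ x, g x ∂torusMeasure := by
  rw [torusMeasure, isAddFundamentalDomain_cube.setLIntegral_eq
    (isAddFundamentalDomain_vadd_cube y) g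
    (fun l x => by rw [Submodule.vadd_def, vadd_eq_add, add_comm]; exact hg.add_lattice l.2 x),
    ← (measurePreserving_add_right (volume : Measure E3) y).setLIntegral_comp_preimage_emb
      (measurableEmbedding_addRight y) g (y +ᵥ cube), preimage_vadd_cube]

lemma integral_torus_add_right {F : Type*} [NormedAddCommGroup F] [NormedSpace ℝ F] {g : E3 → F}
    (hg : IsPeriodic g) (y : E3) :
    ∫ x, g (x + y) ∂torusMeasure = ∫ x, g x ∂torusMeasure := by
  rw [torusMeasure, isAddFundamentalDomain_cube.setIntegral_eq
    (isAddFundamentalDomain_vadd_cube y) (f := g)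
    (fun l x => by rw [Submodule.vadd_def, vadd_eq_add, add_comm]; exact hg.add_lattice l.2 x),
    ← (measurePreserving_add_right (volume : Measure E3) y).setIntegral_preimage_emb
      (measurableEmbedding_addRight y) g (y +ᵥ cube), preimage_vadd_cube]

lemma isBounded_cube : Bornology.IsBounded cube := by
  rw [cube_eq_fundamentalDomain]
  exact ZSpan.fundamentalDomain_isBounded _

lemma volume_cube : volume cube = 1 := by
  rw [cube_eq_fundamentalDomain]
  rw [measure_congr (ZSpan.fundamentalDomain_ae_parallelepiped _ volume)]
  exact (EuclideanSpace.basisFun (Fin 3) ℝ).volume_parallelepiped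

instance : IsProbabilityMeasure torusMeasure :=
  ⟨by simp [torusMeasure, volume_cube]⟩

lemma exists_lattice_sub_mem_cube (x : E3) : ∃ l ∈ lattice, x - l ∈ cube := by
  obtain ⟨l, hl, -⟩ := ZSpan.exist_unique_vadd_mem_fundamentalDomain
    (EuclideanSpace.basisFun (Fin 3) ℝ).toBasis x
  refine ⟨-l, neg_mem l.2, ?_⟩
  rw [cube_eq_fundamentalDomain]
  rw [sub_neg_eq_add, add_comm]
  exact hl

lemma IsPeriodic.exists_mem_cube {F : Type*} {g : E3 → F} (hg : IsPeriodic g) (x : E3) :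
    ∃ y ∈ cube, g x = g y := by
  obtain ⟨l, hl, h⟩ := exists_lattice_sub_mem_cube x
  exact ⟨x - l, h, by rw [← hg.add_lattice hl (x - l), sub_add_cancel]⟩

/-- A bounded set is covered by finitely many translates of the fundamental domain. -/
lemma exists_setLIntegral_le_of_isBounded {B : Set E3} (hB : Bornology.IsBounded B) :
    ∃ N : ℕ, ∀ g : E3 → ℝ≥0∞, IsPeriodic g →
      ∫⁻ x in B, g x ≤ N * ∫⁻ x, g x ∂torusMeasure := by
  have hfin : Set.Finite {l : lattice | ((l +ᵥ cube) ∩ B).Nonempty} := by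
    obtain ⟨R, hR⟩ := hB.subset_closedBall 0
    obtain ⟨S, hS⟩ := isBounded_cube.subset_closedBall 0
    have hK : (Metric.closedBall (0 : E3) (R + S) ∩ (lattice : Set E3)).Finite :=
      Metric.finite_isBounded_inter_isClosed ⟨inferInstanceAs (DiscreteTopology lattice)⟩ Metric.isBounded_closedBall
        (by
          have : IsClosed (lattice.toAddSubgroup : Set E3) := inferInstance
          exact this)
    refine (hK.preimage (Subtype.val_injective.injOn (s := _))).subset ?_
    rintro l ⟨x, ⟨y, hy, rfl⟩, hx⟩
    refine ⟨?_, l.2⟩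
    have h1 := hR hx
    have h2 := hS hy
    simp only [mem_closedBall_zero_iff, vadd_eq_add] at h1 h2 ⊢
    calc ‖(l : E3)‖ = ‖((l : E3) + y) - y‖ := by simp
      _ ≤ R + S := (norm_sub_le _ _).trans (add_le_add h1 h2)
  refine ⟨hfin.toFinset.card, fun g hg => ?_⟩
  have hsub : B ⊆ ⋃ l : hfin.toFinset, ((l : lattice) +ᵥ cube) := by
    intro x hx
    obtain ⟨l, hl, h⟩ := exists_lattice_sub_mem_cube x
    have hm : x ∈ (⟨l, hl⟩ : lattice) +ᵥ cube := ⟨x - l, h, by simp⟩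
    simp only [mem_iUnion]
    exact ⟨⟨⟨l, hl⟩, by simpa using ⟨x, hm, hx⟩⟩, hm⟩
  calc ∫⁻ x in B, g x ≤ ∫⁻ x in ⋃ l : hfin.toFinset, ((l : lattice) +ᵥ cube), g x :=
        lintegral_mono_set hsub
    _ ≤ ∑ l ∈ hfin.toFinset, ∫⁻ x in l +ᵥ cube, g x := by
        refine (lintegral_iUnion_le _ _).trans_eq ?_
        rw [tsum_fintype,
          ← Finset.sum_coe_sort hfin.toFinset fun l => ∫⁻ x in l +ᵥ cube, g x]
    _ = ∑ l ∈ hfin.toFinset, ∫⁻ x, g x ∂torusMeasure := by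
        refine Finset.sum_congr rfl fun l _ => ?_
        exact ((isAddFundamentalDomain_vadd_cube (l : E3)).setLIntegral_eq
          isAddFundamentalDomain_cube g
          (fun l x => by rw [Submodule.vadd_def, vadd_eq_add, add_comm]; exact hg.add_lattice l.2 x))
    _ = _ := by simp

end Periodic

end VlasovPowerLaw

/-! ### Integration by parts on the torus and the symmetric gradient -/

namespace VlasovPowerLaw

lemma IsPeriodic.partialD {F : Type*} [NormedAddCommGroup F] [NormedSpace ℝ F] {g : E3 → F}
    (hg : IsPeriodic g) (j : Fin 3) : IsPeriodic (partialD j g) := fun x i => by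
  simp only [VlasovPowerLaw.partialD, hg.fderiv x i]

lemma IsPeriodic.exists_norm_le {F : Type*} [NormedAddCommGroup F] {g : E3 → F}
    (hg : IsPeriodic g) (hc : Continuous g) : ∃ C, ∀ x, ‖g x‖ ≤ C := by
  obtain ⟨C, hC⟩ := isBounded_cube.isCompact_closure.exists_bound_of_continuousOn hc.continuousOn
  refine ⟨C, fun x => ?_⟩
  obtain ⟨y, hy, h⟩ := hg.exists_mem_cube x
  rw [h]
  exact hC y (subset_closure hy)

lemma integrable_torus_of_continuous {F : Type*} [NormedAddCommGroup F] {g : E3 → F}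
    (hg : Continuous g) : Integrable g torusMeasure :=
  (hg.continuousOn.integrableOn_compact isBounded_cube.isCompact_closure).mono_set subset_closure

/-- The integral of `g (x + s • v)` does not depend on `s`; differentiating under the integral at `s
= 0` gives the claim and avoids face-by-face boundary terms. -/
lemma integral_torus_fderiv_eq_zero {g : E3 → ℝ} (hg : IsPeriodic g) (hc : ContDiff ℝ 1 g)
    (v : E3) : ∫ x, fderiv ℝ g x v ∂torusMeasure = 0 := by
  have hcd : Continuous fun x => fderiv ℝ g x v :=
    (hc.continuous_fderiv one_ne_zero).clm_apply continuous_const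
  have hper : IsPeriodic fun x => fderiv ℝ g x v := fun x i => by
    simp only [hg.fderiv x i]
  obtain ⟨C, hC⟩ := hper.exists_norm_le hcd
  have hder : ∀ x s, HasDerivAt (fun s : ℝ => g (x + s • v)) (fderiv ℝ g (x + s • v) v) s := by
    intro x s
    have h1 : HasDerivAt (fun s : ℝ => x + s • v) v s := by
      simpa using ((hasDerivAt_id s).smul_const v).const_add x
    exact ((hc.differentiable one_ne_zero _).hasFDerivAt).comp_hasDerivAt s h1
  have hsh : ∀ s : ℝ, Continuous fun x : E3 => x + s • v := fun s => by fun_prop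
  have h := (hasDerivAt_integral_of_dominated_loc_of_deriv_le (μ := torusMeasure)
    (F := fun s x => g (x + s • v)) (F' := fun s x => fderiv ℝ g (x + s • v) v) (x₀ := (0 : ℝ))
    (s := univ) (bound := fun _ => C) Filter.univ_mem
    (Filter.Eventually.of_forall fun s =>
      (hc.continuous.comp (hsh s)).aestronglyMeasurable)
    (integrable_torus_of_continuous (hc.continuous.comp (hsh 0)))
    (hcd.comp (hsh 0)).aestronglyMeasurable
    (Filter.Eventually.of_forall fun x s _ => hC _) (integrable_const C)
    (Filter.Eventually.of_forall fun x s _ => hder x s)).2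
  simp only [zero_smul, add_zero] at h
  have hconst : (fun s : ℝ => ∫ x, g (x + s • v) ∂torusMeasure) =
      fun _ => ∫ x, g x ∂torusMeasure := funext fun s => integral_torus_add_right hg _
  rw [hconst] at h
  exact h.unique (hasDerivAt_const _ _)

lemma IsPeriodic.mul {a b : E3 → ℝ} (ha : IsPeriodic a) (hb : IsPeriodic b) :
    IsPeriodic fun x => a x * b x := fun x i => by simp only [ha x i, hb x i]

lemma continuous_partialD {F : Type*} [NormedAddCommGroup F] [NormedSpace ℝ F] {g : E3 → F}
    (hg : ContDiff ℝ 1 g) (j : Fin 3) : Continuous (partialD j g) :=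
  (hg.continuous_fderiv one_ne_zero).clm_apply continuous_const

/-- Integration by parts on the torus. -/
lemma integral_torus_mul_partialD {a b : E3 → ℝ} (ha : IsPeriodic a) (hb : IsPeriodic b)
    (hac : ContDiff ℝ 1 a) (hbc : ContDiff ℝ 1 b) (j : Fin 3) :
    ∫ x, a x * partialD j b x ∂torusMeasure = -∫ x, partialD j a x * b x ∂torusMeasure := by
  have h := integral_torus_fderiv_eq_zero (ha.mul hb) (hac.mul hbc) (EuclideanSpace.single j 1)
  have h1 : ∀ x, fderiv ℝ (fun x => a x * b x) x (EuclideanSpace.single j 1) =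
      a x * partialD j b x + partialD j a x * b x := fun x => by
    rw [fderiv_fun_mul (hac.differentiable one_ne_zero x) (hbc.differentiable one_ne_zero x)]
    simp [partialD, mul_comm]
  simp only [h1] at h
  have h2 := integral_add (integrable_torus_of_continuous
      (hac.continuous.mul (continuous_partialD hbc j)))
    (integrable_torus_of_continuous ((continuous_partialD hac j).mul hbc.continuous))
  simp only [Pi.mul_apply] at h2
  linarith

lemma fderiv_apply_eq_sum {F : Type*} [NormedAddCommGroup F] [NormedSpace ℝ F] (g : E3 → F)
    (x ξ : E3) : fderiv ℝ g x ξ = ∑ j, ξ j • partialD j g x := by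
  conv_lhs => rw [← (EuclideanSpace.basisFun (Fin 3) ℝ).sum_repr ξ]
  simp [partialD, map_sum]

lemma frob_nonneg (K : Matrix (Fin 3) (Fin 3) ℝ) : 0 ≤ frob K := Real.sqrt_nonneg _

lemma frob_sq (K : Matrix (Fin 3) (Fin 3) ℝ) : frob K ^ 2 = ∑ i, ∑ j, K i j ^ 2 :=
  Real.sq_sqrt (Finset.sum_nonneg fun _ _ => Finset.sum_nonneg fun _ _ => sq_nonneg _)

/-- The quadratic form of the gradient only sees the symmetric gradient. -/
lemma abs_inner_fderiv_le (u : E3 → E3) (x ξ : E3) :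
    |inner ℝ (fderiv ℝ u x ξ) ξ| ≤ frob (symGrad u x) * ‖ξ‖ ^ 2 := by
  have h1 : inner ℝ (fderiv ℝ u x ξ) ξ = ∑ i, ∑ j, symGrad u x i j * (ξ i * ξ j) := by
    rw [fderiv_apply_eq_sum]
    simp only [PiLp.inner_apply, symGrad, Fin.sum_univ_three, Matrix.of_apply, PiLp.add_apply,
      PiLp.smul_apply, RCLike.inner_apply, conj_trivial, smul_eq_mul]
    ring
  have h2 : (∑ i, ∑ j, symGrad u x i j * (ξ i * ξ j)) ^ 2 ≤
      (frob (symGrad u x) * ‖ξ‖ ^ 2) ^ 2 := by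
    have hcs := Finset.sum_mul_sq_le_sq_mul_sq (Finset.univ : Finset (Fin 3 × Fin 3))
      (fun z => symGrad u x z.1 z.2) (fun z => ξ z.1 * ξ z.2)
    simp only [Fintype.sum_prod_type] at hcs
    refine hcs.trans_eq ?_
    rw [mul_pow, frob_sq, EuclideanSpace.norm_sq_eq]
    congr 1
    simp only [Fin.sum_univ_three, Real.norm_eq_abs, sq_abs]
    ring
  rw [h1]
  exact abs_le_of_sq_le_sq h2 (mul_nonneg (frob_nonneg _) (sq_nonneg _))

lemma continuous_symGrad {u : E3 → E3} (hu : ContDiff ℝ 1 u) : Continuous (symGrad u) := by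
  refine continuous_pi fun i => continuous_pi fun j => ?_
  have h : ∀ k l, Continuous fun x => (partialD k u x) l := fun k l =>
    (EuclideanSpace.proj (𝕜 := ℝ) l).continuous.comp (continuous_partialD hu k)
  exact ((h j i).add (h i j)).div_const 2

lemma continuous_frob : Continuous frob := by
  unfold frob
  fun_prop

lemma IsPeriodic.symGrad {u : E3 → E3} (hu : IsPeriodic u) : IsPeriodic (symGrad u) :=
  fun x i => by
    ext k l
    simp only [VlasovPowerLaw.symGrad, Matrix.of_apply, hu.partialD _ x i]

end VlasovPowerLaw

/-! ### Korn–Poincaré inequality by averaging over segments -/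

namespace VlasovPowerLaw

/-- The pointwise size of the symmetric gradient. -/
noncomputable def strain (u : E3 → E3) (x : E3) : ℝ≥0∞ := ENNReal.ofReal (frob (symGrad u x))

lemma continuous_strain {u : E3 → E3} (hu : ContDiff ℝ 1 u) : Continuous (strain u) :=
  ENNReal.continuous_ofReal.comp (continuous_frob.comp (continuous_symGrad hu))

lemma IsPeriodic.strain {u : E3 → E3} (hu : IsPeriodic u) : IsPeriodic (strain u) :=
  hu.symGrad.comp fun K => ENNReal.ofReal (frob K)

/-- The mean of `G` over the segments from `x` to the points of a ball around `x`. -/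
noncomputable def segmentIntegral (G : E3 → ℝ≥0∞) (x : E3) : ℝ≥0∞ :=
  ∫⁻ z in Metric.closedBall (0 : E3) 3, ∫⁻ s in Ioc (0 : ℝ) 1, G (x + s • z)

/-- The fundamental theorem of calculus for `⟨u, ξ⟩` along the segment in the same direction `ξ`:
the derivative is the quadratic form of the gradient, hence bounded by the strain. -/
lemma enorm_inner_sub_le {u : E3 → E3} (hu : ContDiff ℝ 1 u) (x ξ : E3) :
    ‖inner ℝ (u (x + ξ) - u x) ξ‖ₑ ≤
      ENNReal.ofReal (‖ξ‖ ^ 2) * ∫⁻ s in Ioc (0 : ℝ) 1, strain u (x + s • ξ) := by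
  have hline : Continuous fun s : ℝ => x + s • ξ := by fun_prop
  have hder : ∀ s : ℝ, HasDerivAt (fun s : ℝ => inner ℝ (u (x + s • ξ)) ξ)
      (inner ℝ (fderiv ℝ u (x + s • ξ) ξ) ξ) s := by
    intro s
    have h1 : HasDerivAt (fun s : ℝ => x + s • ξ) ξ s := by
      simpa using ((hasDerivAt_id s).smul_const ξ).const_add x
    have h2 := ((hu.differentiable one_ne_zero _).hasFDerivAt).comp_hasDerivAt s h1
    simpa using h2.inner ℝ (hasDerivAt_const s ξ)
  have hcont : Continuous fun s : ℝ => inner ℝ (fderiv ℝ u (x + s • ξ) ξ) ξ :=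
    (((hu.continuous_fderiv one_ne_zero).comp hline).clm_apply continuous_const).inner
      continuous_const
  have hftc : ∫ s in (0 : ℝ)..1, inner ℝ (fderiv ℝ u (x + s • ξ) ξ) ξ =
      inner ℝ (u (x + ξ) - u x) ξ := by
    rw [intervalIntegral.integral_eq_sub_of_hasDerivAt (fun s _ => hder s)
      (hcont.intervalIntegrable _ _)]
    simp [inner_sub_left]
  rw [← hftc, intervalIntegral.integral_of_le zero_le_one]
  refine (enorm_integral_le_lintegral_enorm _).trans ?_
  rw [← lintegral_const_mul' _ _ ENNReal.ofReal_ne_top]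
  refine lintegral_mono fun s => ?_
  rw [strain, ← ENNReal.ofReal_mul (sq_nonneg _), Real.enorm_eq_ofReal_abs, mul_comm]
  exact ENNReal.ofReal_le_ofReal (abs_inner_fderiv_le _ _ _)

lemma norm_le_two_of_mem_cube {z : E3} (hz : z ∈ cube) : ‖z‖ ≤ 2 := by
  have h : ‖z‖ ^ 2 ≤ 2 ^ 2 := by
    rw [EuclideanSpace.norm_sq_eq]
    have hi : ∀ i, ‖z i‖ ^ 2 ≤ 1 := fun i => by
      have := hz i
      rw [Real.norm_eq_abs, sq_abs]
      nlinarith [this.1, this.2]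
    calc ∑ i, ‖z i‖ ^ 2 ≤ ∑ _i : Fin 3, (1 : ℝ) := Finset.sum_le_sum fun i _ => hi i
      _ ≤ 2 ^ 2 := by norm_num
  exact le_of_sq_le_sq h (by norm_num)

lemma measurable_segment {G : E3 → ℝ≥0∞} (hG : Measurable G) (x : E3) :
    Measurable fun w : E3 × ℝ => G (x + w.2 • w.1) :=
  hG.comp (by fun_prop)

/-- A Korn type estimate on the torus, pointwise: the oscillation of a vector field is controlled
by its symmetric gradient. -/
lemma enorm_sub_mean_le {u : E3 → E3} (hu : ContDiff ℝ 1 u) (hper : IsPeriodic u) (x : E3) :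
    ‖u x - ∫ y, u y ∂torusMeasure‖ₑ ≤ 54 * segmentIntegral (strain u) x := by
  set S : E3 → ℝ≥0∞ := fun ξ => ∫⁻ s in Ioc (0 : ℝ) 1, strain u (x + s • ξ) with hS
  have hSm : Measurable S :=
    (measurable_segment (continuous_strain hu).measurable x).lintegral_prod_right'
  have hA : ∀ ξ : E3, ‖ξ‖ ≤ 3 → ‖inner ℝ (u (x + ξ) - u x) ξ‖ₑ ≤ 9 * S ξ := by
    intro ξ hξ
    refine (enorm_inner_sub_le hu x ξ).trans ?_
    gcongr
    exact ENNReal.ofReal_le_of_le_toReal (by norm_num; nlinarith [norm_nonneg ξ])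
  have hnorm : ∀ (i : Fin 3) (z : E3), z ∈ cube → ‖z + EuclideanSpace.single i 1‖ ≤ 3 := by
    intro i z hz
    refine (norm_add_le _ _).trans ?_
    have h1 : ‖EuclideanSpace.single i (1 : ℝ)‖ = 1 := by simp
    linarith [norm_le_two_of_mem_cube hz]
  -- By periodicity `u (x+z+e_i) = u (x+z)`, so the estimates in the directions `z+e_i` and `z`
  -- concern the same difference `u (x+z) - u x`. Their difference is its inner product with `e_i`.
  -- Both directions have length at most `3`, whence the factor `9` and the radius of the ball.
  have hcomp : ∀ (i : Fin 3), ∀ z ∈ cube, ‖(u (x + z) - u x) i‖ₑ ≤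
      9 * S (z + EuclideanSpace.single i 1) + 9 * S z := by
    intro i z hz
    have h1 := hA _ (hnorm i z hz)
    have h2 := hA z ((norm_le_two_of_mem_cube hz).trans (by norm_num))
    rw [← add_assoc, hper] at h1
    have h3 : (u (x + z) - u x) i =
        inner ℝ (u (x + z) - u x) (z + EuclideanSpace.single i 1) -
          inner ℝ (u (x + z) - u x) z := by
      rw [inner_add_right, add_sub_cancel_left, EuclideanSpace.inner_single_right]
      simp
    rw [h3]
    exact enorm_sub_le.trans (add_le_add h1 h2)
  have hcube : ∀ v : E3, (∀ z ∈ cube, ‖z + v‖ ≤ 3) →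
      ∫⁻ z, S (z + v) ∂torusMeasure ≤ segmentIntegral (strain u) x := by
    intro v hv
    have h1 := (measurePreserving_add_right (volume : Measure E3) v).setLIntegral_comp_preimage
      Metric.isClosed_closedBall.measurableSet hSm (s := Metric.closedBall (0 : E3) 3)
    rw [segmentIntegral, ← h1]
    exact lintegral_mono_set fun z hz => mem_closedBall_zero_iff.2 (hv z hz)
  have hi : ∀ i, ‖(u x - ∫ y, u y ∂torusMeasure) i‖ₑ ≤ 18 * segmentIntegral (strain u) x := by
    intro i
    have hint : Integrable (fun z => u (x + z) - u x) torusMeasure :=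
      integrable_torus_of_continuous (by have := hu.continuous; fun_prop)
    have h1 : (u x - ∫ y, u y ∂torusMeasure) i =
        -∫ z, (u (x + z) - u x) i ∂torusMeasure := by
      have h2 : ∫ z, (u (x + z) - u x) i ∂torusMeasure =
          (∫ z, (u (x + z) - u x) ∂torusMeasure) i :=
        (EuclideanSpace.proj (𝕜 := ℝ) i).integral_comp_comm hint
      have h3 : ∫ z, (u (x + z) - u x) ∂torusMeasure = (∫ y, u y ∂torusMeasure) - u x := by
        rw [integral_sub (integrable_torus_of_continuous (by have := hu.continuous; fun_prop))
          (integrable_const _), integral_const]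
        simp only [add_comm x, integral_torus_add_right hper]
        simp
      rw [h2, h3]
      simp
    rw [h1, enorm_neg]
    calc ‖∫ z, (u (x + z) - u x) i ∂torusMeasure‖ₑ
        ≤ ∫⁻ z, ‖(u (x + z) - u x) i‖ₑ ∂torusMeasure := enorm_integral_le_lintegral_enorm _
      _ ≤ ∫⁻ z, (9 * S (z + EuclideanSpace.single i 1) + 9 * S (z + 0)) ∂torusMeasure := by
          refine setLIntegral_mono' measurableSet_cube fun z hz => ?_
          rw [add_zero]
          exact hcomp i z hz
      _ = 9 * ∫⁻ z, S (z + EuclideanSpace.single i 1) ∂torusMeasure +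
          9 * ∫⁻ z, S (z + 0) ∂torusMeasure := by
          rw [lintegral_add_left (by fun_prop), lintegral_const_mul _ (by fun_prop),
            lintegral_const_mul _ (by fun_prop)]
      _ ≤ 9 * segmentIntegral (strain u) x + 9 * segmentIntegral (strain u) x := by
          gcongr
          · exact hcube _ (hnorm i)
          · refine hcube _ fun z hz => ?_
            rw [add_zero]
            exact (norm_le_two_of_mem_cube hz).trans (by norm_num)
      _ = 18 * segmentIntegral (strain u) x := by rw [← add_mul]; norm_num
  set w := u x - ∫ y, u y ∂torusMeasure
  calc ‖w‖ₑ = ‖∑ i, EuclideanSpace.single i (w i)‖ₑ := by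
        congr 1
        ext j
        fin_cases j <;> simp [Fin.sum_univ_three]
    _ ≤ ∑ i, ‖EuclideanSpace.single i (w i)‖ₑ := enorm_sum_le _ _
    _ = ∑ i, ‖w i‖ₑ := by
        refine Finset.sum_congr rfl fun i _ => ?_
        rw [enorm_eq_iff_norm_eq, PiLp.norm_single]
    _ ≤ ∑ _i : Fin 3, 18 * segmentIntegral (strain u) x := Finset.sum_le_sum fun i _ => hi i
    _ = 54 * segmentIntegral (strain u) x := by
        rw [Finset.sum_const, Finset.card_univ, Fintype.card_fin, nsmul_eq_mul, ← mul_assoc]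
        norm_num

/-- Jensen's inequality for powers and a finite measure. -/
lemma lintegral_rpow_le_measure_univ_rpow_mul {α : Type*} [MeasurableSpace α] {ν : Measure α}
    {F : α → ℝ≥0∞} (hF : AEMeasurable F ν) {p : ℝ} (hp : 1 ≤ p) :
    (∫⁻ a, F a ∂ν) ^ p ≤ ν univ ^ (p - 1) * ∫⁻ a, F a ^ p ∂ν := by
  have hp0 : 0 < p := by linarith
  have h := eLpNorm'_le_eLpNorm'_mul_rpow_measure_univ (μ := ν) zero_lt_one hp
    hF.aestronglyMeasurable
  simp only [eLpNorm', enorm_eq_self, ENNReal.rpow_one, div_one] at h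
  refine (ENNReal.rpow_le_rpow h hp0.le).trans_eq ?_
  rw [ENNReal.mul_rpow_of_nonneg _ _ hp0.le, ← ENNReal.rpow_mul, ← ENNReal.rpow_mul]
  rw [one_div_mul_cancel hp0.ne', ENNReal.rpow_one, mul_comm]
  congr 2
  field_simp

lemma segmentIntegral_eq {G : E3 → ℝ≥0∞} (hG : Measurable G) (x : E3) :
    segmentIntegral G x = ∫⁻ w, G (x + w.2 • w.1)
      ∂((volume.restrict (Metric.closedBall (0 : E3) 3)).prod (volume.restrict (Ioc (0 : ℝ) 1))) :=
  (lintegral_prod _ (measurable_segment hG x).aemeasurable).symm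

/-- The `L^p` bound for `segmentIntegral` on the torus. -/
lemma lintegral_segmentIntegral_rpow_le {G : E3 → ℝ≥0∞} (hG : Measurable G) (hper : IsPeriodic G)
    {p : ℝ} (hp : 1 ≤ p) :
    ∫⁻ x, segmentIntegral G x ^ p ∂torusMeasure ≤
      volume (Metric.closedBall (0 : E3) 3) ^ p * ∫⁻ x, G x ^ p ∂torusMeasure := by
  set ν := (volume.restrict (Metric.closedBall (0 : E3) 3)).prod (volume.restrict (Ioc (0 : ℝ) 1))
  have hν : ν univ = volume (Metric.closedBall (0 : E3) 3) := by
    simp [ν, Measure.prod_apply]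
  have hm : Measurable fun w : E3 × E3 × ℝ => G (w.1 + w.2.2 • w.2.1) ^ p :=
    (hG.comp (by fun_prop)).pow_const _
  calc ∫⁻ x, segmentIntegral G x ^ p ∂torusMeasure
      ≤ ∫⁻ x, ν univ ^ (p - 1) * ∫⁻ w, G (x + w.2 • w.1) ^ p ∂ν ∂torusMeasure := by
        refine lintegral_mono fun x => ?_
        rw [segmentIntegral_eq hG]
        exact lintegral_rpow_le_measure_univ_rpow_mul (measurable_segment hG x).aemeasurable hp
    _ = ν univ ^ (p - 1) * ∫⁻ x, ∫⁻ w, G (x + w.2 • w.1) ^ p ∂ν ∂torusMeasure :=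
        -- Next, Tonelli puts the torus integral inside, where translation invariance removes the
        -- shift `s • z`.
        lintegral_const_mul _ hm.lintegral_prod_right'
    _ = ν univ ^ (p - 1) * ∫⁻ w, ∫⁻ x, G (x + w.2 • w.1) ^ p ∂torusMeasure ∂ν := by
        rw [lintegral_lintegral_swap hm.aemeasurable]
    _ = ν univ ^ (p - 1) * (ν univ * ∫⁻ x, G x ^ p ∂torusMeasure) := by
        simp only [lintegral_torus_add_right (hper.comp fun a => a ^ p)]
        rw [lintegral_const, mul_comm (ν univ)]
    _ = _ := by
        rw [← mul_assoc, hν]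
        congr 1
        have hpos : volume (Metric.closedBall (0 : E3) 3) ≠ 0 :=
          (Metric.measure_closedBall_pos volume _ (by norm_num)).ne'
        have htop : volume (Metric.closedBall (0 : E3) 3) ≠ ∞ := measure_closedBall_lt_top.ne
        nth_rewrite 2 [← ENNReal.rpow_one (volume (Metric.closedBall (0 : E3) 3))]
        rw [← ENNReal.rpow_add _ _ hpos htop]
        congr 1
        ring

/-- A Korn–Poincaré inequality on the torus. -/
lemma lintegral_enorm_sub_mean_rpow_le {p : ℝ} (hp : 1 ≤ p) : ∃ C : ℝ≥0, ∀ u : E3 → E3,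
    ContDiff ℝ 1 u → IsPeriodic u →
      ∫⁻ x, ‖u x - ∫ y, u y ∂torusMeasure‖ₑ ^ p ∂torusMeasure ≤
        C * ∫⁻ x, strain u x ^ p ∂torusMeasure := by
  have hp0 : 0 ≤ p := by linarith
  have htop : ((54 : ℝ≥0∞) * volume (Metric.closedBall (0 : E3) 3)) ^ p ≠ ∞ :=
    ENNReal.rpow_ne_top_of_nonneg hp0
      (ENNReal.mul_ne_top (by norm_num) measure_closedBall_lt_top.ne)
  refine ⟨(((54 : ℝ≥0∞) * volume (Metric.closedBall (0 : E3) 3)) ^ p).toNNReal,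
    fun u hu hper => ?_⟩
  rw [ENNReal.coe_toNNReal htop]
  calc ∫⁻ x, ‖u x - ∫ y, u y ∂torusMeasure‖ₑ ^ p ∂torusMeasure
      ≤ ∫⁻ x, 54 ^ p * segmentIntegral (strain u) x ^ p ∂torusMeasure := by
        refine lintegral_mono fun x => ?_
        rw [← ENNReal.mul_rpow_of_nonneg _ _ hp0]
        exact ENNReal.rpow_le_rpow (enorm_sub_mean_le hu hper x) hp0
    _ = 54 ^ p * ∫⁻ x, segmentIntegral (strain u) x ^ p ∂torusMeasure :=
        lintegral_const_mul' _ _ (ENNReal.rpow_ne_top_of_nonneg hp0 (by norm_num))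
    _ ≤ _ := by
        rw [ENNReal.mul_rpow_of_nonneg _ _ hp0, mul_assoc]
        gcongr
        exact lintegral_segmentIntegral_rpow_le (continuous_strain hu).measurable hper.strain hp

end VlasovPowerLaw

/-! ### Korn–Morrey inequality for exponents above three -/

namespace VlasovPowerLaw

/-- Change of variables with Jacobian `s⁻³`; for `s ≤ 1` the dilated ball stays inside the original
one. -/
lemma setLIntegral_closedBall_comp_smul_le {F : E3 → ℝ≥0∞} (hF : Measurable F) {s : ℝ}
    (hs : 0 < s) (hs1 : s ≤ 1) (R : ℝ) :
    ∫⁻ z in Metric.closedBall (0 : E3) R, F (s • z) ≤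
      ENNReal.ofReal (s ^ (-3 : ℝ)) * ∫⁻ z in Metric.closedBall (0 : E3) R, F z := by
  have hB : MeasurableSet (Metric.closedBall (0 : E3) R) := Metric.isClosed_closedBall.measurableSet
  have hpow : |(s ^ Module.finrank ℝ E3)⁻¹| = s ^ (-3 : ℝ) := by
    rw [finrank_euclideanSpace_fin, abs_of_pos (by positivity), Real.rpow_neg hs.le]
    norm_cast
  calc ∫⁻ z in Metric.closedBall (0 : E3) R, F (s • z)
      ≤ ∫⁻ z, (Metric.closedBall (0 : E3) R).indicator F (s • z) := by
        rw [← lintegral_indicator hB]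
        refine lintegral_mono fun z => ?_
        by_cases hz : z ∈ Metric.closedBall (0 : E3) R
        · have hz' : s • z ∈ Metric.closedBall (0 : E3) R := by
            rw [mem_closedBall_zero_iff] at hz ⊢
            rw [norm_smul, Real.norm_of_nonneg hs.le]
            exact (mul_le_of_le_one_left (norm_nonneg _) hs1).trans hz
          rw [indicator_of_mem hz, indicator_of_mem hz']
        · simp [indicator_of_notMem hz]
    _ = ∫⁻ z, (Metric.closedBall (0 : E3) R).indicator F z
          ∂(Measure.map (s • ·) (volume : Measure E3)) :=
        (lintegral_map (hF.indicator hB) (measurable_const_smul s)).symm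
    _ = _ := by
        rw [Measure.map_addHaar_smul _ hs.ne', lintegral_smul_measure, lintegral_indicator hB,
          hpow, smul_eq_mul]

/-- A Morrey type estimate for `segmentIntegral`. -/
lemma segmentIntegral_le {p : ℝ} (hp : 3 < p) : ∃ C : ℝ≥0, ∀ G : E3 → ℝ≥0∞, Measurable G →
    IsPeriodic G → ∀ x, segmentIntegral G x ≤ C * (∫⁻ y, G y ^ p ∂torusMeasure) ^ (1 / p) := by
  have hp0 : 0 < p := by linarith
  obtain ⟨N, hN⟩ := exists_setLIntegral_le_of_isBounded (Metric.isBounded_closedBall (x := (0 : E3))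
    (r := 3))
  set V := volume (Metric.closedBall (0 : E3) 3) with hV
  have hVtop : V ≠ ∞ := measure_closedBall_lt_top.ne
  set A : ℝ≥0∞ := (V ^ (p - 1) * N) ^ (1 / p) with hA
  have hAtop : A ≠ ∞ := ENNReal.rpow_ne_top_of_nonneg (by positivity)
    (ENNReal.mul_ne_top (ENNReal.rpow_ne_top_of_nonneg (by linarith) hVtop) (by simp))
  -- This integral is finite exactly because `p > 3`. The weight `s^(-3/p)` is the `p`-th root of
  -- the Jacobian after Jensen on the ball.
  set L : ℝ≥0∞ := ∫⁻ s in Ioc (0 : ℝ) 1, ENNReal.ofReal (s ^ (-3 / p)) with hL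
  have hLtop : L ≠ ∞ := by
    have hi : IntervalIntegrable (fun s : ℝ => s ^ (-3 / p)) volume 0 1 :=
      intervalIntegral.intervalIntegrable_rpow' (by rw [lt_div_iff₀ hp0]; linarith)
    rw [intervalIntegrable_iff_integrableOn_Ioc_of_le zero_le_one] at hi
    exact hi.lintegral_lt_top.ne
  refine ⟨(A * L).toNNReal, fun G hG hper x => ?_⟩
  rw [ENNReal.coe_toNNReal (ENNReal.mul_ne_top hAtop hLtop)]
  set I := ∫⁻ y, G y ^ p ∂torusMeasure
  have hslice : ∀ s ∈ Ioc (0 : ℝ) 1, ∫⁻ z in Metric.closedBall (0 : E3) 3, G (x + s • z) ≤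
      A * I ^ (1 / p) * ENNReal.ofReal (s ^ (-3 / p)) := by
    intro s hs
    have h1 : (∫⁻ z in Metric.closedBall (0 : E3) 3, G (x + s • z)) ^ p ≤
        V ^ (p - 1) * (ENNReal.ofReal (s ^ (-3 : ℝ)) * (N * I)) := by
      refine (lintegral_rpow_le_measure_univ_rpow_mul
        (hG.comp (by fun_prop)).aemeasurable (by linarith)).trans ?_
      rw [Measure.restrict_apply_univ]
      gcongr
      refine (setLIntegral_closedBall_comp_smul_le (F := fun z => G (x + z) ^ p)
        ((hG.comp (by fun_prop)).pow_const _) hs.1 hs.2 3).trans ?_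
      gcongr
      have hper' : IsPeriodic fun z => G (x + z) ^ p := by
        have := (hper.add_right x).comp fun a => a ^ p
        simpa only [add_comm x] using this
      refine (hN _ hper').trans_eq ?_
      have := lintegral_torus_add_right (hper.comp fun a => a ^ p) x
      simp only [add_comm x]
      rw [this]
    have h2 := ENNReal.rpow_le_rpow h1 (z := 1 / p) (by positivity)
    rw [← ENNReal.rpow_mul, mul_one_div_cancel hp0.ne', ENNReal.rpow_one] at h2
    refine h2.trans_eq ?_
    have h3 : ENNReal.ofReal (s ^ (-3 / p)) = ENNReal.ofReal (s ^ (-3 : ℝ)) ^ (1 / p) := by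
      rw [ENNReal.ofReal_rpow_of_nonneg (Real.rpow_nonneg hs.1.le _) (by positivity),
        ← Real.rpow_mul hs.1.le]
      congr 2
      ring
    rw [h3, hA, ← ENNReal.mul_rpow_of_nonneg _ _ (by positivity),
      ← ENNReal.mul_rpow_of_nonneg _ _ (by positivity)]
    congr 1
    ring
  calc segmentIntegral G x
      = ∫⁻ s in Ioc (0 : ℝ) 1, ∫⁻ z in Metric.closedBall (0 : E3) 3, G (x + s • z) := by
        rw [segmentIntegral]
        exact lintegral_lintegral_swap (measurable_segment hG x).aemeasurable
    _ ≤ ∫⁻ s in Ioc (0 : ℝ) 1, A * I ^ (1 / p) * ENNReal.ofReal (s ^ (-3 / p)) :=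
        setLIntegral_mono' measurableSet_Ioc hslice
    _ = A * L * I ^ (1 / p) := by
        rw [lintegral_const_mul _ (by fun_prop), hL]
        ring

/-- A Korn–Morrey inequality on the torus. -/
lemma enorm_sub_mean_le_of_three_lt {p : ℝ} (hp : 3 < p) : ∃ C : ℝ≥0, ∀ u : E3 → E3,
    ContDiff ℝ 1 u → IsPeriodic u → ∀ x,
      ‖u x - ∫ y, u y ∂torusMeasure‖ₑ ≤
        C * (∫⁻ y, strain u y ^ p ∂torusMeasure) ^ (1 / p) := by
  obtain ⟨C, hC⟩ := segmentIntegral_le hp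
  refine ⟨54 * C, fun u hu hper x => (enorm_sub_mean_le hu hper x).trans ?_⟩
  push_cast
  rw [mul_assoc]
  gcongr
  exact hC _ (continuous_strain hu).measurable hper.strain x

end VlasovPowerLaw

/-! ### Korn–Sobolev inequality on the whole space -/

namespace VlasovPowerLaw

/-- One-dimensional Sobolev estimate along a line in the direction `b`, for the `b`-component. -/
lemma enorm_inner_rpow_le_lintegral_line {w : E3 → E3} (hw : ContDiff ℝ 1 w)
    (hsupp : HasCompactSupport w) {H : E3 → ℝ≥0∞}
    (hH : ∀ x ξ, ‖ξ‖ = 1 → ‖inner ℝ (fderiv ℝ w x ξ) ξ‖ₑ ≤ H x) {γ : ℝ≥0} (hγ : 1 < γ)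
    (a : E3) {b : E3} (hb : ‖b‖ = 1) (t₀ : ℝ) :
    ‖inner ℝ (w (a + t₀ • b)) b‖ₑ ^ (γ : ℝ) ≤
      ∫⁻ t : ℝ, γ * ‖w (a + t • b)‖ₑ ^ ((γ : ℝ) - 1) * H (a + t • b) := by
  have hγ1 : (1 : ℝ) < γ := hγ
  set h : ℝ → ℝ := fun t => inner ℝ (w (a + t • b)) b with hh
  have hline : ContDiff ℝ 1 fun t : ℝ => a + t • b := by fun_prop
  have hhc : ContDiff ℝ 1 h := (hw.comp hline).inner ℝ contDiff_const
  have hcs : HasCompactSupport fun t : ℝ => w (a + t • b) := by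
    have hb0 : b ≠ 0 := fun h0 => by simp [h0] at hb
    exact hsupp.comp_isClosedEmbedding
      ((Homeomorph.addLeft a).isClosedEmbedding.comp (isClosedEmbedding_smul_left hb0))
  have hcs' : HasCompactSupport fun t : ℝ => ‖h t‖ ^ (γ : ℝ) :=
    hcs.comp_left (g := fun v : E3 => ‖(inner ℝ v b : ℝ)‖ ^ (γ : ℝ))
      (by simp [Real.zero_rpow (by linarith : (γ : ℝ) ≠ 0)])
  have hder : ∀ t, HasDerivAt h (inner ℝ (fderiv ℝ w (a + t • b) b) b) t := by
    intro t
    have h1 : HasDerivAt (fun s : ℝ => a + s • b) b t := by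
      simpa using ((hasDerivAt_id t).smul_const b).const_add a
    have h2 := ((hw.differentiable one_ne_zero _).hasFDerivAt).comp_hasDerivAt t h1
    simpa using h2.inner ℝ (hasDerivAt_const t b)
  -- `|h|^γ` is `C¹` because `γ > 1` and has compact support on the line, so its value is at most
  -- the integral of the absolute value of its derivative.
  have hmain := hcs'.enorm_le_lintegral_Ici_deriv (hhc.norm_rpow hγ1) t₀
  rw [Real.enorm_rpow_of_nonneg (norm_nonneg _) (by positivity), enorm_norm] at hmain
  refine hmain.trans ((setLIntegral_le_lintegral _ _).trans (lintegral_mono fun t => ?_))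
  have h3 : ‖deriv (fun t => ‖h t‖ ^ (γ : ℝ)) t‖ₑ ≤ γ * ‖h t‖ₑ ^ ((γ : ℝ) - 1) * ‖deriv h t‖ₑ := by
    have := enorm_fderiv_norm_rpow_le (hhc.differentiable one_ne_zero) (x := t) hγ
    rwa [enorm_eq_iff_norm_eq.2 (norm_deriv_eq_norm_fderiv (f := h)).symm,
      enorm_eq_iff_norm_eq.2 (norm_deriv_eq_norm_fderiv).symm] at this
  refine h3.trans ?_
  rw [(hder t).deriv]
  gcongr
  · rw [enorm_le_iff_norm_le]
    exact (norm_inner_le_norm _ _).trans_eq (by rw [hb, mul_one])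
  · exact hH _ _ hb

/-- The grid-lines estimate in the orthonormal frame `R e₁, R e₂, R e₃`. -/
lemma lintegral_prod_inner_frame_le {w : E3 → E3} (hw : ContDiff ℝ 1 w)
    (hsupp : HasCompactSupport w) {H : E3 → ℝ≥0∞} (hHm : Measurable H)
    (hH : ∀ x ξ, ‖ξ‖ = 1 → ‖inner ℝ (fderiv ℝ w x ξ) ξ‖ₑ ≤ H x) {γ : ℝ≥0} (hγ : 1 < γ)
    (R : E3 ≃ₗᵢ[ℝ] E3) :
    ∫⁻ x, ∏ i, (‖inner ℝ (w x) (R (EuclideanSpace.single i 1))‖ₑ ^ (γ : ℝ)) ^ (1 / 2 : ℝ) ≤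
      (∫⁻ x, γ * ‖w x‖ₑ ^ ((γ : ℝ) - 1) * H x) ^ (3 / 2 : ℝ) := by
  have hwm : Measurable w := hw.continuous.measurable
  -- Coordinates along the rotated frame: measure preserving, and changing the `i`-th coordinate
  -- moves along `R e_i`.
  set T : (Fin 3 → ℝ) → E3 := fun y => R (WithLp.toLp 2 y) with hT
  have hTm : MeasurePreserving T volume volume :=
    R.measurePreserving.comp (PiLp.volume_preserving_toLp (Fin 3))
  set f : E3 → ℝ≥0∞ := fun x => γ * ‖w x‖ₑ ^ ((γ : ℝ) - 1) * H x with hf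
  have hfm : Measurable f := by
    have := hwm.enorm
    fun_prop
  have hgm : Measurable fun x => ∏ i : Fin 3,
      (‖inner ℝ (w x) (R (EuclideanSpace.single i 1))‖ₑ ^ (γ : ℝ)) ^ (1 / 2 : ℝ) := by
    refine Finset.measurable_fun_prod _ fun i _ => ?_
    have : Measurable fun x => inner ℝ (w x) (R (EuclideanSpace.single i 1)) :=
      (hw.continuous.inner continuous_const).measurable
    fun_prop
  have hupd : ∀ (y : Fin 3 → ℝ) (i : Fin 3) (t : ℝ), T (Function.update y i t) =
      T (Function.update y i 0) + t • R (EuclideanSpace.single i 1) := by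
    intro y i t
    rw [hT]
    simp only [← map_smul, ← map_add]
    congr 1
    ext j
    by_cases hj : j = i
    · subst hj; simp
    · simp [hj]
  -- The grid-lines inequality in dimension `n = 3` has outer exponent `n/(n-1) = 3/2` and inner
  -- exponents `1/(n-1) = 1/2`.
  have hconj : Real.HolderConjugate (Fintype.card (Fin 3)) (3 / 2 : ℝ) := by
    rw [Real.holderConjugate_iff]
    norm_num
  rw [← hTm.lintegral_comp hgm, ← hTm.lintegral_comp hfm]
  refine le_trans (lintegral_mono fun y => ?_)
    (lintegral_prod_lintegral_pow_le (fun _ : Fin 3 => (volume : Measure ℝ)) hconj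
      (hfm.comp hTm.measurable))
  have he : (1 : ℝ) / ((Fintype.card (Fin 3) : ℝ) - 1) = 1 / 2 := by norm_num
  rw [he]
  refine Finset.prod_le_prod' fun i _ => ?_
  refine ENNReal.rpow_le_rpow ?_ (by norm_num)
  have hb : ‖R (EuclideanSpace.single i (1 : ℝ))‖ = 1 := by simp
  have h := enorm_inner_rpow_le_lintegral_line hw hsupp hH hγ (T (Function.update y i 0)) hb (y i)
  rw [← hupd, Function.update_eq_self] at h
  refine h.trans_eq ?_
  simp only [← hupd, hf]

/-- Finitely many orthonormal frames suffice to make every vector transversal to all coordinate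
planes of one of them. -/
lemma exists_finset_frames : ∃ F : Finset (E3 ≃ₗᵢ[ℝ] E3), ∃ c : ℝ, 0 < c ∧ ∀ v : E3, ∃ R ∈ F,
    c * ‖v‖ ^ 3 ≤ ∏ i, |inner ℝ v (R (EuclideanSpace.single i 1))| := by
  classical
  -- The unit diagonal has all coordinates equal to `1/√3`. A frame carrying it to a unit vector `v`
  -- therefore gives `v` the coordinate product `(1/√3)³`. The constant `c` is half of this, so that
  -- the strict bound persists near `v` and compactness of the sphere leaves finitely many frames.
  set d : E3 := WithLp.toLp 2 fun _ => (√3)⁻¹ with hd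
  have hd1 : ‖d‖ = 1 := by
    rw [EuclideanSpace.norm_eq]
    simp [hd]
  set e : Fin 3 → E3 := fun i => EuclideanSpace.single i 1 with he
  set P : (E3 ≃ₗᵢ[ℝ] E3) → E3 → ℝ := fun R v => ∏ i, |inner ℝ v (R (e i))| with hP
  have hPc : ∀ R, Continuous (P R) := fun R =>
    continuous_finsetProd _ fun i _ => (continuous_id.inner continuous_const).abs
  set c : ℝ := ((√3)⁻¹) ^ 3 / 2 with hc
  have hc0 : 0 < c := by positivity
  -- The reflection exchanging `d` and `v`, which exists because both are unit vectors.
  set ref : E3 → (E3 ≃ₗᵢ[ℝ] E3) := fun v => (ℝ ∙ (d - v))ᗮ.reflection with href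
  have hval : ∀ v ∈ Metric.sphere (0 : E3) 1, c < P (ref v) v := by
    intro v hv
    have hv1 : ‖v‖ = 1 := by simpa using hv
    have hrd : ref v d = v := Submodule.reflection_sub (hd1.trans hv1.symm)
    have hin : ∀ i, inner ℝ v (ref v (e i)) = (√3)⁻¹ := by
      intro i
      calc inner ℝ v (ref v (e i)) = inner ℝ (ref v d) (ref v (e i)) := by rw [hrd]
        _ = inner ℝ d (e i) := LinearIsometryEquiv.inner_map_map _ _ _
        _ = (√3)⁻¹ := by simp [he, hd, EuclideanSpace.inner_single_right]
    have h3 : (0 : ℝ) < (√3)⁻¹ := by positivity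
    simp only [hP, hin, abs_of_pos h3, Finset.prod_const, Finset.card_univ, Fintype.card_fin, hc]
    linarith [pow_pos h3 3]
  obtain ⟨t, -, ht⟩ := (isCompact_sphere (0 : E3) 1).elim_nhds_subcover
    (fun v => {v' | c < P (ref v) v'})
    fun v hv => (isOpen_lt continuous_const (hPc _)).mem_nhds (hval v hv)
  have hcov : ∀ v ∈ Metric.sphere (0 : E3) 1, ∃ R ∈ t.image ref, c < P R v := by
    intro v hv
    have := ht hv
    simp only [mem_iUnion] at this
    obtain ⟨z, hz, h⟩ := this
    exact ⟨ref z, Finset.mem_image_of_mem _ hz, h⟩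
  refine ⟨t.image ref, c, hc0, fun v => ?_⟩
  by_cases hv : v = 0
  · obtain ⟨R, hR, -⟩ := hcov d (by simpa using hd1)
    exact ⟨R, hR, by simp [hv]⟩
  · have hn : 0 < ‖v‖ := norm_pos_iff.2 hv
    obtain ⟨R, hR, h⟩ := hcov (‖v‖⁻¹ • v) (by simp [norm_smul, hn.ne'])
    refine ⟨R, hR, ?_⟩
    have hscale : P R (‖v‖⁻¹ • v) = (‖v‖⁻¹) ^ 3 * P R v := by
      simp only [hP, real_inner_smul_left, abs_mul, Finset.prod_mul_distrib, Finset.prod_const,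
        Finset.card_univ, Fintype.card_fin, abs_inv, abs_norm]
    rw [hscale, inv_pow, inv_mul_eq_div, lt_div_iff₀ (by positivity)] at h
    exact h.le

/-- A Gagliardo–Nirenberg type inequality involving only the quadratic form of the gradient. -/
lemma exists_lintegral_rpow_le {γ : ℝ≥0} (hγ : 1 < γ) : ∃ C : ℝ≥0, ∀ (w : E3 → E3)
    (H : E3 → ℝ≥0∞), ContDiff ℝ 1 w → HasCompactSupport w → Measurable H →
    (∀ x ξ, ‖ξ‖ = 1 → ‖inner ℝ (fderiv ℝ w x ξ) ξ‖ₑ ≤ H x) →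
    ∫⁻ x, ‖w x‖ₑ ^ (3 * γ / 2 : ℝ) ≤
      C * (∫⁻ x, ‖w x‖ₑ ^ ((γ : ℝ) - 1) * H x) ^ (3 / 2 : ℝ) := by
  obtain ⟨F, c, hc, hF⟩ := exists_finset_frames
  set K : ℝ≥0∞ := ENNReal.ofReal c⁻¹ ^ (γ / 2 : ℝ) with hK
  have hKtop : K ≠ ∞ := ENNReal.rpow_ne_top_of_nonneg (by positivity) ENNReal.ofReal_ne_top
  have hγtop : (γ : ℝ≥0∞) ^ (3 / 2 : ℝ) ≠ ∞ :=
    ENNReal.rpow_ne_top_of_nonneg (by norm_num) ENNReal.coe_ne_top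
  have htop : K * (F.card * (γ : ℝ≥0∞) ^ (3 / 2 : ℝ)) ≠ ∞ :=
    ENNReal.mul_ne_top hKtop (ENNReal.mul_ne_top (by simp) hγtop)
  refine ⟨(K * (F.card * (γ : ℝ≥0∞) ^ (3 / 2 : ℝ))).toNNReal, fun w H hw hsupp hHm hH => ?_⟩
  rw [ENNReal.coe_toNNReal htop]
  set Q : (E3 ≃ₗᵢ[ℝ] E3) → E3 → ℝ≥0∞ := fun R v =>
    ∏ i, (‖inner ℝ v (R (EuclideanSpace.single i 1))‖ₑ ^ (γ : ℝ)) ^ (1 / 2 : ℝ) with hQ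
  have hQm : ∀ R, Measurable fun x => Q R (w x) := fun R => by
    refine Finset.measurable_fun_prod _ fun i _ => ?_
    have : Measurable fun x => inner ℝ (w x) (R (EuclideanSpace.single i 1)) :=
      (hw.continuous.inner continuous_const).measurable
    fun_prop
  -- The product of components in a single frame vanishes on its coordinate planes. At each `v` some
  -- frame of `F` is transversal, so the sum over `F` dominates a full power of the norm.
  have hpt : ∀ v : E3, ‖v‖ₑ ^ (3 * γ / 2 : ℝ) ≤ K * ∑ R ∈ F, Q R v := by
    intro v
    obtain ⟨R, hR, h⟩ := hF v
    have hq : Q R v = (∏ i, ‖inner ℝ v (R (EuclideanSpace.single i 1))‖ₑ) ^ (γ / 2 : ℝ) := by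
      simp only [hQ]
      rw [← ENNReal.prod_rpow_of_nonneg (by positivity)]
      refine Finset.prod_congr rfl fun i _ => ?_
      rw [← ENNReal.rpow_mul]
      ring_nf
    have h1 : ‖v‖ₑ ^ 3 ≤ ENNReal.ofReal c⁻¹ *
        ∏ i, ‖inner ℝ v (R (EuclideanSpace.single i 1))‖ₑ := by
      simp only [← ofReal_norm, Real.norm_eq_abs]
      rw [← ENNReal.ofReal_prod_of_nonneg fun i _ => abs_nonneg _,
        ← ENNReal.ofReal_mul (by positivity), ← ENNReal.ofReal_pow (norm_nonneg _)]
      refine ENNReal.ofReal_le_ofReal ?_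
      rw [inv_mul_eq_div, le_div_iff₀ hc, mul_comm]
      exact h
    calc ‖v‖ₑ ^ (3 * γ / 2 : ℝ) = (‖v‖ₑ ^ 3) ^ (γ / 2 : ℝ) := by
          rw [← ENNReal.rpow_natCast, ← ENNReal.rpow_mul]
          congr 1
          push_cast
          ring
      _ ≤ (ENNReal.ofReal c⁻¹ *
          ∏ i, ‖inner ℝ v (R (EuclideanSpace.single i 1))‖ₑ) ^ (γ / 2 : ℝ) :=
          ENNReal.rpow_le_rpow h1 (by positivity)
      _ = K * Q R v := by rw [ENNReal.mul_rpow_of_nonneg _ _ (by positivity), hq]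
      _ ≤ K * ∑ R ∈ F, Q R v := by
          gcongr
          exact Finset.single_le_sum (f := fun R => Q R v) (fun _ _ => zero_le) hR
  calc ∫⁻ x, ‖w x‖ₑ ^ (3 * γ / 2 : ℝ) ≤ ∫⁻ x, K * ∑ R ∈ F, Q R (w x) :=
        lintegral_mono fun x => hpt (w x)
    _ = K * ∑ R ∈ F, ∫⁻ x, Q R (w x) := by
        rw [lintegral_const_mul' _ _ hKtop, lintegral_finsetSum _ fun R _ => hQm R]
    _ ≤ K * ∑ _R ∈ F, (γ * ∫⁻ x, ‖w x‖ₑ ^ ((γ : ℝ) - 1) * H x) ^ (3 / 2 : ℝ) := by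
        gcongr with R hR
        rw [← lintegral_const_mul' _ _ ENNReal.coe_ne_top]
        simp only [← mul_assoc]
        exact lintegral_prod_inner_frame_le hw hsupp hHm hH hγ R
    _ = _ := by
        rw [Finset.sum_const, nsmul_eq_mul, ENNReal.mul_rpow_of_nonneg _ _ (by norm_num)]
        ring

/-- A Korn–Sobolev inequality on `ℝ³`. -/
lemma exists_korn_sobolev {q : ℝ} (hq : 2 ≤ q) : ∃ C : ℝ≥0, ∀ (w : E3 → E3)
    (H : E3 → ℝ≥0∞), ContDiff ℝ 1 w → HasCompactSupport w → Measurable H →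
    (∀ x ξ, ‖ξ‖ = 1 → ‖inner ℝ (fderiv ℝ w x ξ) ξ‖ₑ ≤ H x) →
    (∫⁻ x, ‖w x‖ₑ ^ q) ^ (1 / q) ≤
      C * (∫⁻ x, H x ^ (3 * q / (3 + q))) ^ (1 / (3 * q / (3 + q))) := by
  have hq0 : 0 < q := by linarith
  -- Chosen so that `3γ/2 = q`.
  set γ : ℝ≥0 := ⟨2 * q / 3, by positivity⟩ with hγ
  have hγr : (γ : ℝ) = 2 * q / 3 := rfl
  have hγ1 : 1 < γ := by
    rw [← NNReal.coe_lt_coe, hγr]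
    norm_num
    linarith
  obtain ⟨C, hC⟩ := exists_lintegral_rpow_le hγ1
  refine ⟨C ^ (2 / 3 : ℝ), fun w H hw hsupp hHm hH => ?_⟩
  have hwm : Measurable fun x => ‖w x‖ₑ := hw.continuous.measurable.enorm
  have h := hC w H hw hsupp hHm hH
  have he : (3 * γ / 2 : ℝ) = q := by rw [hγr]; ring
  rw [he] at h
  set s : ℝ := 3 * q / (3 + q) with hs
  have hs0 : 0 < s := by positivity
  -- The exponent conjugate to `s`; also `(γ - 1) s' = q`, so Hölder reproduces the integral `J` on
  -- the right.
  set s' : ℝ := 3 * q / (2 * q - 3) with hs'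
  have hs'0 : 0 < s' := div_pos (by positivity) (by linarith)
  have hconj : s'.HolderConjugate s := by
    refine ⟨?_, hs'0, hs0⟩
    rw [hs, hs', inv_div, inv_div, inv_one]
    field_simp
    ring
  set J := ∫⁻ x, ‖w x‖ₑ ^ q with hJ
  set A := (∫⁻ x, H x ^ s) ^ (1 / s) with hA
  have hJtop : J ≠ ∞ := by
    have hcont : Continuous fun x => ‖w x‖ ^ q :=
      hw.continuous.norm.rpow_const fun _ => Or.inr hq0.le
    have hcs : HasCompactSupport fun x => ‖w x‖ ^ q :=
      hsupp.comp_left (g := fun v : E3 => ‖v‖ ^ q) (by simp [Real.zero_rpow hq0.ne'])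
    have := (hcont.integrable_of_hasCompactSupport hcs (μ := volume)).2.ne
    simpa only [Real.enorm_rpow_of_nonneg (norm_nonneg _) hq0.le, enorm_norm] using this
  have hholder : ∫⁻ x, ‖w x‖ₑ ^ ((γ : ℝ) - 1) * H x ≤ J ^ (1 / s') * A := by
    have := ENNReal.lintegral_mul_le_Lp_mul_Lq volume hconj
      (hwm.pow_const ((γ : ℝ) - 1)).aemeasurable hHm.aemeasurable
    refine this.trans_eq ?_
    simp only [← ENNReal.rpow_mul, hJ, hA]
    have hexp : ((γ : ℝ) - 1) * s' = q := by
      rw [hγr, hs']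
      have : 2 * q - 3 ≠ 0 := by linarith
      field_simp
    rw [hexp]
  have h1 : J ≤ C * (J ^ (1 / s') * A) ^ (3 / 2 : ℝ) := h.trans (by gcongr)
  by_cases hJ0 : J = 0
  · rw [hJ0, ENNReal.zero_rpow_of_pos (by positivity)]
    exact zero_le
  -- The right side contains `J` to the power `1 - 3/(2q)`, which can be cancelled because compact
  -- support makes `J` finite and the case `J = 0` is settled.
  have h2 : J ^ (3 / 2 * (1 / s')) * J ^ (3 / (2 * q)) ≤
      J ^ (3 / 2 * (1 / s')) * (C * A ^ (3 / 2 : ℝ)) := by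
    rw [← ENNReal.rpow_add _ _ hJ0 hJtop]
    have hexp : 3 / 2 * (1 / s') + 3 / (2 * q) = 1 := by
      rw [hs']
      field_simp
      ring
    rw [hexp, ENNReal.rpow_one]
    refine h1.trans_eq ?_
    rw [ENNReal.mul_rpow_of_nonneg _ _ (by norm_num), ← ENNReal.rpow_mul, mul_comm (1 / s')]
    ring
  have h3 : J ^ (3 / (2 * q)) ≤ C * A ^ (3 / 2 : ℝ) :=
    (ENNReal.mul_le_mul_iff_right (by simp [hJ0, hJtop])
      (by simp [hJ0, hJtop])).1 h2
  have h4 := ENNReal.rpow_le_rpow h3 (z := 2 / 3) (by norm_num)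
  rw [← ENNReal.rpow_mul, ENNReal.mul_rpow_of_nonneg _ _ (by norm_num), ← ENNReal.rpow_mul] at h4
  have e1 : 3 / (2 * q) * (2 / 3) = 1 / q := by field_simp
  have e2 : (3 / 2 : ℝ) * (2 / 3) = 1 := by norm_num
  rw [e1, e2, ENNReal.rpow_one] at h4
  rwa [ENNReal.coe_rpow_of_nonneg _ (by norm_num)]

end VlasovPowerLaw

/-! ### Korn–Sobolev on the torus and the density-weighted inequality -/

namespace VlasovPowerLaw

/-- The product rule for a localized field still involves the gradient of `g` only through its
quadratic form, plus a term of order zero. -/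
lemma abs_inner_cutoff_le {χ : E3 → ℝ} {g : E3 → E3} {x ξ : E3} (hχ : DifferentiableAt ℝ χ x)
    (hg : DifferentiableAt ℝ g x) (hξ : ‖ξ‖ = 1) :
    |inner ℝ (fderiv ℝ (fun y => χ y • g y) x ξ) ξ| ≤
      |χ x| * |inner ℝ (fderiv ℝ g x ξ) ξ| + ‖fderiv ℝ χ x‖ * ‖g x‖ := by
  rw [fderiv_fun_smul hχ hg]
  simp only [add_apply, smul_apply,
    ContinuousLinearMap.smulRight_apply, inner_add_left, real_inner_smul_left]
  refine (abs_add_le _ _).trans ?_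
  rw [abs_mul, abs_mul]
  have h1 : |fderiv ℝ χ x ξ| ≤ ‖fderiv ℝ χ x‖ := by
    simpa [hξ] using (fderiv ℝ χ x).le_opNorm ξ
  have h2 : |inner ℝ (g x) ξ| ≤ ‖g x‖ := by simpa [hξ] using abs_real_inner_le_norm (g x) ξ
  gcongr

/-- A Korn–Sobolev inequality on the torus, for the critical exponents. -/
lemma exists_korn_sobolev_torus_critical {q : ℝ} (hq : 2 ≤ q) : ∃ C : ℝ≥0, ∀ u : E3 → E3,
    ContDiff ℝ 1 u → IsPeriodic u →
      (∫⁻ x, ‖u x - ∫ y, u y ∂torusMeasure‖ₑ ^ q ∂torusMeasure) ^ (1 / q) ≤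
        C * (∫⁻ x, strain u x ^ (3 * q / (3 + q)) ∂torusMeasure) ^ (1 / (3 * q / (3 + q))) := by
  have hq0 : 0 < q := by linarith
  obtain ⟨C₁, hC₁⟩ := exists_korn_sobolev hq
  set s : ℝ := 3 * q / (3 + q) with hs
  have hs1 : 1 ≤ s := by rw [hs, le_div_iff₀ (by linarith)]; linarith
  have hs0 : 0 < s := by linarith
  obtain ⟨C₂, hC₂⟩ := lintegral_enorm_sub_mean_rpow_le hs1
  obtain ⟨N, hN⟩ := exists_setLIntegral_le_of_isBounded
    (Metric.isBounded_closedBall (x := (0 : E3)) (r := 3))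
  -- The cutoff is `1` on the ball of radius `2`, which contains the cube, and vanishes outside
  -- radius `3`, a ball covered by finitely many lattice translates.
  let χ : ContDiffBump (0 : E3) := ⟨2, 3, by norm_num, by norm_num⟩
  have hχd : ContDiff ℝ 1 χ := χ.contDiff
  have hχt : tsupport χ = Metric.closedBall 0 3 := χ.tsupport_eq
  have hBm : MeasurableSet (Metric.closedBall (0 : E3) 3) :=
    Metric.isClosed_closedBall.measurableSet
  obtain ⟨D, hD⟩ : ∃ D, ∀ x, ‖fderiv ℝ χ x‖ ≤ D :=
    (χ.hasCompactSupport.fderiv ℝ).exists_bound_of_continuous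
      (hχd.continuous_fderiv one_ne_zero)
  set D' := ENNReal.ofReal D
  set A : ℝ≥0∞ := 2 ^ (s - 1) * (N + D' ^ s * (N * C₂)) with hA
  have hAtop : A ^ (1 / s) ≠ ∞ := by
    refine ENNReal.rpow_ne_top_of_nonneg (by positivity) (ENNReal.mul_ne_top
      (ENNReal.rpow_ne_top_of_nonneg (by linarith) (by norm_num)) (ENNReal.add_ne_top.2 ⟨by simp,
      ENNReal.mul_ne_top (ENNReal.rpow_ne_top_of_nonneg hs0.le ENNReal.ofReal_ne_top)
        (ENNReal.mul_ne_top (by simp) (by simp))⟩))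
  refine ⟨C₁ * (A ^ (1 / s)).toNNReal, fun u hu hper => ?_⟩
  push_cast
  rw [ENNReal.coe_toNNReal hAtop]
  set m := ∫ y, u y ∂torusMeasure with hm
  set g : E3 → E3 := fun x => u x - m with hg
  have hgd : ContDiff ℝ 1 g := hu.sub contDiff_const
  have hgper : IsPeriodic g := hper.comp fun v => v - m
  have hfd : ∀ x, fderiv ℝ g x = fderiv ℝ u x := fun x => by rw [hg, fderiv_sub_const]
  set w : E3 → E3 := fun x => χ x • g x with hw
  set H : E3 → ℝ≥0∞ := (Metric.closedBall (0 : E3) 3).indicator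
    fun x => strain u x + D' * ‖g x‖ₑ with hH
  have hsm : Measurable (strain u) := (continuous_strain hu).measurable
  have hgm : Measurable fun x => ‖g x‖ₑ := hgd.continuous.measurable.enorm
  have hHm : Measurable H := (hsm.add (hgm.const_mul _)).indicator hBm
  have hwd : ContDiff ℝ 1 w := hχd.smul hgd
  have hws : HasCompactSupport w := χ.hasCompactSupport.smul_right
  have hHb : ∀ x ξ, ‖ξ‖ = 1 → ‖inner ℝ (fderiv ℝ w x ξ) ξ‖ₑ ≤ H x := by
    intro x ξ hξ
    by_cases hx : x ∈ Metric.closedBall (0 : E3) 3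
    · rw [hH, indicator_of_mem hx]
      have h1 := abs_inner_cutoff_le (hχd.differentiable one_ne_zero x)
        (hgd.differentiable one_ne_zero x) hξ
      have h2 := abs_inner_fderiv_le u x ξ
      rw [hξ, one_pow, mul_one] at h2
      rw [hfd] at h1
      have h3 : |χ x| ≤ 1 := abs_le.2 ⟨by linarith [χ.nonneg (x := x)], χ.le_one⟩
      rw [strain, ← ofReal_norm, ← ofReal_norm (g x), Real.norm_eq_abs,
        ← ENNReal.ofReal_mul ((norm_nonneg _).trans (hD 0)),
        ← ENNReal.ofReal_add (frob_nonneg _)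
          (mul_nonneg ((norm_nonneg _).trans (hD 0)) (norm_nonneg _))]
      refine ENNReal.ofReal_le_ofReal (h1.trans (add_le_add ?_ ?_))
      · exact (mul_le_of_le_one_left (abs_nonneg _) h3).trans h2
      · exact mul_le_mul_of_nonneg_right (hD x) (norm_nonneg _)
    · have hx' : x ∉ tsupport w := fun h =>
        hx (hχt ▸ (tsupport_smul_subset_left χ g) h)
      rw [fderiv_of_notMem_tsupport ℝ hx']
      simp
  have hmain := hC₁ w H hwd hws hHm hHb
  have hleft : ∫⁻ x, ‖g x‖ₑ ^ q ∂torusMeasure ≤ ∫⁻ x, ‖w x‖ₑ ^ q := by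
    refine le_trans (setLIntegral_mono' measurableSet_cube fun x hx => ?_)
      (setLIntegral_le_lintegral cube _)
    have : χ x = 1 := χ.one_of_mem_closedBall
      (mem_closedBall_zero_iff.2 (norm_le_two_of_mem_cube hx))
    simp only [hw, this, one_smul, le_refl]
  -- The zeroth-order term `|∇χ||u - m|` is absorbed by the Korn–Poincaré inequality with the same
  -- exponent `s`.
  have hright : ∫⁻ x, H x ^ s ≤ A * ∫⁻ x, strain u x ^ s ∂torusMeasure := by
    have hHs : ∀ x, H x ^ s = (Metric.closedBall (0 : E3) 3).indicator
        (fun x => (strain u x + D' * ‖g x‖ₑ) ^ s) x := fun x => by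
      by_cases hx : x ∈ Metric.closedBall (0 : E3) 3
      · rw [hH, indicator_of_mem hx, indicator_of_mem hx]
      · rw [hH, indicator_of_notMem hx, indicator_of_notMem hx, ENNReal.zero_rpow_of_pos hs0]
    simp only [hHs]
    rw [lintegral_indicator hBm]
    calc ∫⁻ x in Metric.closedBall (0 : E3) 3, (strain u x + D' * ‖g x‖ₑ) ^ s
        ≤ ∫⁻ x in Metric.closedBall (0 : E3) 3,
            2 ^ (s - 1) * (strain u x ^ s + D' ^ s * ‖g x‖ₑ ^ s) := by
          refine lintegral_mono fun x => ?_
          rw [← ENNReal.mul_rpow_of_nonneg _ _ hs0.le]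
          exact ENNReal.rpow_add_le_mul_rpow_add_rpow _ _ hs1
      _ = 2 ^ (s - 1) * ((∫⁻ x in Metric.closedBall (0 : E3) 3, strain u x ^ s) +
            D' ^ s * ∫⁻ x in Metric.closedBall (0 : E3) 3, ‖g x‖ₑ ^ s) := by
          rw [lintegral_const_mul _ (by fun_prop), lintegral_add_left (by fun_prop),
            lintegral_const_mul _ (by fun_prop)]
      _ ≤ 2 ^ (s - 1) * (N * (∫⁻ x, strain u x ^ s ∂torusMeasure) +
            D' ^ s * (N * (C₂ * ∫⁻ x, strain u x ^ s ∂torusMeasure))) := by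
          gcongr
          · exact hN _ (hper.strain.comp fun a => a ^ s)
          · refine (hN _ (hgper.comp fun v => ‖v‖ₑ ^ s)).trans ?_
            gcongr
            exact hC₂ u hu hper
      _ = A * ∫⁻ x, strain u x ^ s ∂torusMeasure := by rw [hA]; ring
  calc (∫⁻ x, ‖g x‖ₑ ^ q ∂torusMeasure) ^ (1 / q)
      ≤ (∫⁻ x, ‖w x‖ₑ ^ q) ^ (1 / q) := ENNReal.rpow_le_rpow hleft (by positivity)
    _ ≤ C₁ * (∫⁻ x, H x ^ s) ^ (1 / s) := hmain
    _ ≤ C₁ * (A * ∫⁻ x, strain u x ^ s ∂torusMeasure) ^ (1 / s) := by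
        gcongr
    _ = _ := by rw [ENNReal.mul_rpow_of_nonneg _ _ (by positivity), mul_assoc]

/-- The Korn–Sobolev inequality on the torus. -/
lemma exists_korn_sobolev_torus {q p : ℝ} (hq : 2 ≤ q) (hp : 3 * q / (3 + q) ≤ p) :
    ∃ C : ℝ≥0, ∀ u : E3 → E3, ContDiff ℝ 1 u → IsPeriodic u →
      (∫⁻ x, ‖u x - ∫ y, u y ∂torusMeasure‖ₑ ^ q ∂torusMeasure) ^ (1 / q) ≤
        C * (∫⁻ x, strain u x ^ p ∂torusMeasure) ^ (1 / p) := by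
  obtain ⟨C, hC⟩ := exists_korn_sobolev_torus_critical hq
  refine ⟨C, fun u hu hper => (hC u hu hper).trans ?_⟩
  set s : ℝ := 3 * q / (3 + q) with hs
  have hs0 : 0 < s := by positivity
  have hp0 : 0 < p := hs0.trans_le hp
  gcongr
  have hsm : Measurable (strain u) := (continuous_strain hu).measurable
  -- Supercritical exponents follow from the critical one by Jensen, as the torus has mass one.
  have h := lintegral_rpow_le_measure_univ_rpow_mul (ν := torusMeasure)
    (hsm.pow_const s).aemeasurable ((one_le_div hs0).2 hp)
  rw [measure_univ, ENNReal.one_rpow, one_mul] at h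
  simp only [← ENNReal.rpow_mul, mul_div_cancel₀ p hs0.ne'] at h
  have h2 := ENNReal.rpow_le_rpow h (z := 1 / p) (by positivity)
  rw [← ENNReal.rpow_mul] at h2
  have e : p / s * (1 / p) = 1 / s := by field_simp
  rwa [e] at h2

/-- For finite `r` the four cases share the condition `3p ≤ r(5p - 6)`, equivalent for `r > 1` to
the Sobolev requirement `3q/(3+q) ≤ p` with `q = 2r'`. For `p < 2` the assumption gives the stronger
`6 ≤ r(5p - 6)`. -/
lemma AdmissibleExponent.le_toReal_mul {p : ℝ} {r : ℝ≥0∞} (hr : AdmissibleExponent p r)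
    (hp : 6 / 5 ≤ p) (htop : r ≠ ∞) : 3 * p ≤ r.toReal * (5 * p - 6) ∧ 1 ≤ r.toReal := by
  obtain ⟨h1, h2, h3, h4⟩ := hr
  have hone : 1 ≤ r → 1 ≤ r.toReal := fun h => by
    simpa using ENNReal.toReal_mono htop h
  have hkey : ∀ a : ℝ, 0 < a → ENNReal.ofReal a / ENNReal.ofReal (5 * p - 6) ≤ r →
      0 < 5 * p - 6 ∧ a ≤ r.toReal * (5 * p - 6) := by
    intro a ha h
    have hpos : 0 < 5 * p - 6 := by
      by_contra hcon
      -- At `p = 6/5` the quotient in `[0,∞]` is infinite, contradicting `r ≠ ∞`.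
      rw [ENNReal.ofReal_of_nonpos (not_lt.1 hcon), ENNReal.div_zero (by simpa using ha)] at h
      exact htop (top_le_iff.1 h)
    refine ⟨hpos, ?_⟩
    rw [← ENNReal.ofReal_div_of_pos hpos] at h
    have := ENNReal.toReal_mono htop h
    rwa [ENNReal.toReal_ofReal (by positivity), div_le_iff₀ hpos] at this
  rcases lt_or_ge p 2 with hp2 | hp2
  · obtain ⟨hpos, h⟩ := hkey 6 (by norm_num) (by simpa using h1 hp2)
    exact ⟨by linarith, by nlinarith⟩
  rcases lt_trichotomy p 3 with hp3 | hp3 | hp3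
  · obtain ⟨hpos, h⟩ := hkey (3 * p) (by linarith) (h2 hp2 hp3)
    exact ⟨h, by nlinarith⟩
  · have := hone (h3 hp3).le
    exact ⟨by nlinarith, this⟩
  · have := hone (h4 hp3)
    exact ⟨by nlinarith, this⟩

/-- Hölder with exponents `r'` and `r` reduces this to an `L^{2r'}` bound on the oscillation. For `r
= ∞` that is the `L²` Korn–Sobolev bound, valid from `p = 6/5` on; for `r = 1` it is a sup bound,
where admissibility forces `p > 3` and Morrey applies; in between it is Korn–Sobolev. -/
lemma exists_lintegral_sq_mul_le {p : ℝ} {r : ℝ≥0∞} (hp : 6 / 5 ≤ p)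
    (hr : AdmissibleExponent p r) : ∃ K : ℝ≥0, ∀ (u : E3 → E3) (ρ : E3 → ℝ), ContDiff ℝ 1 u →
      IsPeriodic u → AEStronglyMeasurable ρ torusMeasure →
      ∫⁻ x, ‖u x - ∫ y, u y ∂torusMeasure‖ₑ ^ 2 * ‖ρ x‖ₑ ∂torusMeasure ≤
        K * eLpNorm ρ r torusMeasure * (∫⁻ x, strain u x ^ p ∂torusMeasure) ^ (2 / p) := by
  have hp0 : 0 < p := by linarith
  have hsq : ∀ a : ℝ≥0∞, a ^ (2 / p) = (a ^ (1 / p)) ^ 2 := fun a => by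
    rw [← ENNReal.rpow_natCast, ← ENNReal.rpow_mul]
    congr 1
    push_cast
    ring
  by_cases htop : r = ∞
  · subst htop
    obtain ⟨C, hC⟩ := exists_korn_sobolev_torus le_rfl (by norm_num; linarith : 3 * 2 / (3 + 2) ≤ p)
    refine ⟨C ^ 2, fun u ρ hu hper hρ => ?_⟩
    have h := hC u hu hper
    set g := fun x => u x - ∫ y, u y ∂torusMeasure
    have h2 := pow_le_pow_left₀ zero_le h 2
    rw [← ENNReal.rpow_natCast, ← ENNReal.rpow_mul, mul_pow] at h2
    norm_num at h2
    calc ∫⁻ x, ‖g x‖ₑ ^ 2 * ‖ρ x‖ₑ ∂torusMeasure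
        ≤ ∫⁻ x, ‖g x‖ₑ ^ 2 * eLpNorm ρ ∞ torusMeasure ∂torusMeasure := by
          refine lintegral_mono_ae ?_
          filter_upwards [enorm_ae_le_eLpNormEssSup ρ torusMeasure] with x hx
          rw [eLpNorm_exponent_top]
          gcongr
      _ = (∫⁻ x, ‖g x‖ₑ ^ 2 ∂torusMeasure) * eLpNorm ρ ∞ torusMeasure := by
          have : Measurable fun x => ‖g x‖ₑ ^ 2 :=
            ((hu.continuous.sub continuous_const).measurable.enorm).pow_const 2
          rw [lintegral_mul_const _ this]
      _ ≤ _ := by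
          rw [hsq]
          push_cast
          calc _ ≤ (C ^ 2 * ((∫⁻ x, strain u x ^ p ∂torusMeasure) ^ (1 / p)) ^ 2) *
              eLpNorm ρ ∞ torusMeasure := by
                gcongr
                simpa using h2
            _ = _ := by ring
  obtain ⟨hr1, hr2⟩ := hr.le_toReal_mul hp htop
  set R := r.toReal with hR
  rcases hr2.eq_or_lt with hR1 | hR1
  · have hr1' : r = 1 := by
      rw [← ENNReal.ofReal_toReal htop, ← hR, ← hR1, ENNReal.ofReal_one]
    have hp3 : 3 < p := by
      have hge : 3 ≤ p := by rw [← hR1] at hr1; linarith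
      rcases hge.eq_or_lt with h | h
      · exact absurd (hr.2.2.1 h.symm) (by simp [hr1'])
      · exact h
    obtain ⟨C, hC⟩ := enorm_sub_mean_le_of_three_lt hp3
    refine ⟨C ^ 2, fun u ρ hu hper hρ => ?_⟩
    rw [hr1', eLpNorm_one_eq_lintegral_enorm, hsq]
    calc _ ≤ ∫⁻ x, (C * (∫⁻ y, strain u y ^ p ∂torusMeasure) ^ (1 / p)) ^ 2 * ‖ρ x‖ₑ
          ∂torusMeasure := by
          refine lintegral_mono fun x => ?_
          gcongr
          exact hC u hu hper x
      _ = _ := by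
          rw [lintegral_const_mul'' _ hρ.enorm]
          push_cast
          ring
  · set R' := R / (R - 1) with hR'
    have hR'1 : 1 ≤ R' := by rw [hR', one_le_div (by linarith)]; linarith
    have hconj : R'.HolderConjugate R := (Real.HolderConjugate.conjExponent hR1).symm
    have hR1' : R - 1 ≠ 0 := by linarith
    have hR0 : 0 < R := by linarith
    have hexp : 3 * (2 * R') / (3 + 2 * R') ≤ p := by
      rw [div_le_iff₀ (by linarith), hR']
      have : 0 < R - 1 := by linarith
      rw [← sub_nonneg]
      have e : p * (3 + 2 * (R / (R - 1))) - 3 * (2 * (R / (R - 1))) =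
          (R * (5 * p - 6) - 3 * p) / (R - 1) := by field_simp; ring
      rw [e]
      exact div_nonneg (by linarith) this.le
    obtain ⟨C, hC⟩ := exists_korn_sobolev_torus (by linarith : 2 ≤ 2 * R') hexp
    refine ⟨C ^ 2, fun u ρ hu hper hρ => ?_⟩
    have h := pow_le_pow_left₀ zero_le (hC u hu hper) 2
    set g := fun x => u x - ∫ y, u y ∂torusMeasure
    have hgm : Measurable fun x => ‖g x‖ₑ ^ 2 :=
      ((hu.continuous.sub continuous_const).measurable.enorm).pow_const 2
    have hr0 : r ≠ 0 := fun h0 => by simp [hR, h0] at hR0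
    calc ∫⁻ x, ‖g x‖ₑ ^ 2 * ‖ρ x‖ₑ ∂torusMeasure
        ≤ (∫⁻ x, (‖g x‖ₑ ^ 2) ^ R' ∂torusMeasure) ^ (1 / R') *
          (∫⁻ x, ‖ρ x‖ₑ ^ R ∂torusMeasure) ^ (1 / R) :=
          ENNReal.lintegral_mul_le_Lp_mul_Lq _ hconj hgm.aemeasurable hρ.enorm
      _ = ((∫⁻ x, ‖g x‖ₑ ^ (2 * R') ∂torusMeasure) ^ (1 / (2 * R'))) ^ 2 *
          eLpNorm ρ r torusMeasure := by
          rw [eLpNorm_eq_lintegral_rpow_enorm_toReal hr0 htop]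
          congr 1
          rw [← ENNReal.rpow_natCast _ 2, ← ENNReal.rpow_mul]
          congr 1
          · refine lintegral_congr fun x => ?_
            rw [← ENNReal.rpow_natCast, ← ENNReal.rpow_mul]
            norm_num
          · push_cast
            field_simp
      _ ≤ (C * (∫⁻ x, strain u x ^ p ∂torusMeasure) ^ (1 / p)) ^ 2 *
          eLpNorm ρ r torusMeasure := by gcongr
      _ = _ := by
          rw [hsq]
          push_cast
          ring

end VlasovPowerLaw

/-! ### From the integrated differential inequality to decay rates -/

namespace VlasovPowerLaw

section Decay

open Filter Topology

variable {E : ℝ → ℝ} {c a : ℝ}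

/-- The equations hold only for positive times; continuity of `E` lets `s` tend to zero. -/
lemma decrement_from_zero (hE : ContinuousOn E (Ici 0))
    (hdec : ∀ s t, 0 < s → s ≤ t → E t + c * (t - s) * E t ^ a ≤ E s) {s t : ℝ} (hs : 0 ≤ s)
    (hst : s ≤ t) : E t + c * (t - s) * E t ^ a ≤ E s := by
  rcases hs.eq_or_lt with rfl | hs
  · rcases hst.eq_or_lt with rfl | ht
    · simp
    · have h1 : Tendsto E (𝓝[>] 0) (𝓝 (E 0)) :=
        (hE 0 self_mem_Ici).mono_left (nhdsWithin_mono _ Ioi_subset_Ici_self)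
      have h2 : Tendsto (fun s => E t + c * (t - s) * E t ^ a) (𝓝[>] 0)
          (𝓝 (E t + c * (t - 0) * E t ^ a)) :=
        ((by fun_prop : Continuous fun s => E t + c * (t - s) * E t ^ a).tendsto 0).mono_left
          nhdsWithin_le_nhds
      refine le_of_tendsto_of_tendsto h2 h1 ?_
      filter_upwards [Ioo_mem_nhdsGT ht] with z hz
      exact hdec z t hz.1 hz.2.le
  · exact hdec s t hs hst

/-- The right slopes of `E` are asymptotically at most `-c E^a`. The barrier decays at half that
rate and is positive, so at any contact point its derivative is strictly larger and `E` cannot cross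
it. -/
lemma le_of_decrement (hE : ContinuousOn E (Ici 0)) (ha : 0 ≤ a) (hc : 0 < c)
    (hdec : ∀ s t, 0 < s → s ≤ t → E t + c * (t - s) * E t ^ a ≤ E s)
    {B : ℝ → ℝ} (hB0 : E 0 ≤ B 0) (hBpos : ∀ t, 0 ≤ t → 0 < B t)
    (hB : ∀ t, 0 ≤ t → HasDerivAt B (-(c / 2) * B t ^ a) t) {t : ℝ} (ht : 0 ≤ t) :
    E t ≤ B t := by
  refine image_le_of_liminf_slope_right_lt_deriv_boundary' (f' := fun x => -c * E x ^ a)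
    (hE.mono Icc_subset_Ici_self) ?_ hB0
    (fun x hx => (hB x hx.1).continuousAt.continuousWithinAt)
    (fun x hx => (hB x hx.1).hasDerivWithinAt) ?_ (right_mem_Icc.2 ht)
  · intro x hx r hr
    refine Eventually.frequently ?_
    have h1 : Tendsto (fun z => -c * E z ^ a) (𝓝[>] x) (𝓝 (-c * E x ^ a)) := by
      have h2 : Tendsto E (𝓝[>] x) (𝓝 (E x)) :=
        (hE x hx.1).mono_left (nhdsWithin_mono _ fun z hz => hx.1.trans (le_of_lt hz))
      exact (h2.rpow_const (Or.inr ha)).const_mul _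
    filter_upwards [h1.eventually_lt_const hr, self_mem_nhdsWithin] with z hz hxz
    have hxz : x < z := hxz
    refine lt_of_le_of_lt ?_ hz
    rw [slope_def_field, div_le_iff₀ (by linarith)]
    linarith [decrement_from_zero hE hdec hx.1 hxz.le]
  · intro x hx hEB
    have := Real.rpow_pos_of_pos (hBpos x hx.1) a
    simp only [hEB]
    nlinarith

lemma antitone_of_decrement (hE : ContinuousOn E (Ici 0)) (hpos : ∀ t, 0 ≤ t → 0 ≤ E t)
    (hc : 0 < c) (hdec : ∀ s t, 0 < s → s ≤ t → E t + c * (t - s) * E t ^ a ≤ E s) {t : ℝ}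
    (ht : 0 ≤ t) : E t ≤ E 0 := by
  have h := decrement_from_zero hE hdec le_rfl ht
  have : 0 ≤ c * (t - 0) * E t ^ a :=
    mul_nonneg (mul_nonneg hc.le (by linarith)) (Real.rpow_nonneg (hpos t ht) _)
  linarith

lemma exp_decay_of_decrement (hE : ContinuousOn E (Ici 0)) (hpos : ∀ t, 0 ≤ t → 0 ≤ E t)
    (hc : 0 < c) (hdec : ∀ s t, 0 < s → s ≤ t → E t + c * (t - s) * E t ^ (1 : ℝ) ≤ E s) {t : ℝ}
    (ht : 0 ≤ t) : E t ≤ E 0 * Real.exp (-(c / 2 * t)) := by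
  -- If `E 0 = 0` the barrier would vanish identically; monotonicity settles this case.
  rcases (hpos 0 le_rfl).eq_or_lt with h0 | h0
  · have := antitone_of_decrement hE hpos hc hdec ht
    rw [← h0] at this ⊢
    simpa using this
  · refine le_of_decrement (B := fun t => E 0 * Real.exp (-(c / 2 * t))) hE zero_le_one hc hdec
      (by simp) (fun t _ => by positivity) (fun t _ => ?_) ht
    have h1 : HasDerivAt (fun t : ℝ => -(c / 2 * t)) (-(c / 2)) t := by
      simpa using ((hasDerivAt_id' t).const_mul (c / 2)).fun_neg
    refine (h1.exp.const_mul (E 0)).congr_deriv ?_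
    rw [Real.rpow_one]
    ring

lemma algebraic_decay_of_decrement {p : ℝ} (hp : 2 < p) (hE : ContinuousOn E (Ici 0))
    (hpos : ∀ t, 0 ≤ t → 0 ≤ E t) (hc : 0 < c)
    (hdec : ∀ s t, 0 < s → s ≤ t → E t + c * (t - s) * E t ^ (p / 2) ≤ E s) {t : ℝ}
    (ht : 0 ≤ t) :
    E t ≤ (E 0 ^ ((2 - p) / 2) + c / 2 * (p / 2 - 1) * t) ^ (-(2 / (p - 2))) := by
  have hb : ∀ t, 0 ≤ t → 0 ≤ c / 2 * (p / 2 - 1) * t := fun t ht =>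
    mul_nonneg (mul_nonneg (by linarith) (by linarith)) ht
  -- For `E 0 = 0` the negative real power `0 ^ ((2 - p) / 2)` is `0` by convention; the right side
  -- is merely nonnegative, and `E` stays at `0`.
  rcases (hpos 0 le_rfl).eq_or_lt with h0 | h0
  · refine (antitone_of_decrement hE hpos hc hdec ht).trans ?_
    rw [← h0]
    exact Real.rpow_nonneg (add_nonneg (Real.rpow_nonneg le_rfl _) (hb t ht)) _
  · have hk : 0 < E 0 ^ ((2 - p) / 2) := Real.rpow_pos_of_pos h0 _
    have hbase : ∀ t, 0 ≤ t → 0 < E 0 ^ ((2 - p) / 2) + c / 2 * (p / 2 - 1) * t :=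
      fun t ht => by linarith [hb t ht]
    have hp2 : p - 2 ≠ 0 := by linarith
    refine le_of_decrement (a := p / 2)
      (B := fun t => (E 0 ^ ((2 - p) / 2) + c / 2 * (p / 2 - 1) * t) ^ (-(2 / (p - 2))))
      hE (by linarith) hc hdec ?_ (fun t ht => Real.rpow_pos_of_pos (hbase t ht) _)
      (fun t ht => ?_) ht
    · simp only [mul_zero, add_zero]
      rw [← Real.rpow_mul h0.le]
      have : (2 - p) / 2 * -(2 / (p - 2)) = 1 := by field_simp; ring
      rw [this, Real.rpow_one]
    · have h1 : HasDerivAt (fun t : ℝ => E 0 ^ ((2 - p) / 2) + c / 2 * (p / 2 - 1) * t)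
          (c / 2 * (p / 2 - 1)) t := by
        simpa using ((hasDerivAt_id' t).const_mul (c / 2 * (p / 2 - 1))).const_add
          (E 0 ^ ((2 - p) / 2))
      refine (h1.rpow_const (p := -(2 / (p - 2))) (Or.inl (hbase t ht).ne')).congr_deriv ?_
      rw [← Real.rpow_mul (hbase t ht).le]
      have e : -(2 / (p - 2)) * (p / 2) = -(2 / (p - 2)) - 1 := by field_simp; ring
      rw [e]
      field_simp

end Decay

end VlasovPowerLaw

/-! ### Weak form of the Vlasov equation for compactly supported tests -/

namespace VlasovPowerLaw

/-- The fundamental theorem of calculus under an integral over a compact set of parameters. -/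
lemma integral_sub_integral_eq_intervalIntegral {X : Type*} [TopologicalSpace X]
    [SecondCountableTopology X] [MeasurableSpace X] [BorelSpace X] {ν : Measure X}
    [IsFiniteMeasure ν] {K : Set X} (hK : IsCompact K) (hνK : ∀ᵐ x ∂ν, x ∈ K)
    {F F' : ℝ → X → ℝ} (hF : ∀ τ, 0 < τ → Integrable (F τ) ν)
    (hder : ∀ τ, 0 < τ → ∀ x, HasDerivAt (fun τ => F τ x) (F' τ x) τ)
    (hF' : ContinuousOn (fun z : ℝ × X => F' z.1 z.2) (Ioi 0 ×ˢ univ)) {s t : ℝ} (hs : 0 < s)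
    (hst : s ≤ t) :
    IntervalIntegrable (fun τ => ∫ x, F' τ x ∂ν) volume s t ∧
      ∫ x, F t x ∂ν - ∫ x, F s x ∂ν = ∫ τ in s..t, ∫ x, F' τ x ∂ν := by
  have hpos : ∀ τ ∈ uIcc s t, 0 < τ := fun τ hτ => by
    rw [uIcc_of_le hst] at hτ
    exact hs.trans_le hτ.1
  -- `F'` is bounded on the compact set carrying the measure, which justifies Fubini.
  obtain ⟨C, hC⟩ := (isCompact_Icc (a := s) (b := t)).prod hK |>.exists_bound_of_continuousOn
    (hF'.mono fun z hz => ⟨hs.trans_le hz.1.1, mem_univ _⟩)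
  have hmeas : AEStronglyMeasurable (fun z : ℝ × X => F' z.1 z.2)
      ((volume.restrict (uIoc s t)).prod ν) := by
    have hsub : uIoc s t ⊆ Ioi (0 : ℝ) := fun τ hτ => hpos τ (uIoc_subset_uIcc hτ)
    have h1 : AEStronglyMeasurable (fun z : ℝ × X => F' z.1 z.2)
        (((volume : Measure ℝ).prod ν).restrict (Ioi 0 ×ˢ univ)) :=
      hF'.aestronglyMeasurable (measurableSet_Ioi.prod MeasurableSet.univ)
    rw [← Measure.prod_restrict, Measure.restrict_univ] at h1
    exact h1.mono_measure (Measure.prod_mono (Measure.restrict_mono hsub le_rfl) le_rfl)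
  have hbound : ∀ᵐ z ∂((volume.restrict (uIoc s t)).prod ν), ‖F' z.1 z.2‖ ≤ C := by
    have h1 : ∀ᵐ z ∂((volume.restrict (uIoc s t)).prod ν), z.1 ∈ uIoc s t :=
      Measure.quasiMeasurePreserving_fst.ae (ae_restrict_mem measurableSet_uIoc)
    have h2 : ∀ᵐ z ∂((volume.restrict (uIoc s t)).prod ν), z.2 ∈ K :=
      Measure.quasiMeasurePreserving_snd.ae hνK
    filter_upwards [h1, h2] with z hz1 hz2
    exact hC z ⟨by rw [← uIcc_of_le hst]; exact uIoc_subset_uIcc hz1, hz2⟩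
  have : IsFiniteMeasure ((volume : Measure ℝ).restrict (uIoc s t)) :=
    inferInstanceAs (IsFiniteMeasure (volume.restrict (Ioc (min s t) (max s t))))
  have hint : Integrable (Function.uncurry F') ((volume.restrict (uIoc s t)).prod ν) :=
    Integrable.of_bound hmeas C hbound
  refine ⟨intervalIntegrable_iff.2 hint.integral_prod_left, ?_⟩
  rw [← integral_sub (hF t (hs.trans_le hst)) (hF s hs), intervalIntegral_integral_swap hint]
  refine integral_congr_ae (Filter.Eventually.of_forall fun x => ?_)
  have hc : ContinuousOn (fun τ => F' τ x) (uIcc s t) :=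
    hF'.comp (f := fun τ : ℝ => (τ, x)) (by fun_prop) fun τ hτ => ⟨hpos τ hτ, mem_univ _⟩
  exact (intervalIntegral.integral_eq_sub_of_hasDerivAt (fun τ hτ => hder τ (hpos τ hτ) x)
    hc.intervalIntegrable).symm

instance : SFinite phaseMeasure := inferInstanceAs (SFinite (torusMeasure.prod volume))

instance : IsFiniteMeasureOnCompacts phaseMeasure :=
  inferInstanceAs (IsFiniteMeasureOnCompacts (torusMeasure.prod volume))

lemma ae_phaseMeasure_fst_mem : ∀ᵐ z ∂phaseMeasure, z.1 ∈ cube :=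
  Measure.quasiMeasurePreserving_fst.ae (ae_restrict_mem measurableSet_cube)

lemma integrable_phase_of_continuous {h : E3 × E3 → ℝ} (hc : Continuous h) {K : Set E3}
    (hK : IsCompact K) (hzero : ∀ z, z.2 ∉ K → h z = 0) : Integrable h phaseMeasure := by
  have h1 : IntegrableOn h (closure cube ×ˢ K) phaseMeasure :=
    hc.continuousOn.integrableOn_compact (isBounded_cube.isCompact_closure.prod hK)
  refine h1.integrable_of_ae_notMem_eq_zero ?_
  filter_upwards [ae_phaseMeasure_fst_mem] with z hz hn
  exact hzero z fun h => hn ⟨subset_closure hz, h⟩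

variable {μ p : ℝ} {f : ℝ → E3 → E3 → ℝ} {u : ℝ → E3 → E3} {π : ℝ → E3 → ℝ}

namespace IsRegularSolution

lemma hasFDerivAt_f (h : IsRegularSolution μ p f u π) {t : ℝ} (ht : 0 < t) (x v : E3) :
    HasFDerivAt (fun z : ℝ × E3 × E3 => f z.1 z.2.1 z.2.2)
      (fderiv ℝ (fun z : ℝ × E3 × E3 => f z.1 z.2.1 z.2.2) (t, x, v)) (t, x, v) :=
  ((h.contDiff_f.differentiableOn one_ne_zero).differentiableAt
    ((isOpen_Ioi.prod isOpen_univ).mem_nhds (mk_mem_prod ht (mem_univ _)))).hasFDerivAt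

lemma continuousOn_fderiv_f (h : IsRegularSolution μ p f u π) :
    ContinuousOn (fderiv ℝ (fun z : ℝ × E3 × E3 => f z.1 z.2.1 z.2.2)) (Ioi 0 ×ˢ univ) :=
  h.contDiff_f.continuousOn_fderiv_of_isOpen (isOpen_Ioi.prod isOpen_univ) le_rfl

lemma hasDerivAt_f (h : IsRegularSolution μ p f u π) {t : ℝ} (ht : 0 < t) (x v : E3) :
    HasDerivAt (fun s => f s x v)
      (fderiv ℝ (fun z : ℝ × E3 × E3 => f z.1 z.2.1 z.2.2) (t, x, v) (1, 0, 0)) t :=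
  (h.hasFDerivAt_f ht x v).comp_hasDerivAt (f := fun s : ℝ => (s, x, v)) t
    ((hasDerivAt_id t).prodMk ((hasDerivAt_const t x).prodMk (hasDerivAt_const t v)))

lemma contDiff_f_fst (h : IsRegularSolution μ p f u π) {t : ℝ} (ht : 0 < t) (v : E3) :
    ContDiff ℝ 1 fun x => f t x v := by
  rw [← contDiffOn_univ]
  exact h.contDiff_f.comp (f := fun x : E3 => (t, x, v)) (by fun_prop)
    fun x _ => ⟨ht, mem_univ _⟩

lemma contDiff_f_snd (h : IsRegularSolution μ p f u π) {t : ℝ} (ht : 0 < t) (x : E3) :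
    ContDiff ℝ 1 fun v => f t x v := by
  rw [← contDiffOn_univ]
  exact h.contDiff_f.comp (f := fun v : E3 => (t, x, v)) (by fun_prop)
    fun x _ => ⟨ht, mem_univ _⟩

lemma fderiv_f_fst (h : IsRegularSolution μ p f u π) {t : ℝ} (ht : 0 < t) (x v w : E3) :
    fderiv ℝ (fun y => f t y v) x w =
      fderiv ℝ (fun z : ℝ × E3 × E3 => f z.1 z.2.1 z.2.2) (t, x, v) (0, w, 0) := by
  have h1 : HasFDerivAt (fun y : E3 => (t, y, v)) ((0 : E3 →L[ℝ] ℝ).prod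
      ((ContinuousLinearMap.id ℝ E3).prod (0 : E3 →L[ℝ] E3))) x :=
    (hasFDerivAt_const t x).prodMk ((hasFDerivAt_id x).prodMk (hasFDerivAt_const v x))
  have h2 := ((h.hasFDerivAt_f ht x v).comp x h1).fderiv
  change (fderiv ℝ ((fun z : ℝ × E3 × E3 => f z.1 z.2.1 z.2.2) ∘ fun y : E3 => (t, y, v)) x) w = _
  rw [h2]
  simp

lemma continuous_f_slice (h : IsRegularSolution μ p f u π) {t : ℝ} (ht : 0 ≤ t) :
    Continuous fun z : E3 × E3 => f t z.1 z.2 := by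
  rw [← continuousOn_univ]
  exact h.continuous_f.comp (f := fun z : E3 × E3 => (t, z)) (by fun_prop)
    fun z _ => ⟨ht, mem_univ _⟩

lemma continuous_u_slice (h : IsRegularSolution μ p f u π) {t : ℝ} (ht : 0 ≤ t) :
    Continuous (u t) := by
  rw [← continuousOn_univ]
  exact h.continuous_u.comp (f := fun z : E3 => (t, z)) (by fun_prop)
    fun z _ => ⟨ht, mem_univ _⟩

lemma contDiff_u_slice (h : IsRegularSolution μ p f u π) {t : ℝ} (ht : 0 < t) :
    ContDiff ℝ 1 (u t) := by
  rw [← contDiffOn_univ]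
  exact h.contDiff_u.comp (f := fun z : E3 => (t, z)) (by fun_prop)
    fun z _ => ⟨ht, mem_univ _⟩

/-- Integration by parts in the velocity variable. -/
lemma integral_mul_divergence (h : IsRegularSolution μ p f u π) {t : ℝ} (ht : 0 < t) (x : E3)
    {φ : E3 → ℝ} (hφ : ContDiff ℝ 1 φ) (hφs : HasCompactSupport φ) :
    ∫ v, φ v * divergence (fun w => f t x w • (u t x - w)) v =
      -∫ v, fderiv ℝ φ v (u t x - v) * f t x v := by
  have hf := h.contDiff_f_snd ht x
  set F : E3 → E3 := fun w => f t x w • (u t x - w) with hF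
  have hFc : ContDiff ℝ 1 F := hf.smul (contDiff_const.sub contDiff_id)
  have hFi : ∀ i, ContDiff ℝ 1 fun w => F w i := fun i =>
    (EuclideanSpace.proj (𝕜 := ℝ) i).contDiff.comp hFc
  have hpart : ∀ i v, (partialD i F v) i = fderiv ℝ (fun w => F w i) v
      (EuclideanSpace.single i 1) := by
    intro i v
    have := ((EuclideanSpace.proj (𝕜 := ℝ) i).hasFDerivAt.comp v
      (hFc.differentiable one_ne_zero v).hasFDerivAt).fderiv
    change _ = fderiv ℝ ((EuclideanSpace.proj (𝕜 := ℝ) i) ∘ F) v _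
    rw [this]
    rfl
  have hc1 : ∀ i, Continuous fun v => fderiv ℝ φ v (EuclideanSpace.single i 1) * F v i := fun i =>
    ((hφ.continuous_fderiv one_ne_zero).clm_apply continuous_const).mul (hFi i).continuous
  have hc2 : ∀ i, Continuous fun v => φ v * fderiv ℝ (fun w => F w i) v
      (EuclideanSpace.single i 1) := fun i =>
    hφ.continuous.mul (((hFi i).continuous_fderiv one_ne_zero).clm_apply continuous_const)
  have hi1 : ∀ i, Integrable fun v => fderiv ℝ φ v (EuclideanSpace.single i 1) * F v i := fun i =>
    (hc1 i).integrable_of_hasCompactSupport (hφs.fderiv_apply ℝ _).mul_right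
  have hi2 : ∀ i, Integrable fun v => φ v * fderiv ℝ (fun w => F w i) v
      (EuclideanSpace.single i 1) := fun i =>
    (hc2 i).integrable_of_hasCompactSupport hφs.mul_right
  have hi3 : ∀ i, Integrable fun v => φ v * F v i := fun i =>
    (hφ.continuous.mul (hFi i).continuous).integrable_of_hasCompactSupport hφs.mul_right
  have hibp : ∀ i, ∫ v, φ v * fderiv ℝ (fun w => F w i) v (EuclideanSpace.single i 1) =
      -∫ v, fderiv ℝ φ v (EuclideanSpace.single i 1) * F v i := fun i =>
    integral_mul_fderiv_eq_neg_fderiv_mul_of_integrable (hi1 i) (hi2 i) (hi3 i)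
      (fun v _ => hφ.differentiable one_ne_zero v)
      (fun v _ => (hFi i).differentiable one_ne_zero v)
  have e1 : ∀ v, φ v * divergence F v =
      ∑ i, φ v * fderiv ℝ (fun w => F w i) v (EuclideanSpace.single i 1) := fun v => by
    rw [divergence, Finset.mul_sum]
    exact Finset.sum_congr rfl fun i _ => by rw [hpart]
  have e2 : ∀ v, fderiv ℝ φ v (u t x - v) * f t x v =
      ∑ i, fderiv ℝ φ v (EuclideanSpace.single i 1) * F v i := fun v => by
    rw [fderiv_apply_eq_sum, Finset.sum_mul]
    refine Finset.sum_congr rfl fun i _ => ?_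
    simp only [partialD, hF, PiLp.smul_apply, smul_eq_mul]
    ring
  simp only [e1, e2]
  rw [integral_finsetSum _ fun i _ => hi2 i, integral_finsetSum _ fun i _ => hi1 i,
    ← Finset.sum_neg_distrib]
  exact Finset.sum_congr rfl fun i _ => hibp i

/-- The weak form of the Vlasov equation, at a fixed positive time. -/
lemma integral_mul_deriv_f (h : IsRegularSolution μ p f u π) {t : ℝ} (ht : 0 < t)
    {φ : E3 → ℝ} (hφ : ContDiff ℝ 1 φ) (hφs : HasCompactSupport φ) :
    ∫ z, φ z.2 * deriv (fun s => f s z.1 z.2) t ∂phaseMeasure =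
      ∫ z, fderiv ℝ φ z.2 (u t z.1 - z.2) * f t z.1 z.2 ∂phaseMeasure := by
  have hslice : ContinuousOn (fun z : E3 × E3 => fderiv ℝ
      (fun z : ℝ × E3 × E3 => f z.1 z.2.1 z.2.2) (t, z)) univ :=
    h.continuousOn_fderiv_f.comp (f := fun z : E3 × E3 => (t, z)) (by fun_prop)
      fun z _ => ⟨ht, mem_univ _⟩
  rw [continuousOn_univ] at hslice
  have hφz : Continuous fun z : E3 × E3 => φ z.2 := hφ.continuous.comp continuous_snd
  have hzero : ∀ z : E3 × E3, z.2 ∉ tsupport φ → φ z.2 = 0 := fun z hz =>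
    image_eq_zero_of_notMem_tsupport hz
  set T₁ : E3 × E3 → ℝ := fun z => φ z.2 * deriv (fun s => f s z.1 z.2) t with hT₁
  set T₂ : E3 × E3 → ℝ := fun z => φ z.2 * fderiv ℝ (fun y => f t y z.2) z.1 z.2 with hT₂
  set T₃ : E3 × E3 → ℝ := fun z =>
    φ z.2 * divergence (fun w => f t z.1 w • (u t z.1 - w)) z.2 with hT₃
  set T₄ : E3 × E3 → ℝ := fun z => fderiv ℝ φ z.2 (u t z.1 - z.2) * f t z.1 z.2 with hT₄
  have hT₁c : Continuous T₁ := by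
    have : T₁ = fun z : E3 × E3 => φ z.2 * fderiv ℝ
        (fun z : ℝ × E3 × E3 => f z.1 z.2.1 z.2.2) (t, z) (1, 0, 0) := funext fun z => by
      rw [hT₁]
      simp only [(h.hasDerivAt_f ht z.1 z.2).deriv]
    rw [this]
    exact hφz.mul (hslice.clm_apply continuous_const)
  have hT₂c : Continuous T₂ := by
    have : T₂ = fun z : E3 × E3 => φ z.2 * fderiv ℝ
        (fun z : ℝ × E3 × E3 => f z.1 z.2.1 z.2.2) (t, z) (0, z.2, 0) := funext fun z => by
      rw [hT₂]
      simp only [h.fderiv_f_fst ht]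
    rw [this]
    exact hφz.mul (hslice.clm_apply (by fun_prop))
  have hsum : ∀ z, T₁ z = -T₂ z - T₃ z := fun z => by
    have := h.kinetic t ht z.1 z.2
    simp only [hT₁, hT₂, hT₃]
    linear_combination φ z.2 * this
  -- Continuity of the divergence term is read off the equation, from that of the other two terms.
  have hT₃c : Continuous T₃ := by
    have : T₃ = fun z => -T₂ z - T₁ z := funext fun z => by rw [hsum]; ring
    rw [this]
    exact hT₂c.neg.sub hT₁c
  have hT₄c : Continuous T₄ := by
    refine Continuous.mul ?_ (h.continuous_f_slice ht.le)
    have hu := h.continuous_u_slice ht.le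
    exact ((hφ.continuous_fderiv one_ne_zero).comp continuous_snd).clm_apply (by fun_prop)
  have hi₂ : Integrable T₂ phaseMeasure :=
    integrable_phase_of_continuous hT₂c hφs fun z hz => by simp [hT₂, hzero z hz]
  have hi₃ : Integrable T₃ phaseMeasure :=
    integrable_phase_of_continuous hT₃c hφs fun z hz => by simp [hT₃, hzero z hz]
  have hi₄ : Integrable T₄ phaseMeasure :=
    integrable_phase_of_continuous hT₄c hφs fun z hz => by
      simp [hT₄, fderiv_of_notMem_tsupport ℝ hz]
  -- At fixed `v` the transport term is a directional derivative of a periodic function, and the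
  -- test function does not depend on `x`.
  have hz₂ : ∫ z, T₂ z ∂phaseMeasure = 0 := by
    rw [phaseMeasure, integral_prod_symm _ hi₂]
    simp only [hT₂]
    refine integral_eq_zero_of_ae (Filter.Eventually.of_forall fun v => ?_)
    simp only [Pi.zero_apply]
    rw [integral_const_mul, integral_torus_fderiv_eq_zero (h.periodic_f t ht.le v)
      (h.contDiff_f_fst ht v), mul_zero]
  have hz₃ : ∫ z, T₃ z ∂phaseMeasure = -∫ z, T₄ z ∂phaseMeasure := by
    rw [phaseMeasure, integral_prod _ hi₃, integral_prod _ hi₄, ← integral_neg]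
    exact integral_congr_ae (Filter.Eventually.of_forall fun x =>
      h.integral_mul_divergence ht x hφ hφs)
  calc ∫ z, T₁ z ∂phaseMeasure = ∫ z, (-T₂ z - T₃ z) ∂phaseMeasure := by simp only [hsum]
    _ = -(∫ z, T₂ z ∂phaseMeasure) - ∫ z, T₃ z ∂phaseMeasure := by
        rw [integral_sub hi₂.fun_neg hi₃, integral_neg]
    _ = ∫ z, T₄ z ∂phaseMeasure := by rw [hz₂, hz₃]; ring

/-- The weak form of the Vlasov equation, integrated in time. -/
lemma integral_sub_eq_of_hasCompactSupport (h : IsRegularSolution μ p f u π) {φ : E3 → ℝ}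
    (hφ : ContDiff ℝ 1 φ) (hφs : HasCompactSupport φ) {s t : ℝ} (hs : 0 < s) (hst : s ≤ t) :
    ∫ z, φ z.2 * f t z.1 z.2 ∂phaseMeasure - ∫ z, φ z.2 * f s z.1 z.2 ∂phaseMeasure =
      ∫ τ in s..t, ∫ z, fderiv ℝ φ z.2 (u τ z.1 - z.2) * f τ z.1 z.2 ∂phaseMeasure := by
  set K : Set (E3 × E3) := closure cube ×ˢ tsupport φ with hK
  have hKc : IsCompact K := isBounded_cube.isCompact_closure.prod hφs
  have hφz : Continuous fun z : E3 × E3 => φ z.2 := hφ.continuous.comp continuous_snd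
  have hrestr : ∀ g : E3 × E3 → ℝ, ∫ z in K, φ z.2 * g z ∂phaseMeasure =
      ∫ z, φ z.2 * g z ∂phaseMeasure := fun g => by
    refine setIntegral_eq_integral_of_ae_compl_eq_zero ?_
    filter_upwards [ae_phaseMeasure_fst_mem] with z hz hn
    rw [image_eq_zero_of_notMem_tsupport fun h => hn ⟨subset_closure hz, h⟩, zero_mul]
  have : IsFiniteMeasure (phaseMeasure.restrict K) := ⟨by
    rw [Measure.restrict_apply_univ]
    exact hKc.measure_lt_top⟩
  have hmain := (integral_sub_integral_eq_intervalIntegral (ν := phaseMeasure.restrict K) hKc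
    (ae_restrict_mem hKc.isClosed.measurableSet)
    (F := fun τ z => φ z.2 * f τ z.1 z.2)
    (F' := fun τ z => φ z.2 * deriv (fun s => f s z.1 z.2) τ)
    (fun τ hτ => ((hφz.mul (h.continuous_f_slice hτ.le)).continuousOn.integrableOn_compact hKc))
    (fun τ hτ z => (h.hasDerivAt_f hτ z.1 z.2).differentiableAt.hasDerivAt.const_mul _)
    ?_ hs hst).2
  · simp only [hrestr] at hmain
    rw [hmain]
    refine intervalIntegral.integral_congr fun τ hτ => ?_
    rw [uIcc_of_le hst] at hτ
    exact h.integral_mul_deriv_f (hs.trans_le hτ.1) hφ hφs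
  · refine (hφz.comp continuous_snd).continuousOn.mul ?_
    refine ContinuousOn.congr (f := fun z : ℝ × E3 × E3 => fderiv ℝ
      (fun z : ℝ × E3 × E3 => f z.1 z.2.1 z.2.2) z (1, 0, 0))
      (h.continuousOn_fderiv_f.clm_apply continuousOn_const) fun z hz => ?_
    exact (h.hasDerivAt_f hz.1 z.2.1 z.2.2).deriv

end IsRegularSolution

end VlasovPowerLaw

/-! ### Removing the truncation: test functions of quadratic growth -/

namespace VlasovPowerLaw

section Cutoff

/-- A smooth cutoff function which is `1` on the cube. -/
noncomputable def cubeBump : ContDiffBump (0 : E3) := ⟨2, 3, by norm_num, by norm_num⟩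

lemma cubeBump_eq_one {x : E3} (hx : x ∈ cube) : cubeBump x = 1 :=
  cubeBump.one_of_mem_closedBall (mem_closedBall_zero_iff.2 (norm_le_two_of_mem_cube hx))

/-- The cube is not compact; inserting a bump that is `1` on it leaves the integral unchanged and
makes the integrand compactly supported. -/
lemma continuousOn_integral_torus {S : Set ℝ} {g : ℝ → E3 → ℝ}
    (hg : ContinuousOn (fun z : ℝ × E3 => g z.1 z.2) (S ×ˢ univ)) :
    ContinuousOn (fun τ => ∫ x, g τ x ∂torusMeasure) S := by
  have h : ContinuousOn (fun τ => ∫ x, cubeBump x * g τ x ∂torusMeasure) S := by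
    refine continuousOn_integral_of_compact_support (k := Metric.closedBall (0 : E3) 3)
      (isCompact_closedBall _ _) ?_ fun τ x _ hx => ?_
    · exact (cubeBump.continuous.comp continuous_snd).continuousOn.mul hg
    · rw [cubeBump.zero_of_le_dist, zero_mul]
      exact (not_le.1 hx).le
  refine h.congr fun τ _ => setIntegral_congr_fun measurableSet_cube fun x hx => ?_
  simp only [cubeBump_eq_one hx, one_mul]

lemma continuousOn_integral_phase {S : Set ℝ} {g : ℝ → E3 × E3 → ℝ} {K : Set E3}
    (hK : IsCompact K) (hg : ContinuousOn (fun z : ℝ × E3 × E3 => g z.1 z.2) (S ×ˢ univ))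
    (hzero : ∀ τ ∈ S, ∀ z, z.2 ∉ K → g τ z = 0) :
    ContinuousOn (fun τ => ∫ z, g τ z ∂phaseMeasure) S := by
  have h : ContinuousOn (fun τ => ∫ z, cubeBump z.1 * g τ z ∂phaseMeasure) S := by
    refine continuousOn_integral_of_compact_support (k := Metric.closedBall (0 : E3) 3 ×ˢ K)
      ((isCompact_closedBall _ _).prod hK) ?_ fun τ z hτ hz => ?_
    · exact (cubeBump.continuous.comp (by fun_prop)).continuousOn.mul hg
    · by_cases h1 : z.2 ∈ K
      · rw [cubeBump.zero_of_le_dist, zero_mul]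
        exact (not_le.1 fun h => hz ⟨h, h1⟩).le
      · rw [hzero τ hτ z h1, mul_zero]
  refine h.congr fun τ _ => integral_congr_ae ?_
  filter_upwards [ae_phaseMeasure_fst_mem] with z hz
  rw [cubeBump_eq_one hz, one_mul]

/-- Truncation of a function at scale `ε⁻¹`. -/
noncomputable def truncate (ε : ℝ) (φ : E3 → ℝ) (v : E3) : ℝ :=
  (⟨1, 2, one_pos, one_lt_two⟩ : ContDiffBump (0 : E3)) (ε • v) * φ v

variable {ε : ℝ} {φ : E3 → ℝ}

lemma contDiff_truncate (hφ : ContDiff ℝ 1 φ) : ContDiff ℝ 1 (truncate ε φ) :=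
  ((ContDiffBump.contDiff _).comp (contDiff_const_smul ε)).mul hφ

lemma hasCompactSupport_truncate (hε : 0 < ε) : HasCompactSupport (truncate ε φ) :=
  ((ContDiffBump.hasCompactSupport _).comp_smul hε.ne').mul_right

lemma abs_truncate_le (v : E3) : |truncate ε φ v| ≤ |φ v| := by
  rw [truncate, abs_mul]
  exact mul_le_of_le_one_left (abs_nonneg _)
    (abs_le.2 ⟨by linarith [ContDiffBump.nonneg (⟨1, 2, one_pos, one_lt_two⟩ :
      ContDiffBump (0 : E3)) (x := ε • v)], ContDiffBump.le_one _⟩)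

lemma truncate_eventuallyEq {v : E3} (h : ‖ε • v‖ < 1) : truncate ε φ =ᶠ[nhds v] φ := by
  have hopen : IsOpen {w : E3 | ‖ε • w‖ < 1} := isOpen_lt (by fun_prop) continuous_const
  filter_upwards [hopen.mem_nhds h] with w hw
  rw [truncate, ContDiffBump.one_of_mem_closedBall _ (mem_closedBall_zero_iff.2 (le_of_lt hw)),
    one_mul]

/-- The gradient of the cutoff at scale `ε⁻¹` has size `ε` and lives where `ε‖v‖ ≤ 2`, so it is at
most a constant over `1 + ‖v‖`, uniformly in `ε ≤ 1`. Against quadratic growth of `φ` this leaves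
linear growth. -/
lemma exists_norm_fderiv_truncate_le {C : ℝ} (hφ : ContDiff ℝ 1 φ)
    (h0 : ∀ v, |φ v| ≤ C * (1 + ‖v‖ ^ 2)) (h1 : ∀ v, ‖fderiv ℝ φ v‖ ≤ C * (1 + ‖v‖)) :
    ∃ A, 0 ≤ A ∧ ∀ ε, 0 < ε → ε ≤ 1 → ∀ v, ‖fderiv ℝ (truncate ε φ) v‖ ≤ A * (1 + ‖v‖) := by
  set χ : ContDiffBump (0 : E3) := ⟨1, 2, one_pos, one_lt_two⟩ with hχ
  have hχd : ContDiff ℝ 1 χ := χ.contDiff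
  obtain ⟨D, hD⟩ : ∃ D, ∀ x, ‖fderiv ℝ χ x‖ ≤ D :=
    (χ.hasCompactSupport.fderiv ℝ).exists_bound_of_continuous
      (hχd.continuous_fderiv one_ne_zero)
  have hD0 : 0 ≤ D := (norm_nonneg _).trans (hD 0)
  have hC0 : 0 ≤ C := by simpa using (abs_nonneg _).trans (h0 0)
  refine ⟨C * (1 + 3 * D), by positivity, fun ε hε hε1 v => ?_⟩
  have hd1 : DifferentiableAt ℝ (fun w => χ (ε • w)) v :=
    (hχd.comp (contDiff_const_smul ε)).differentiable one_ne_zero v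
  have hkey : ‖fderiv ℝ (fun w => χ (ε • w)) v‖ * (1 + ‖v‖) ≤ 3 * D := by
    rw [fderiv_comp_smul, norm_smul, Real.norm_of_nonneg hε.le]
    by_cases hv : ε • v ∈ tsupport χ
    · rw [χ.tsupport_eq, mem_closedBall_zero_iff, norm_smul, Real.norm_of_nonneg hε.le] at hv
      have hv : ε * ‖v‖ ≤ 2 := hv
      calc ε * ‖fderiv ℝ χ (ε • v)‖ * (1 + ‖v‖)
          = ‖fderiv ℝ χ (ε • v)‖ * (ε + ε * ‖v‖) := by ring
        _ ≤ D * (1 + 2) := by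
            gcongr
            exact hD _
        _ = 3 * D := by ring
    · rw [fderiv_of_notMem_tsupport ℝ hv]
      simp
      positivity
  have htr : truncate ε φ = fun w => χ (ε • w) * φ w := rfl
  rw [htr, fderiv_fun_mul hd1 (hφ.differentiable one_ne_zero v)]
  have hχ1 : |χ (ε • v)| ≤ 1 := abs_le.2 ⟨by linarith [χ.nonneg (x := ε • v)], χ.le_one⟩
  calc _ ≤ ‖χ (ε • v) • fderiv ℝ φ v‖ + ‖φ v • fderiv ℝ (fun w => χ (ε • w)) v‖ := norm_add_le _ _
    _ = |χ (ε • v)| * ‖fderiv ℝ φ v‖ + |φ v| * ‖fderiv ℝ (fun w => χ (ε • w)) v‖ := by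
        rw [norm_smul, norm_smul, Real.norm_eq_abs, Real.norm_eq_abs]
    _ ≤ 1 * (C * (1 + ‖v‖)) +
          (C * ((1 + ‖v‖) * (1 + ‖v‖))) * ‖fderiv ℝ (fun w => χ (ε • w)) v‖ := by
        gcongr
        · exact h1 v
        · refine (h0 v).trans ?_
          gcongr
          nlinarith [norm_nonneg v]
    _ = C * (1 + ‖v‖) +
          C * (1 + ‖v‖) * (‖fderiv ℝ (fun w => χ (ε • w)) v‖ * (1 + ‖v‖)) := by ring
    _ ≤ C * (1 + ‖v‖) + C * (1 + ‖v‖) * (3 * D) := by gcongr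
    _ = _ := by ring

end Cutoff

variable {μ p : ℝ} {f : ℝ → E3 → E3 → ℝ} {u : ℝ → E3 → E3} {π : ℝ → E3 → ℝ}

namespace IsRegularSolution

lemma exists_norm_u_le (h : IsRegularSolution μ p f u π) (T : ℝ) :
    ∃ U, 0 ≤ U ∧ ∀ t ∈ Icc 0 T, ∀ x, ‖u t x‖ ≤ U := by
  obtain ⟨U, hU⟩ := ((isCompact_Icc (a := (0 : ℝ)) (b := T)).prod
    isBounded_cube.isCompact_closure).exists_bound_of_continuousOn
    (h.continuous_u.mono fun z hz => ⟨hz.1.1, mem_univ _⟩)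
  refine ⟨max U 0, le_max_right _ _, fun t ht x => ?_⟩
  obtain ⟨y, hy, hxy⟩ := (h.periodic_u t ht.1).exists_mem_cube x
  rw [hxy]
  exact (hU (t, y) ⟨ht, subset_closure hy⟩).trans (le_max_left _ _)

lemma aestronglyMeasurable_of_continuousOn {g : ℝ × E3 × E3 → ℝ}
    (hg : ContinuousOn g (Ici 0 ×ˢ univ)) {s t : ℝ} (hs : 0 ≤ s) :
    AEStronglyMeasurable g ((volume.restrict (Ioc s t)).prod phaseMeasure) := by
  have h1 : AEStronglyMeasurable g
      (((volume : Measure ℝ).prod phaseMeasure).restrict (Ici 0 ×ˢ univ)) :=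
    hg.aestronglyMeasurable (measurableSet_Ici.prod MeasurableSet.univ)
  rw [← Measure.prod_restrict, Measure.restrict_univ] at h1
  exact h1.mono_measure (Measure.prod_mono
    (Measure.restrict_mono (fun τ hτ => hs.trans hτ.1.le) le_rfl) le_rfl)

/-- The moment bound, uniform on bounded time intervals, gives joint integrability in time and phase
space; this is the dominating function for the truncation limit. -/
lemma integrable_moment_prod (h : IsRegularSolution μ p f u π) {s t : ℝ} (hs : 0 ≤ s) :
    Integrable (fun z : ℝ × E3 × E3 => (1 + ‖z.2.2‖ ^ 2) * f z.1 z.2.1 z.2.2)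
      ((volume.restrict (Ioc s t)).prod phaseMeasure) := by
  have hm := aestronglyMeasurable_of_continuousOn (t := t)
    (g := fun z : ℝ × E3 × E3 => (1 + ‖z.2.2‖ ^ 2) * f z.1 z.2.1 z.2.2)
    ((by fun_prop : Continuous fun z : ℝ × E3 × E3 => 1 + ‖z.2.2‖ ^ 2).continuousOn.mul
      h.continuous_f) hs
  rw [integrable_prod_iff hm]
  refine ⟨(ae_restrict_iff' measurableSet_Ioc).2 (Filter.Eventually.of_forall fun τ hτ =>
    h.integrable_moment τ (hs.trans hτ.1.le)), ?_⟩
  obtain ⟨C, hC⟩ := h.bounded_moment t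
  refine Integrable.of_bound hm.norm.integral_prod_right' C
    ((ae_restrict_iff' measurableSet_Ioc).2 (Filter.Eventually.of_forall fun τ hτ => ?_))
  have hτ0 : 0 ≤ τ := hs.trans hτ.1.le
  rw [Real.norm_of_nonneg (integral_nonneg fun _ => norm_nonneg _)]
  refine le_trans (le_of_eq (integral_congr_ae (Filter.Eventually.of_forall fun z => ?_)))
    (hC τ hτ0 hτ.2)
  exact Real.norm_of_nonneg (mul_nonneg (by positivity) (h.nonneg_f τ hτ0 _ _))

lemma continuousOn_transport (h : IsRegularSolution μ p f u π) {φ : E3 → ℝ}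
    (hφ : ContDiff ℝ 1 φ) :
    ContinuousOn (fun z : ℝ × E3 × E3 =>
      fderiv ℝ φ z.2.2 (u z.1 z.2.1 - z.2.2) * f z.1 z.2.1 z.2.2) (Ici 0 ×ˢ univ) := by
  have hu : ContinuousOn (fun z : ℝ × E3 × E3 => u z.1 z.2.1) (Ici 0 ×ˢ univ) :=
    h.continuous_u.comp (f := fun z : ℝ × E3 × E3 => (z.1, z.2.1)) (by fun_prop)
      fun z hz => ⟨hz.1, mem_univ _⟩
  refine ContinuousOn.mul (ContinuousOn.clm_apply ?_ (hu.sub (by fun_prop))) h.continuous_f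
  exact ((hφ.continuous_fderiv one_ne_zero).comp (by fun_prop)).continuousOn

/-- Extends the identity to `s = 0`: with compact velocity support both sides are continuous up to
the initial time. -/
lemma integral_sub_eq_of_hasCompactSupport' (h : IsRegularSolution μ p f u π) {φ : E3 → ℝ}
    (hφ : ContDiff ℝ 1 φ) (hφs : HasCompactSupport φ) {s t : ℝ} (hs : 0 ≤ s) (hst : s ≤ t) :
    ∫ z, φ z.2 * f t z.1 z.2 ∂phaseMeasure - ∫ z, φ z.2 * f s z.1 z.2 ∂phaseMeasure =
      ∫ τ in s..t, ∫ z, fderiv ℝ φ z.2 (u τ z.1 - z.2) * f τ z.1 z.2 ∂phaseMeasure := by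
  rcases hst.eq_or_lt with rfl | hlt
  · simp
  rcases hs.eq_or_lt with rfl | hs0
  swap
  · exact h.integral_sub_eq_of_hasCompactSupport hφ hφs hs0 hst
  set m : ℝ → ℝ := fun τ => ∫ z, φ z.2 * f τ z.1 z.2 ∂phaseMeasure with hm
  set G : ℝ → ℝ := fun τ =>
    ∫ z, fderiv ℝ φ z.2 (u τ z.1 - z.2) * f τ z.1 z.2 ∂phaseMeasure with hG
  have hmc : ContinuousOn m (Ici 0) := by
    refine continuousOn_integral_phase hφs (ContinuousOn.mul ?_ h.continuous_f) fun τ _ z hz => ?_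
    · exact (hφ.continuous.comp (by fun_prop)).continuousOn
    · rw [image_eq_zero_of_notMem_tsupport hz, zero_mul]
  have hGc : ContinuousOn G (Ici 0) := by
    refine continuousOn_integral_phase hφs (h.continuousOn_transport hφ) fun τ _ z hz => ?_
    rw [fderiv_of_notMem_tsupport ℝ hz]
    simp
  have hGi : IntegrableOn G (uIcc 0 t) := by
    rw [uIcc_of_le hst]
    exact (hGc.mono Icc_subset_Ici_self).integrableOn_Icc
  have hprim : Filter.Tendsto (fun s => ∫ τ in s..t, G τ) (nhdsWithin 0 (Ioi 0))
      (nhds (∫ τ in (0 : ℝ)..t, G τ)) := by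
    have := intervalIntegral.continuousOn_primitive_interval_left hGi 0 left_mem_uIcc
    rw [ContinuousWithinAt, uIcc_of_le hst] at this
    exact this.mono_left (nhdsWithin_le_of_mem (Icc_mem_nhdsGT hlt))
  have hlim : Filter.Tendsto (fun s => m t - m s) (nhdsWithin 0 (Ioi 0)) (nhds (m t - m 0)) :=
    ((hmc 0 self_mem_Ici).mono_left (nhdsWithin_mono _ Ioi_subset_Ici_self)).const_sub _
  refine tendsto_nhds_unique hlim (hprim.congr' ?_)
  filter_upwards [Ioo_mem_nhdsGT hlt] with s hs
  exact (h.integral_sub_eq_of_hasCompactSupport hφ hφs hs.1 hs.2.le).symm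

/-- The weak form of the Vlasov equation for test functions of quadratic growth. -/
lemma integral_sub_eq (h : IsRegularSolution μ p f u π) {φ : E3 → ℝ} {C : ℝ}
    (hφ : ContDiff ℝ 1 φ) (h0 : ∀ v, |φ v| ≤ C * (1 + ‖v‖ ^ 2))
    (h1 : ∀ v, ‖fderiv ℝ φ v‖ ≤ C * (1 + ‖v‖)) {s t : ℝ} (hs : 0 ≤ s) (hst : s ≤ t) :
    IntervalIntegrable
        (fun τ => ∫ z, fderiv ℝ φ z.2 (u τ z.1 - z.2) * f τ z.1 z.2 ∂phaseMeasure) volume s t ∧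
      ∫ z, φ z.2 * f t z.1 z.2 ∂phaseMeasure - ∫ z, φ z.2 * f s z.1 z.2 ∂phaseMeasure =
        ∫ τ in s..t, ∫ z, fderiv ℝ φ z.2 (u τ z.1 - z.2) * f τ z.1 z.2 ∂phaseMeasure := by
  obtain ⟨U, hU0, hU⟩ := h.exists_norm_u_le t
  obtain ⟨A, hA0, hA⟩ := exists_norm_fderiv_truncate_le hφ h0 h1
  have hC0 : 0 ≤ C := by simpa using (abs_nonneg _).trans (h0 0)
  set ν := ((volume : Measure ℝ).restrict (Ioc s t)).prod phaseMeasure with hν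
  have hW := h.integrable_moment_prod (t := t) hs
  have hae : ∀ᵐ z ∂ν, z.1 ∈ Ioc s t :=
    Measure.quasiMeasurePreserving_fst.ae (ae_restrict_mem measurableSet_Ioc)
  -- Linear growth of the gradient times linear growth of `u - v` stays within the second moment,
  -- since `u` is bounded on `[0,t]`.
  have hbound : ∀ (ψ : E3 → ℝ) (B : ℝ), 0 ≤ B → (∀ v, ‖fderiv ℝ ψ v‖ ≤ B * (1 + ‖v‖)) →
      ∀ᵐ z ∂ν, ‖fderiv ℝ ψ z.2.2 (u z.1 z.2.1 - z.2.2) * f z.1 z.2.1 z.2.2‖ ≤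
        B * (2 * (1 + U)) * ((1 + ‖z.2.2‖ ^ 2) * f z.1 z.2.1 z.2.2) := by
    intro ψ B hB0 hB
    filter_upwards [hae] with z hz
    have hz0 : 0 ≤ z.1 := hs.trans hz.1.le
    have hf0 := h.nonneg_f z.1 hz0 z.2.1 z.2.2
    rw [norm_mul, Real.norm_of_nonneg hf0, ← mul_assoc]
    gcongr
    have hv := norm_nonneg z.2.2
    calc ‖fderiv ℝ ψ z.2.2 (u z.1 z.2.1 - z.2.2)‖
        ≤ ‖fderiv ℝ ψ z.2.2‖ * ‖u z.1 z.2.1 - z.2.2‖ := ContinuousLinearMap.le_opNorm _ _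
      _ ≤ (B * (1 + ‖z.2.2‖)) * (U + ‖z.2.2‖) := by
          gcongr
          · exact hB _
          · exact (norm_sub_le _ _).trans (add_le_add (hU _ ⟨hz0, hz.2⟩ _) le_rfl)
      _ = B * ((1 + ‖z.2.2‖) * (U + ‖z.2.2‖)) := by ring
      _ ≤ B * (2 * (1 + U) * (1 + ‖z.2.2‖ ^ 2)) := by
          refine mul_le_mul_of_nonneg_left ?_ hB0
          nlinarith [sq_nonneg (1 - ‖z.2.2‖), mul_nonneg hU0 hv,
            mul_nonneg hU0 (sq_nonneg (1 - ‖z.2.2‖))]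
      _ = _ := by ring
  have hmeas : ∀ ψ : E3 → ℝ, ContDiff ℝ 1 ψ → AEStronglyMeasurable (fun z : ℝ × E3 × E3 =>
      fderiv ℝ ψ z.2.2 (u z.1 z.2.1 - z.2.2) * f z.1 z.2.1 z.2.2) ν := fun ψ hψ =>
    aestronglyMeasurable_of_continuousOn (h.continuousOn_transport hψ) hs
  have hintφ : Integrable (fun z : ℝ × E3 × E3 =>
      fderiv ℝ φ z.2.2 (u z.1 z.2.1 - z.2.2) * f z.1 z.2.1 z.2.2) ν :=
    (hW.const_mul _).mono' (hmeas φ hφ) (hbound φ C hC0 h1)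
  refine ⟨?_, ?_⟩
  · rw [intervalIntegrable_iff, uIoc_of_le hst]
    exact hintφ.integral_prod_left
  set ε : ℕ → ℝ := fun n => 1 / ((n : ℝ) + 1) with hε
  have hε0 : ∀ n, 0 < ε n := fun n => Nat.one_div_pos_of_nat
  have hε1 : ∀ n, ε n ≤ 1 := fun n => by
    rw [hε]
    exact (div_le_one (by positivity)).2 (by linarith [(Nat.cast_nonneg n : (0 : ℝ) ≤ n)])
  have hεt : Filter.Tendsto ε Filter.atTop (nhds 0) := tendsto_one_div_add_atTop_nhds_zero_nat
  -- Near each fixed `v` the truncation is eventually exact, so values and derivatives converge by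
  -- being eventually constant.
  have hev : ∀ v : E3, ∀ᶠ n in Filter.atTop, truncate (ε n) φ =ᶠ[nhds v] φ := by
    intro v
    have h2 : Filter.Tendsto (fun n => ‖ε n • v‖) Filter.atTop (nhds 0) := by
      simpa using (hεt.smul_const v).norm
    filter_upwards [h2.eventually_lt_const one_pos] with n hn using truncate_eventuallyEq hn
  have hleft : ∀ τ, 0 ≤ τ → Filter.Tendsto
      (fun n => ∫ z, truncate (ε n) φ z.2 * f τ z.1 z.2 ∂phaseMeasure) Filter.atTop
      (nhds (∫ z, φ z.2 * f τ z.1 z.2 ∂phaseMeasure)) := by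
    intro τ hτ
    refine tendsto_integral_of_dominated_convergence
      (fun z => C * ((1 + ‖z.2‖ ^ 2) * f τ z.1 z.2)) (fun n => ?_)
      ((h.integrable_moment τ hτ).const_mul C) (fun n => Filter.Eventually.of_forall fun z => ?_)
      (Filter.Eventually.of_forall fun z => ?_)
    · exact (((contDiff_truncate hφ).continuous.comp continuous_snd).mul
        (h.continuous_f_slice hτ)).aestronglyMeasurable
    · have hf0 := h.nonneg_f τ hτ z.1 z.2
      rw [norm_mul, Real.norm_of_nonneg hf0, Real.norm_eq_abs, ← mul_assoc]
      gcongr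
      exact (abs_truncate_le _).trans (h0 _)
    · refine tendsto_const_nhds.congr' ?_
      filter_upwards [hev z.2] with n hn
      rw [hn.eq_of_nhds]
  have hright : Filter.Tendsto (fun n => ∫ z, fderiv ℝ (truncate (ε n) φ) z.2.2
      (u z.1 z.2.1 - z.2.2) * f z.1 z.2.1 z.2.2 ∂ν) Filter.atTop
      (nhds (∫ z, fderiv ℝ φ z.2.2 (u z.1 z.2.1 - z.2.2) * f z.1 z.2.1 z.2.2 ∂ν)) := by
    refine tendsto_integral_of_dominated_convergence _
      (fun n => hmeas _ (contDiff_truncate hφ)) (hW.const_mul (A * (2 * (1 + U))))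
      (fun n => hbound _ A hA0 (hA _ (hε0 n) (hε1 n))) (Filter.Eventually.of_forall fun z => ?_)
    refine tendsto_const_nhds.congr' ?_
    filter_upwards [hev z.2.2] with n hn
    rw [hn.fderiv_eq]
  have hiter : ∀ ψ : E3 → ℝ, Integrable (fun z : ℝ × E3 × E3 =>
      fderiv ℝ ψ z.2.2 (u z.1 z.2.1 - z.2.2) * f z.1 z.2.1 z.2.2) ν →
      ∫ z, fderiv ℝ ψ z.2.2 (u z.1 z.2.1 - z.2.2) * f z.1 z.2.1 z.2.2 ∂ν =
      ∫ τ in s..t, ∫ z, fderiv ℝ ψ z.2 (u τ z.1 - z.2) * f τ z.1 z.2 ∂phaseMeasure := by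
    intro ψ hψ
    rw [hν, integral_prod _ hψ, intervalIntegral.integral_of_le hst]
  rw [← hiter φ hintφ]
  refine tendsto_nhds_unique ((hleft t (hs.trans hst)).sub (hleft s hs)) (hright.congr fun n => ?_)
  have hn := (hW.const_mul _).mono' (hmeas _ (contDiff_truncate (ε := ε n) hφ))
    (hbound _ A hA0 (hA _ (hε0 n) (hε1 n)))
  rw [hiter _ hn]
  exact (h.integral_sub_eq_of_hasCompactSupport' (contDiff_truncate hφ)
    (hasCompactSupport_truncate (hε0 n)) hs hst).symm

end IsRegularSolution

end VlasovPowerLaw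

/-! ### Momentum and kinetic energy balances of the fluid -/

namespace VlasovPowerLaw

lemma partialD_apply {w : E3 → E3} {x : E3} (hw : DifferentiableAt ℝ w x) (i j : Fin 3) :
    partialD j (fun y => w y i) x = (partialD j w x) i := by
  have := ((EuclideanSpace.proj (𝕜 := ℝ) i).hasFDerivAt.comp x hw.hasFDerivAt).fderiv
  change fderiv ℝ ((EuclideanSpace.proj (𝕜 := ℝ) i) ∘ w) x _ = _
  rw [this]
  rfl

lemma contDiff_apply_coord {w : E3 → E3} (hw : ContDiff ℝ 1 w) (i : Fin 3) :
    ContDiff ℝ 1 fun y => w y i :=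
  (EuclideanSpace.proj (𝕜 := ℝ) i).contDiff.comp hw

/-- A divergence-free field transports with zero mean. -/
lemma integral_torus_fderiv_apply_eq_zero {w : E3 → E3} {b : E3 → ℝ} (hw : ContDiff ℝ 1 w)
    (hwp : IsPeriodic w) (hdiv : ∀ x, divergence w x = 0) (hb : ContDiff ℝ 1 b)
    (hbp : IsPeriodic b) : ∫ x, fderiv ℝ b x (w x) ∂torusMeasure = 0 := by
  have hwi := contDiff_apply_coord hw
  have hpi : ∀ i, IsPeriodic fun y => w y i := fun i => hwp.comp fun v => v i
  have hi : ∀ j, Integrable (fun x => w x j * partialD j b x) torusMeasure := fun j =>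
    integrable_torus_of_continuous ((hwi j).continuous.mul (continuous_partialD hb j))
  have hi' : ∀ j, Integrable (fun x => partialD j (fun y => w y j) x * b x) torusMeasure :=
    fun j => integrable_torus_of_continuous ((continuous_partialD (hwi j) j).mul hb.continuous)
  simp only [fderiv_apply_eq_sum, smul_eq_mul]
  rw [integral_finsetSum _ fun j _ => hi j]
  simp only [integral_torus_mul_partialD (hpi _) hbp (hwi _) hb]
  rw [Finset.sum_neg_distrib, ← integral_finsetSum _ fun j _ => hi' j]
  simp only [← Finset.sum_mul, partialD_apply (hw.differentiable one_ne_zero _)]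
  simp only [divergence] at hdiv
  simp [hdiv]

/-- The stress is symmetric, so contracting it with the gradient keeps only `Du` and produces the
density `μ|Du|^p`. Where `Du = 0` the value of the possibly singular factor `|Du|^(p-2)` is
irrelevant. -/
lemma sum_partialD_mul_stress {w : E3 → E3} {x : E3} (μ p : ℝ) (hp : 1 < p) :
    ∑ i, ∑ j, (partialD j w x) i * stress μ p (symGrad w x) i j =
      μ * frob (symGrad w x) ^ p := by
  have h1 : ∑ i, ∑ j, (partialD j w x) i * symGrad w x i j = frob (symGrad w x) ^ 2 := by
    rw [frob_sq]
    simp only [symGrad, Matrix.of_apply, Fin.sum_univ_three]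
    ring
  have h2 : frob (symGrad w x) ^ (p - 2) * frob (symGrad w x) ^ 2 = frob (symGrad w x) ^ p := by
    rcases (frob_nonneg (symGrad w x)).eq_or_lt with h0 | h0
    · rw [← h0, Real.zero_rpow (by linarith : p ≠ 0)]
      simp
    · rw [← Real.rpow_natCast, ← Real.rpow_add h0]
      norm_num
  rw [← h2, ← h1]
  simp only [stress, Matrix.smul_apply, smul_eq_mul, Finset.mul_sum]
  exact Finset.sum_congr rfl fun i _ => Finset.sum_congr rfl fun j _ => by ring

lemma integrable_frob_rpow {w : E3 → E3} (hw : ContDiff ℝ 1 w) {p : ℝ} (hp : 0 ≤ p) :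
    Integrable (fun x => frob (symGrad w x) ^ p) torusMeasure :=
  integrable_torus_of_continuous
    ((continuous_frob.comp (continuous_symGrad hw)).rpow_const fun _ => Or.inr hp)

lemma integral_neg_sub_add_sub {α : Type*} [MeasurableSpace α] {ν : Measure α} {a b c d : α → ℝ}
    (ha : Integrable a ν) (hb : Integrable b ν) (hc : Integrable c ν) (hd : Integrable d ν) :
    ∫ x, (-a x - b x + c x - d x) ∂ν =
      -(∫ x, a x ∂ν) - ∫ x, b x ∂ν + ∫ x, c x ∂ν - ∫ x, d x ∂ν := by
  have h1 : Integrable (fun x => -a x) ν := ha.neg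
  have h2 : Integrable (fun x => -a x - b x) ν := h1.sub hb
  have h3 : Integrable (fun x => -a x - b x + c x) ν := h2.add hc
  rw [integral_sub h3 hd, integral_add h2 hc, integral_sub h1 hb, integral_neg]

variable {μ p : ℝ} {f : ℝ → E3 → E3 → ℝ} {u : ℝ → E3 → E3} {π : ℝ → E3 → ℝ}

namespace IsRegularSolution

lemma hasDerivAt_u (h : IsRegularSolution μ p f u π) {t : ℝ} (ht : 0 < t) (x : E3) :
    HasDerivAt (fun s => u s x) (fderiv ℝ (fun z : ℝ × E3 => u z.1 z.2) (t, x) (1, 0)) t := by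
  have h1 : DifferentiableAt ℝ (fun z : ℝ × E3 => u z.1 z.2) (t, x) :=
    (h.contDiff_u.differentiableOn one_ne_zero).differentiableAt
      ((isOpen_Ioi.prod isOpen_univ).mem_nhds (mk_mem_prod ht (mem_univ _)))
  exact h1.hasFDerivAt.comp_hasDerivAt (f := fun s : ℝ => (s, x)) t
    ((hasDerivAt_id t).prodMk (hasDerivAt_const t x))

lemma continuousOn_deriv_u (h : IsRegularSolution μ p f u π) :
    ContinuousOn (fun z : ℝ × E3 => deriv (fun s => u s z.2) z.1) (Ioi 0 ×ˢ univ) := by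
  refine ContinuousOn.congr (f := fun z : ℝ × E3 => fderiv ℝ
    (fun z : ℝ × E3 => u z.1 z.2) z (1, 0))
    ((h.contDiff_u.continuousOn_fderiv_of_isOpen (isOpen_Ioi.prod isOpen_univ) le_rfl).clm_apply
      continuousOn_const) fun z hz => ?_
  exact (h.hasDerivAt_u hz.1 z.2).deriv

lemma continuous_deriv_u_slice (h : IsRegularSolution μ p f u π) {t : ℝ} (ht : 0 < t) :
    Continuous fun x => deriv (fun s => u s x) t := by
  rw [← continuousOn_univ]
  exact h.continuousOn_deriv_u.comp (f := fun x : E3 => (t, x)) (by fun_prop)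
    fun x _ => ⟨ht, mem_univ _⟩

lemma integrable_phase_of_le (h : IsRegularSolution μ p f u π) {t : ℝ} (ht : 0 ≤ t)
    {g : E3 × E3 → ℝ} (hg : Continuous g) {C : ℝ}
    (hC : ∀ z, |g z| ≤ C * (1 + ‖z.2‖ ^ 2)) :
    Integrable (fun z => g z * f t z.1 z.2) phaseMeasure := by
  refine ((h.integrable_moment t ht).const_mul C).mono'
    (hg.mul (h.continuous_f_slice ht)).aestronglyMeasurable
    (Filter.Eventually.of_forall fun z => ?_)
  have hf0 := h.nonneg_f t ht z.1 z.2
  rw [norm_mul, Real.norm_of_nonneg hf0, Real.norm_eq_abs, ← mul_assoc]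
  gcongr
  exact hC z

lemma integrable_force (h : IsRegularSolution μ p f u π) {t : ℝ} (ht : 0 < t) (x : E3) :
    Integrable fun v => f t x v • (u t x - v) := by
  have hfc := (h.contDiff_f_snd ht x).continuous
  refine ((h.integrable_slice t ht x).const_mul (1 + ‖u t x‖)).mono'
    (hfc.smul (by fun_prop)).aestronglyMeasurable (Filter.Eventually.of_forall fun v => ?_)
  have hf0 := h.nonneg_f t ht.le x v
  rw [norm_smul, Real.norm_of_nonneg hf0, ← mul_assoc, mul_comm]
  gcongr
  nlinarith [norm_sub_le (u t x) v, norm_nonneg (u t x), norm_nonneg v,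
    mul_nonneg (norm_nonneg (u t x)) (norm_nonneg v)]

lemma integral_inner_force (h : IsRegularSolution μ p f u π) {t : ℝ} (ht : 0 < t)
    {w : E3 → E3} (hw : Continuous w) (hwp : IsPeriodic w) :
    Integrable (fun z : E3 × E3 => inner ℝ (w z.1) (u t z.1 - z.2) * f t z.1 z.2) phaseMeasure ∧
    ∫ x, inner ℝ (w x) (∫ v, f t x v • (u t x - v)) ∂torusMeasure =
      ∫ z, inner ℝ (w z.1) (u t z.1 - z.2) * f t z.1 z.2 ∂phaseMeasure := by
  have huc := h.continuous_u_slice ht.le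
  obtain ⟨U, hU⟩ := (h.periodic_u t ht.le).exists_norm_le huc
  obtain ⟨W, hW⟩ := hwp.exists_norm_le hw
  have hW0 : 0 ≤ W := (norm_nonneg _).trans (hW 0)
  have hU0 : 0 ≤ U := (norm_nonneg _).trans (hU 0)
  have hint : Integrable (fun z : E3 × E3 => inner ℝ (w z.1) (u t z.1 - z.2) * f t z.1 z.2)
      phaseMeasure := by
    refine h.integrable_phase_of_le ht.le (C := W * (U + 1)) (by fun_prop) fun z => ?_
    calc |inner ℝ (w z.1) (u t z.1 - z.2)| ≤ ‖w z.1‖ * ‖u t z.1 - z.2‖ :=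
          abs_real_inner_le_norm _ _
      _ ≤ W * (U + ‖z.2‖) := by
          gcongr
          · exact hW _
          · exact (norm_sub_le _ _).trans (add_le_add (hU _) le_rfl)
      _ ≤ W * ((U + 1) * (1 + ‖z.2‖ ^ 2)) := by
          refine mul_le_mul_of_nonneg_left ?_ hW0
          nlinarith [sq_nonneg (1 - ‖z.2‖), norm_nonneg z.2,
            mul_nonneg hU0 (sq_nonneg ‖z.2‖)]
      _ = _ := by ring
  refine ⟨hint, ?_⟩
  rw [phaseMeasure, integral_prod _ hint]
  refine integral_congr_ae (Filter.Eventually.of_forall fun x => ?_)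
  simp only []
  rw [← integral_inner (h.integrable_force ht x)]
  simp only [inner_smul_right, mul_comm]

lemma deriv_u_apply (h : IsRegularSolution μ p f u π) {t : ℝ} (ht : 0 < t) (x : E3) (i : Fin 3) :
    (deriv (fun s => u s x) t) i = -(fderiv ℝ (fun y => u t y i) x (u t x)) - partialD i (π t) x
      + ∑ j, partialD j (fun y => stress μ p (symGrad (u t) y) i j) x
      - (∫ v, f t x v • (u t x - v)) i := by
  have h1 := h.momentum t ht x i
  have h2 : fderiv ℝ (fun y => u t y i) x (u t x) = (fderiv ℝ (u t) x (u t x)) i := by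
    have := ((EuclideanSpace.proj (𝕜 := ℝ) i).hasFDerivAt.comp x
      ((h.contDiff_u_slice ht).differentiable one_ne_zero x).hasFDerivAt).fderiv
    change fderiv ℝ ((EuclideanSpace.proj (𝕜 := ℝ) i) ∘ u t) x _ = _
    rw [this]
    rfl
  rw [h2]
  linarith

/-- Slicewise integrability in `v` does not by itself give continuity of the drag in `x`; the
momentum equation expresses it through continuous terms. -/
lemma continuous_force (h : IsRegularSolution μ p f u π) {t : ℝ} (ht : 0 < t) (i : Fin 3) :
    Continuous fun x => (∫ v, f t x v • (u t x - v)) i := by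
  have hu := h.contDiff_u_slice ht
  have e : (fun x => (∫ v, f t x v • (u t x - v)) i) = fun x =>
      -(fderiv ℝ (fun y => u t y i) x (u t x)) - partialD i (π t) x
      + ∑ j, partialD j (fun y => stress μ p (symGrad (u t) y) i j) x
      - (deriv (fun s => u s x) t) i := funext fun x => by
    rw [h.deriv_u_apply ht]
    ring
  rw [e]
  refine ((Continuous.sub ?_ (continuous_partialD (h.contDiff_pressure t ht) i)).add
    (continuous_finsetSum _ fun j _ => continuous_partialD (h.contDiff_stress t ht i j) j)).sub ?_
  · exact (((contDiff_apply_coord hu i).continuous_fderiv one_ne_zero).clm_apply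
      hu.continuous).neg
  · exact (EuclideanSpace.proj (𝕜 := ℝ) i).continuous.comp (h.continuous_deriv_u_slice ht)

lemma periodic_stress (h : IsRegularSolution μ p f u π) {t : ℝ} (ht : 0 < t) (i j : Fin 3) :
    IsPeriodic fun y => stress μ p (symGrad (u t) y) i j :=
  (h.periodic_u t ht.le).symGrad.comp fun K => stress μ p K i j

/-- The balance of momentum of the fluid. -/
lemma integral_deriv_u_apply (h : IsRegularSolution μ p f u π) {t : ℝ} (ht : 0 < t) (i : Fin 3) :
    ∫ x, (deriv (fun s => u s x) t) i ∂torusMeasure =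
      -∫ x, (∫ v, f t x v • (u t x - v)) i ∂torusMeasure := by
  have hu := h.contDiff_u_slice ht
  have hup := h.periodic_u t ht.le
  have hui := contDiff_apply_coord hu i
  have hi1 : Integrable (fun x => fderiv ℝ (fun y => u t y i) x (u t x)) torusMeasure :=
    integrable_torus_of_continuous ((hui.continuous_fderiv one_ne_zero).clm_apply hu.continuous)
  have hi2 := integrable_torus_of_continuous (continuous_partialD (h.contDiff_pressure t ht) i)
  have hi3 : ∀ j, Integrable (partialD j (fun y => stress μ p (symGrad (u t) y) i j))
      torusMeasure := fun j =>
    integrable_torus_of_continuous (continuous_partialD (h.contDiff_stress t ht i j) j)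
  have hi4 := integrable_torus_of_continuous (h.continuous_force ht i)
  have z1 : ∫ x, fderiv ℝ (fun y => u t y i) x (u t x) ∂torusMeasure = 0 :=
    integral_torus_fderiv_apply_eq_zero hu hup (h.incompressible t ht) hui
      (hup.comp fun v => v i)
  have z2 : ∫ x, partialD i (π t) x ∂torusMeasure = 0 :=
    integral_torus_fderiv_eq_zero (h.periodic_pressure t ht) (h.contDiff_pressure t ht) _
  have z3 : ∀ j, ∫ x, partialD j (fun y => stress μ p (symGrad (u t) y) i j) x ∂torusMeasure = 0 :=
    fun j => integral_torus_fderiv_eq_zero (h.periodic_stress ht i j)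
      (h.contDiff_stress t ht i j) _
  simp only [h.deriv_u_apply ht]
  have hi5 : Integrable (fun x => ∑ j, partialD j
      (fun y => stress μ p (symGrad (u t) y) i j) x) torusMeasure :=
    integrable_finsetSum _ fun j _ => hi3 j
  refine (integral_neg_sub_add_sub hi1 hi2 hi5 hi4).trans ?_
  rw [z1, z2, integral_finsetSum _ fun j _ => hi3 j]
  simp [z3]

/-- The balance of kinetic energy of the fluid. -/
lemma integral_inner_deriv_u (h : IsRegularSolution μ p f u π) (hp : 1 < p) {t : ℝ} (ht : 0 < t) :
    ∫ x, inner ℝ (u t x) (deriv (fun s => u s x) t) ∂torusMeasure =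
      -(μ * ∫ x, frob (symGrad (u t) x) ^ p ∂torusMeasure) -
        ∫ z, inner ℝ (u t z.1) (u t z.1 - z.2) * f t z.1 z.2 ∂phaseMeasure := by
  have hu := h.contDiff_u_slice ht
  have hup := h.periodic_u t ht.le
  have hui := contDiff_apply_coord hu
  have hupi : ∀ i, IsPeriodic fun y => u t y i := fun i => hup.comp fun v => v i
  have hdiv := h.incompressible t ht
  have hπ := h.contDiff_pressure t ht
  have hτ := h.contDiff_stress t ht
  have hJc : Continuous fun x => ∫ v, f t x v • (u t x - v) :=
    (PiLp.continuous_toLp 2 fun _ : Fin 3 => ℝ).comp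
      (continuous_pi fun i => h.continuous_force ht i)
  -- With `k = |u|²/2`, convection contributes `u·∇k` and the pressure `u·∇π`; both have zero mean
  -- because `u` is divergence free.
  set k : E3 → ℝ := fun x => 1 / 2 * ∑ i, u t x i * u t x i with hk
  have hkc : ContDiff ℝ 1 k :=
    contDiff_const.mul (ContDiff.sum fun i _ => (hui i).mul (hui i))
  have hkp : IsPeriodic k := hup.comp fun v => 1 / 2 * ∑ i, v i * v i
  have hkd : ∀ x, fderiv ℝ k x (u t x) = ∑ i, u t x i * fderiv ℝ (fun y => u t y i) x (u t x) := by
    intro x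
    have hd : ∀ i, HasFDerivAt (fun y => u t y i) (fderiv ℝ (fun y => u t y i) x) x := fun i =>
      ((hui i).differentiable one_ne_zero x).hasFDerivAt
    have := ((HasFDerivAt.fun_sum fun i (_ : i ∈ Finset.univ) => (hd i).fun_mul (hd i)).const_mul
      (1 / 2 : ℝ)).fderiv
    rw [hk, this]
    simp only [smul_apply, sum_apply, add_apply, smul_eq_mul, Finset.mul_sum]
    exact Finset.sum_congr rfl fun i _ => by ring
  have hpt : ∀ x, inner ℝ (u t x) (deriv (fun s => u s x) t) =
      -(fderiv ℝ k x (u t x)) - fderiv ℝ (π t) x (u t x)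
      + ∑ i, ∑ j, u t x i * partialD j (fun y => stress μ p (symGrad (u t) y) i j) x
      - inner ℝ (u t x) (∫ v, f t x v • (u t x - v)) := by
    intro x
    rw [hkd, fderiv_apply_eq_sum (π t)]
    simp only [PiLp.inner_apply, RCLike.inner_apply, conj_trivial, h.deriv_u_apply ht,
      smul_eq_mul, ← Finset.mul_sum]
    rw [← Finset.sum_neg_distrib, ← Finset.sum_sub_distrib, ← Finset.sum_add_distrib,
      ← Finset.sum_sub_distrib]
    exact Finset.sum_congr rfl fun i _ => by ring
  have hi1 : Integrable (fun x => fderiv ℝ k x (u t x)) torusMeasure :=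
    integrable_torus_of_continuous ((hkc.continuous_fderiv one_ne_zero).clm_apply hu.continuous)
  have hi2 : Integrable (fun x => fderiv ℝ (π t) x (u t x)) torusMeasure :=
    integrable_torus_of_continuous ((hπ.continuous_fderiv one_ne_zero).clm_apply hu.continuous)
  have hi3 : ∀ i j, Integrable (fun x => u t x i * partialD j
      (fun y => stress μ p (symGrad (u t) y) i j) x) torusMeasure := fun i j =>
    integrable_torus_of_continuous ((hui i).continuous.mul (continuous_partialD (hτ i j) j))
  have hi3' : Integrable (fun x => ∑ i, ∑ j, u t x i * partialD j
      (fun y => stress μ p (symGrad (u t) y) i j) x) torusMeasure :=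
    integrable_finsetSum _ fun i _ => integrable_finsetSum _ fun j _ => hi3 i j
  have hi4 : Integrable (fun x => inner ℝ (u t x) (∫ v, f t x v • (u t x - v))) torusMeasure :=
    integrable_torus_of_continuous (hu.continuous.inner hJc)
  have z1 : ∫ x, fderiv ℝ k x (u t x) ∂torusMeasure = 0 :=
    integral_torus_fderiv_apply_eq_zero hu hup hdiv hkc hkp
  have z2 : ∫ x, fderiv ℝ (π t) x (u t x) ∂torusMeasure = 0 :=
    integral_torus_fderiv_apply_eq_zero hu hup hdiv hπ (h.periodic_pressure t ht)
  have hi5 : ∀ i j, Integrable (fun x => (partialD j (u t) x) i *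
      stress μ p (symGrad (u t) x) i j) torusMeasure := fun i j =>
    integrable_torus_of_continuous (((EuclideanSpace.proj (𝕜 := ℝ) i).continuous.comp
      (continuous_partialD hu j)).mul (hτ i j).continuous)
  have z3 : ∫ x, ∑ i, ∑ j, u t x i * partialD j
      (fun y => stress μ p (symGrad (u t) y) i j) x ∂torusMeasure =
      -(μ * ∫ x, frob (symGrad (u t) x) ^ p ∂torusMeasure) := by
    rw [← integral_const_mul, ← integral_neg]
    simp only [← sum_partialD_mul_stress (w := u t) μ p hp]
    rw [integral_finsetSum _ fun i _ => integrable_finsetSum _ fun j _ => hi3 i j, integral_neg,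
      integral_finsetSum _ fun i _ => integrable_finsetSum _ fun j _ => hi5 i j,
      ← Finset.sum_neg_distrib]
    refine Finset.sum_congr rfl fun i _ => ?_
    rw [integral_finsetSum _ fun j _ => hi3 i j, integral_finsetSum _ fun j _ => hi5 i j,
      ← Finset.sum_neg_distrib]
    refine Finset.sum_congr rfl fun j _ => ?_
    rw [integral_torus_mul_partialD (hupi i) (h.periodic_stress ht i j) (hui i) (hτ i j)]
    simp only [partialD_apply (hu.differentiable one_ne_zero _)]
  simp only [hpt]
  refine (integral_neg_sub_add_sub hi1 hi2 hi3' hi4).trans ?_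
  rw [z1, z2, z3, (h.integral_inner_force ht hu.continuous hup).2]
  ring

end IsRegularSolution

end VlasovPowerLaw

/-! ### Moments, conservation laws and the energy balance -/

namespace VlasovPowerLaw

lemma norm_sq_eq_sum_sq (v : E3) : ‖v‖ ^ 2 = ∑ i, v i ^ 2 := by
  rw [EuclideanSpace.norm_sq_eq]
  simp

lemma abs_apply_le_norm (v : E3) (i : Fin 3) : |v i| ≤ ‖v‖ := by
  simpa using PiLp.norm_apply_le v i

lemma norm_le_one_add_sq (v : E3) : ‖v‖ ≤ 1 + ‖v‖ ^ 2 := by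
  nlinarith [sq_nonneg (1 - ‖v‖), norm_nonneg v]

variable {μ p : ℝ} {f : ℝ → E3 → E3 → ℝ} {u : ℝ → E3 → E3} {π : ℝ → E3 → ℝ}

/-- The total rate of dissipation of the kinetic energy. -/
noncomputable def dissipation (μ p : ℝ) (f : ℝ → E3 → E3 → ℝ) (u : ℝ → E3 → E3) (t : ℝ) : ℝ :=
  μ * ∫ x, frob (symGrad (u t) x) ^ p ∂torusMeasure +
    ∫ z, ‖u t z.1 - z.2‖ ^ 2 * f t z.1 z.2 ∂phaseMeasure

namespace IsRegularSolution

lemma integrable_f (h : IsRegularSolution μ p f u π) {t : ℝ} (ht : 0 ≤ t) :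
    Integrable (fun z : E3 × E3 => f t z.1 z.2) phaseMeasure := by
  simpa using h.integrable_phase_of_le ht (g := fun _ => 1) continuous_const (C := 1)
    fun z => by rw [abs_one, one_mul]; nlinarith [sq_nonneg ‖z.2‖]

lemma integrable_norm_sq (h : IsRegularSolution μ p f u π) {t : ℝ} (ht : 0 ≤ t) :
    Integrable (fun z : E3 × E3 => ‖z.2‖ ^ 2 * f t z.1 z.2) phaseMeasure :=
  h.integrable_phase_of_le ht (by fun_prop) (C := 1) fun z => by
    rw [abs_of_nonneg (sq_nonneg _)]
    linarith

lemma integrable_smul (h : IsRegularSolution μ p f u π) {t : ℝ} (ht : 0 ≤ t) :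
    Integrable (fun z : E3 × E3 => f t z.1 z.2 • z.2) phaseMeasure := by
  have h1 := h.integrable_phase_of_le ht (g := fun z => ‖z.2‖) (by fun_prop) (C := 1) fun z => by
    rw [abs_of_nonneg (norm_nonneg _), one_mul]
    exact norm_le_one_add_sq _
  refine h1.mono' ((h.continuous_f_slice ht).smul continuous_snd).aestronglyMeasurable
    (Filter.Eventually.of_forall fun z => ?_)
  rw [norm_smul, Real.norm_of_nonneg (h.nonneg_f t ht _ _), mul_comm]

lemma inner_particleMean (h : IsRegularSolution μ p f u π) {t : ℝ} (ht : 0 ≤ t) (w : E3) :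
    inner ℝ w (particleMean f t) = ∫ z, inner ℝ w z.2 * f t z.1 z.2 ∂phaseMeasure := by
  rw [particleMean, ← integral_inner (h.integrable_smul ht)]
  simp only [inner_smul_right, mul_comm]

lemma particleMean_apply (h : IsRegularSolution μ p f u π) {t : ℝ} (ht : 0 ≤ t) (i : Fin 3) :
    (particleMean f t) i = ∫ z, z.2 i * f t z.1 z.2 ∂phaseMeasure := by
  have := h.inner_particleMean ht (EuclideanSpace.single i 1)
  simpa [EuclideanSpace.inner_single_left] using this

lemma fluidMean_apply (h : IsRegularSolution μ p f u π) {t : ℝ} (ht : 0 ≤ t) (i : Fin 3) :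
    (fluidMean u t) i = ∫ x, u t x i ∂torusMeasure :=
  ((EuclideanSpace.proj (𝕜 := ℝ) i).integral_comp_comm
    (integrable_torus_of_continuous (h.continuous_u_slice ht))).symm

lemma mass_eq (h : IsRegularSolution μ p f u π) {t : ℝ} (ht : 0 ≤ t) :
    ∫ z, f t z.1 z.2 ∂phaseMeasure = ∫ z, f 0 z.1 z.2 ∂phaseMeasure := by
  have := (h.integral_sub_eq (φ := fun _ => 1) (C := 1) contDiff_const
    (fun v => by rw [abs_one, one_mul]; nlinarith [sq_nonneg ‖v‖])
    (fun v => by simp; positivity) le_rfl ht).2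
  simp only [one_mul, fderiv_fun_const, Pi.zero_apply, zero_apply, zero_mul, integral_zero,
    intervalIntegral.integral_zero] at this
  linarith

lemma integral_norm_sub_sq (h : IsRegularSolution μ p f u π) {t : ℝ} (ht : 0 ≤ t)
    (hmass : ∫ z, f 0 z.1 z.2 ∂phaseMeasure = 1) (w : E3) :
    Integrable (fun z : E3 × E3 => ‖z.2 - w‖ ^ 2 * f t z.1 z.2) phaseMeasure ∧
    ∫ z, ‖z.2 - w‖ ^ 2 * f t z.1 z.2 ∂phaseMeasure =
      ∫ z, ‖z.2‖ ^ 2 * f t z.1 z.2 ∂phaseMeasure - 2 * inner ℝ w (particleMean f t) +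
        ‖w‖ ^ 2 := by
  have hi1 := h.integrable_norm_sq ht
  have hi2 : Integrable (fun z : E3 × E3 => 2 * (inner ℝ w z.2 * f t z.1 z.2)) phaseMeasure := by
    refine (h.integrable_phase_of_le ht (g := fun z => inner ℝ w z.2) (by fun_prop) (C := ‖w‖)
      fun z => ?_).const_mul 2
    refine (abs_real_inner_le_norm _ _).trans ?_
    gcongr
    exact norm_le_one_add_sq _
  have hi3 : Integrable (fun z : E3 × E3 => ‖w‖ ^ 2 * f t z.1 z.2) phaseMeasure :=
    (h.integrable_f ht).const_mul _
  have hi12 : Integrable (fun z : E3 × E3 => ‖z.2‖ ^ 2 * f t z.1 z.2 -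
      2 * (inner ℝ w z.2 * f t z.1 z.2)) phaseMeasure := hi1.sub hi2
  have e : ∀ z : E3 × E3, ‖z.2 - w‖ ^ 2 * f t z.1 z.2 = ‖z.2‖ ^ 2 * f t z.1 z.2 -
      2 * (inner ℝ w z.2 * f t z.1 z.2) + ‖w‖ ^ 2 * f t z.1 z.2 := fun z => by
    rw [norm_sub_sq_real, real_inner_comm]
    ring
  simp only [e]
  refine ⟨hi12.add hi3, ?_⟩
  rw [integral_add hi12 hi3, integral_sub hi1 hi2, integral_const_mul, integral_const_mul,
    h.mass_eq ht, hmass, h.inner_particleMean ht, mul_one]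

lemma integral_norm_sub_fluidMean_sq (h : IsRegularSolution μ p f u π) {t : ℝ} (ht : 0 ≤ t) :
    ∫ x, ‖u t x - fluidMean u t‖ ^ 2 ∂torusMeasure =
      ∫ x, ‖u t x‖ ^ 2 ∂torusMeasure - ‖fluidMean u t‖ ^ 2 := by
  have huc := h.continuous_u_slice ht
  have hi1 : Integrable (fun x => ‖u t x‖ ^ 2) torusMeasure :=
    integrable_torus_of_continuous (by fun_prop)
  have hi2 : Integrable (fun x => 2 * inner ℝ (fluidMean u t) (u t x)) torusMeasure :=
    integrable_torus_of_continuous (by fun_prop)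
  have hi12 : Integrable (fun x => ‖u t x‖ ^ 2 - 2 * inner ℝ (fluidMean u t) (u t x))
      torusMeasure := hi1.sub hi2
  have e : ∀ x, ‖u t x - fluidMean u t‖ ^ 2 = ‖u t x‖ ^ 2 -
      2 * inner ℝ (fluidMean u t) (u t x) + ‖fluidMean u t‖ ^ 2 := fun x => by
    rw [norm_sub_sq_real, real_inner_comm]
  simp only [e]
  rw [integral_add hi12 (integrable_const _), integral_sub hi1 hi2, integral_const_mul,
    integral_inner (integrable_torus_of_continuous huc), ← fluidMean, real_inner_self_eq_norm_sq]
  simp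
  ring

/-- With unit mass, expanding the variances subtracts `½|v_c|² + ½|u_c|²`, and the weight `¼` on
`|u_c - v_c|²` turns this into a multiple of the squared total momentum, a conserved quantity. -/
lemma modulatedEnergy_eq (h : IsRegularSolution μ p f u π) {t : ℝ} (ht : 0 ≤ t)
    (hmass : ∫ z, f 0 z.1 z.2 ∂phaseMeasure = 1) :
    modulatedEnergy f u t = 1 / 2 * ∫ z, ‖z.2‖ ^ 2 * f t z.1 z.2 ∂phaseMeasure +
      1 / 2 * ∫ x, ‖u t x‖ ^ 2 ∂torusMeasure -
      1 / 4 * ‖particleMean f t + fluidMean u t‖ ^ 2 := by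
  rw [modulatedEnergy, (h.integral_norm_sub_sq ht hmass _).2, h.integral_norm_sub_fluidMean_sq ht,
    real_inner_self_eq_norm_sq, norm_sub_sq_real, norm_add_sq_real, real_inner_comm]
  ring

lemma contDiff_norm_sq_E3 : ContDiff ℝ 1 fun v : E3 => ‖v‖ ^ 2 := contDiff_id.norm_sq ℝ

lemma integral_coord_sub (h : IsRegularSolution μ p f u π) (i : Fin 3) {s t : ℝ} (hs : 0 ≤ s)
    (hst : s ≤ t) :
    IntervalIntegrable (fun τ => ∫ z, (u τ z.1 - z.2) i * f τ z.1 z.2 ∂phaseMeasure) volume s t ∧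
      ∫ z, z.2 i * f t z.1 z.2 ∂phaseMeasure - ∫ z, z.2 i * f s z.1 z.2 ∂phaseMeasure =
        ∫ τ in s..t, ∫ z, (u τ z.1 - z.2) i * f τ z.1 z.2 ∂phaseMeasure := by
  have hd : ∀ v : E3, fderiv ℝ (fun w : E3 => w i) v = EuclideanSpace.proj i := fun v =>
    (EuclideanSpace.proj (𝕜 := ℝ) i).hasFDerivAt.fderiv
  have := h.integral_sub_eq (φ := fun v => v i) (C := 1)
    (EuclideanSpace.proj (𝕜 := ℝ) i).contDiff
    (fun v => by rw [one_mul]; exact (abs_apply_le_norm v i).trans (norm_le_one_add_sq v))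
    (fun v => by
      rw [hd, one_mul]
      refine (ContinuousLinearMap.opNorm_le_bound _ zero_le_one fun w => ?_).trans
        (by linarith [norm_nonneg v])
      rw [one_mul]
      exact abs_apply_le_norm w i) hs hst
  simpa only [hd, PiLp.proj_apply] using this

lemma integral_norm_sq_sub (h : IsRegularSolution μ p f u π) {s t : ℝ} (hs : 0 ≤ s)
    (hst : s ≤ t) :
    IntervalIntegrable (fun τ => ∫ z, 2 * inner ℝ z.2 (u τ z.1 - z.2) * f τ z.1 z.2
      ∂phaseMeasure) volume s t ∧
      ∫ z, ‖z.2‖ ^ 2 * f t z.1 z.2 ∂phaseMeasure - ∫ z, ‖z.2‖ ^ 2 * f s z.1 z.2 ∂phaseMeasure =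
        ∫ τ in s..t, ∫ z, 2 * inner ℝ z.2 (u τ z.1 - z.2) * f τ z.1 z.2 ∂phaseMeasure := by
  have hd : ∀ v w : E3, fderiv ℝ (fun w : E3 => ‖w‖ ^ 2) v w = 2 * inner ℝ v w := fun v w => by
    rw [(hasStrictFDerivAt_norm_sq v).hasFDerivAt.fderiv]
    simp
  have := h.integral_sub_eq (φ := fun v => ‖v‖ ^ 2) (C := 2) contDiff_norm_sq_E3
    (fun v => by rw [abs_of_nonneg (sq_nonneg _)]; nlinarith [sq_nonneg ‖v‖])
    (fun v => by
      refine ContinuousLinearMap.opNorm_le_bound _ (by positivity) fun w => ?_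
      rw [hd, norm_mul, Real.norm_eq_abs, Real.norm_eq_abs, abs_two, mul_assoc]
      gcongr
      refine (abs_real_inner_le_norm v w).trans ?_
      gcongr
      linarith) hs hst
  simpa only [hd] using this

/-- Gives continuity in time of the velocity moments. The second moment is only assumed bounded, so
continuity is taken from its representation as a time integral starting at `0`. -/
lemma continuousOn_of_primitive {m G : ℝ → ℝ}
    (hm : ∀ t, 0 ≤ t → IntervalIntegrable G volume 0 t ∧ m t - m 0 = ∫ τ in (0 : ℝ)..t, G τ) :
    ContinuousOn m (Ici 0) := by
  intro t ht
  have ht : 0 ≤ t := ht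
  have h1 := intervalIntegral.continuousOn_primitive_interval' (hm (t + 1) (by linarith)).1
    left_mem_uIcc
  rw [uIcc_of_le (by linarith)] at h1
  have h2 : ContinuousOn m (Icc 0 (t + 1)) := by
    refine (h1.const_add (m 0)).congr fun τ hτ => ?_
    have := (hm τ hτ.1).2
    simp only []
    linarith
  refine (h2 t ⟨ht, by linarith⟩).mono_of_mem_nhdsWithin ?_
  rw [← Ici_inter_Iic]
  exact Filter.inter_mem self_mem_nhdsWithin
    (mem_nhdsWithin_of_mem_nhds (Iic_mem_nhds (by linarith)))

lemma continuousOn_modulatedEnergy (h : IsRegularSolution μ p f u π)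
    (hmass : ∫ z, f 0 z.1 z.2 ∂phaseMeasure = 1) :
    ContinuousOn (modulatedEnergy f u) (Ici 0) := by
  have h1 : ContinuousOn (fun t => ∫ z, ‖z.2‖ ^ 2 * f t z.1 z.2 ∂phaseMeasure) (Ici 0) :=
    continuousOn_of_primitive fun t ht => h.integral_norm_sq_sub le_rfl ht
  have h2 : ContinuousOn (fun t => ∫ x, ‖u t x‖ ^ 2 ∂torusMeasure) (Ici 0) :=
    continuousOn_integral_torus (h.continuous_u.norm.pow 2)
  have h3 : ∀ i, ContinuousOn (fun t => ∫ z, z.2 i * f t z.1 z.2 ∂phaseMeasure) (Ici 0) :=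
    fun i => continuousOn_of_primitive fun t ht => h.integral_coord_sub i le_rfl ht
  have h4 : ∀ i : Fin 3, ContinuousOn (fun t => ∫ x, u t x i ∂torusMeasure) (Ici 0) := fun i =>
    continuousOn_integral_torus
      ((EuclideanSpace.proj (𝕜 := ℝ) i).continuous.comp_continuousOn h.continuous_u)
  have h5 : ContinuousOn (fun t => ∑ i, (∫ z, z.2 i * f t z.1 z.2 ∂phaseMeasure +
      ∫ x, u t x i ∂torusMeasure) ^ 2) (Ici 0) :=
    continuousOn_finsetSum _ fun i _ => ((h3 i).add (h4 i)).pow 2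
  refine (((h1.const_mul (1 / 2)).add (h2.const_mul (1 / 2))).sub (h5.const_mul (1 / 4))).congr
    fun t ht => ?_
  rw [h.modulatedEnergy_eq ht hmass, norm_sq_eq_sum_sq]
  simp only [PiLp.add_apply, h.particleMean_apply ht, h.fluidMean_apply ht]
  rfl

/-- The drag gained by the particles is exactly the drag lost by the fluid. -/
lemma total_momentum_eq (h : IsRegularSolution μ p f u π) {s t : ℝ} (hs : 0 < s) (hst : s ≤ t) :
    particleMean f t + fluidMean u t = particleMean f s + fluidMean u s := by
  ext i
  have ht := hs.trans_le hst
  simp only [PiLp.add_apply, h.particleMean_apply hs.le, h.particleMean_apply ht.le,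
    h.fluidMean_apply hs.le, h.fluidMean_apply ht.le]
  have h1 := (h.integral_coord_sub i hs.le hst).2
  have h2 := (integral_sub_integral_eq_intervalIntegral (ν := torusMeasure)
    isBounded_cube.isCompact_closure
    ((ae_restrict_mem measurableSet_cube).mono fun x hx => subset_closure hx)
    (F := fun τ x => u τ x i) (F' := fun τ x => (deriv (fun s => u s x) τ) i)
    (fun τ hτ => integrable_torus_of_continuous
      (contDiff_apply_coord (h.contDiff_u_slice hτ) i).continuous)
    (fun τ hτ x => (EuclideanSpace.proj (𝕜 := ℝ) i).hasFDerivAt.comp_hasDerivAt τ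
      (h.hasDerivAt_u hτ x).differentiableAt.hasDerivAt)
    ((EuclideanSpace.proj (𝕜 := ℝ) i).continuous.comp_continuousOn h.continuousOn_deriv_u)
    hs hst).2
  have h3 : ∫ τ in s..t, ∫ x, (deriv (fun s => u s x) τ) i ∂torusMeasure =
      -∫ τ in s..t, ∫ z, (u τ z.1 - z.2) i * f τ z.1 z.2 ∂phaseMeasure := by
    rw [← intervalIntegral.integral_neg]
    refine intervalIntegral.integral_congr fun τ hτ => ?_
    rw [uIcc_of_le hst] at hτ
    have hτ0 := hs.trans_le hτ.1
    simp only []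
    rw [h.integral_deriv_u_apply hτ0]
    have := (h.integral_inner_force hτ0 (w := fun _ => EuclideanSpace.single i 1)
      continuous_const fun _ _ => rfl).2
    simp only [EuclideanSpace.inner_single_left, map_one, one_mul] at this
    rw [this]
  linarith

lemma integral_norm_sq_u_sub (h : IsRegularSolution μ p f u π) (hp : 1 < p) {s t : ℝ}
    (hs : 0 < s) (hst : s ≤ t) :
    IntervalIntegrable (fun τ => 2 * (-(μ * ∫ x, frob (symGrad (u τ) x) ^ p ∂torusMeasure) -
        ∫ z, inner ℝ (u τ z.1) (u τ z.1 - z.2) * f τ z.1 z.2 ∂phaseMeasure)) volume s t ∧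
    ∫ x, ‖u t x‖ ^ 2 ∂torusMeasure - ∫ x, ‖u s x‖ ^ 2 ∂torusMeasure =
      ∫ τ in s..t, 2 * (-(μ * ∫ x, frob (symGrad (u τ) x) ^ p ∂torusMeasure) -
        ∫ z, inner ℝ (u τ z.1) (u τ z.1 - z.2) * f τ z.1 z.2 ∂phaseMeasure) := by
  have hmain := integral_sub_integral_eq_intervalIntegral (ν := torusMeasure)
    isBounded_cube.isCompact_closure
    ((ae_restrict_mem measurableSet_cube).mono fun x hx => subset_closure hx)
    (F := fun τ x => ‖u τ x‖ ^ 2) (F' := fun τ x => 2 * inner ℝ (u τ x) (deriv (fun s => u s x) τ))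
    (fun τ hτ => integrable_torus_of_continuous
      (by have := h.continuous_u_slice hτ.le; fun_prop))
    (fun τ hτ x => (h.hasDerivAt_u hτ x).differentiableAt.hasDerivAt.norm_sq)
    (continuousOn_const.mul ((h.continuous_u.mono
      (prod_mono Ioi_subset_Ici_self subset_rfl)).inner h.continuousOn_deriv_u))
    hs hst
  have hpt : ∀ τ ∈ uIcc s t, ∫ x, 2 * inner ℝ (u τ x) (deriv (fun s => u s x) τ) ∂torusMeasure =
      2 * (-(μ * ∫ x, frob (symGrad (u τ) x) ^ p ∂torusMeasure) -
        ∫ z, inner ℝ (u τ z.1) (u τ z.1 - z.2) * f τ z.1 z.2 ∂phaseMeasure) := fun τ hτ => by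
    rw [uIcc_of_le hst] at hτ
    rw [integral_const_mul, h.integral_inner_deriv_u hp (hs.trans_le hτ.1)]
  refine ⟨hmain.1.congr fun τ hτ => hpt τ (uIoc_subset_uIcc hτ), hmain.2.trans ?_⟩
  exact intervalIntegral.integral_congr hpt

/-- The energy balance. -/
lemma modulatedEnergy_sub (h : IsRegularSolution μ p f u π) (hp : 1 < p)
    (hmass : ∫ z, f 0 z.1 z.2 ∂phaseMeasure = 1) {s t : ℝ} (hs : 0 < s) (hst : s ≤ t) :
    IntervalIntegrable (dissipation μ p f u) volume s t ∧
      modulatedEnergy f u s - modulatedEnergy f u t = ∫ τ in s..t, dissipation μ p f u τ := by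
  have h1 := h.integral_norm_sq_sub hs.le hst
  have h2 := h.integral_norm_sq_u_sub hp hs hst
  -- The fluid loses `⟨u, u-v⟩` and the particles gain `⟨v, u-v⟩`; the difference is `|u-v|²`.
  have hpt : ∀ τ ∈ uIcc s t, dissipation μ p f u τ =
      -(1 / 2) * (∫ z, 2 * inner ℝ z.2 (u τ z.1 - z.2) * f τ z.1 z.2 ∂phaseMeasure +
      2 * (-(μ * ∫ x, frob (symGrad (u τ) x) ^ p ∂torusMeasure) -
        ∫ z, inner ℝ (u τ z.1) (u τ z.1 - z.2) * f τ z.1 z.2 ∂phaseMeasure)) := by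
    intro τ hτ
    rw [uIcc_of_le hst] at hτ
    have hτ0 := hs.trans_le hτ.1
    have huc := h.continuous_u_slice hτ0.le
    obtain ⟨U, hU⟩ := (h.periodic_u τ hτ0.le).exists_norm_le huc
    have hU0 : 0 ≤ U := (norm_nonneg _).trans (hU 0)
    have hi1 := (h.integral_inner_force hτ0 huc (h.periodic_u τ hτ0.le)).1
    have hi2 : Integrable (fun z : E3 × E3 => inner ℝ z.2 (u τ z.1 - z.2) * f τ z.1 z.2)
        phaseMeasure := by
      refine h.integrable_phase_of_le hτ0.le (C := U + 1) (by fun_prop) fun z => ?_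
      calc |inner ℝ z.2 (u τ z.1 - z.2)| ≤ ‖z.2‖ * ‖u τ z.1 - z.2‖ := abs_real_inner_le_norm _ _
        _ ≤ ‖z.2‖ * (U + ‖z.2‖) := by
            gcongr
            exact (norm_sub_le _ _).trans (add_le_add (hU _) le_rfl)
        _ ≤ (U + 1) * (1 + ‖z.2‖ ^ 2) := by
            nlinarith [norm_le_one_add_sq z.2, mul_le_mul_of_nonneg_left
              (norm_le_one_add_sq z.2) hU0]
    have e : ∀ z : E3 × E3, ‖u τ z.1 - z.2‖ ^ 2 * f τ z.1 z.2 =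
        inner ℝ (u τ z.1) (u τ z.1 - z.2) * f τ z.1 z.2 -
          inner ℝ z.2 (u τ z.1 - z.2) * f τ z.1 z.2 := fun z => by
      rw [← sub_mul, ← inner_sub_left, real_inner_self_eq_norm_sq]
    rw [dissipation]
    simp only [e, mul_assoc]
    rw [integral_sub hi1 hi2, integral_const_mul]
    ring
  refine ⟨((h1.1.add h2.1).const_mul (-(1 / 2))).congr fun τ hτ =>
    (hpt τ (uIoc_subset_uIcc hτ)).symm, ?_⟩
  rw [intervalIntegral.integral_congr hpt, intervalIntegral.integral_const_mul,
    intervalIntegral.integral_add h1.1 h2.1, ← h1.2, ← h2.2,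
    h.modulatedEnergy_eq hs.le hmass, h.modulatedEnergy_eq (hs.le.trans hst) hmass,
    h.total_momentum_eq hs hst]
  ring

end IsRegularSolution

end VlasovPowerLaw

/-! ### Coercivity of the dissipation and conclusion -/

namespace VlasovPowerLaw

/-- Raising a sublinear dissipation inequality to the critical power. -/
lemma rpow_le_of_le_add {p μ E E₀ D K Y a : ℝ} (hp : 0 < p) (hμ : 0 < μ) (ha : 1 ≤ a)
    (hap : p / 2 ≤ a) (hE : 0 ≤ E) (hEE : E ≤ E₀) (hD : 0 ≤ D) (hK : 0 ≤ K) (hY : 0 ≤ Y)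
    (h : E ≤ D + K * Y ^ (2 / p)) :
    E ^ a ≤ (2 * E₀ ^ (a - 1) + E₀ ^ (a - p / 2) * (2 * K) ^ (p / 2) / μ + 1) * (μ * Y + D) := by
  have hE0 : 0 ≤ E₀ := hE.trans hEE
  have hμY : 0 ≤ μ * Y := mul_nonneg hμ.le hY
  have hA : 0 ≤ E₀ ^ (a - 1) := Real.rpow_nonneg hE0 _
  have hB : 0 ≤ E₀ ^ (a - p / 2) * (2 * K) ^ (p / 2) := by positivity
  have hB' : 0 ≤ E₀ ^ (a - p / 2) * (2 * K) ^ (p / 2) / μ := by positivity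
  -- Surplus powers of `E` are paid for by `E₀`. Below, `b = 1` is used when `D` dominates and `b =
  -- p/2` when `K Y^(2/p)` does; the final `+ 1` in the constant keeps it positive even for `E₀ =
  -- 0`.
  have hsplit : ∀ b, 0 < b → b ≤ a → E ^ a ≤ E₀ ^ (a - b) * E ^ b := fun b hb hba => by
    calc E ^ a = E ^ (a - b) * E ^ b := by
          rw [← Real.rpow_add_of_nonneg hE (sub_nonneg.2 hba) hb.le, sub_add_cancel]
      _ ≤ E₀ ^ (a - b) * E ^ b := by
          gcongr
  rcases le_total (K * Y ^ (2 / p)) D with hle | hle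
  · calc E ^ a ≤ E₀ ^ (a - 1) * E ^ (1 : ℝ) := hsplit 1 one_pos ha
      _ ≤ E₀ ^ (a - 1) * (2 * D) := by
          rw [Real.rpow_one]
          gcongr
          linarith
      _ ≤ _ := by
          nlinarith [mul_nonneg hA hμY, mul_nonneg hB' hμY, mul_nonneg hB' hD]
  · calc E ^ a ≤ E₀ ^ (a - p / 2) * E ^ (p / 2) := hsplit _ (by linarith) hap
      _ ≤ E₀ ^ (a - p / 2) * (2 * K * Y ^ (2 / p)) ^ (p / 2) := by
          gcongr
          linarith
      _ = E₀ ^ (a - p / 2) * (2 * K) ^ (p / 2) / μ * (μ * Y) := by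
          rw [Real.mul_rpow (by positivity) (by positivity), ← Real.rpow_mul hY,
            show 2 / p * (p / 2) = 1 by field_simp, Real.rpow_one]
          field_simp
      _ ≤ _ := by
          nlinarith [mul_nonneg hA hμY, mul_nonneg hA hD, mul_nonneg hB' hD]

lemma lintegral_strain_rpow {w : E3 → E3} (hw : ContDiff ℝ 1 w) {p : ℝ} (hp : 0 ≤ p) :
    ∫⁻ x, strain w x ^ p ∂torusMeasure =
      ENNReal.ofReal (∫ x, frob (symGrad w x) ^ p ∂torusMeasure) := by
  rw [ofReal_integral_eq_lintegral_ofReal (integrable_frob_rpow hw hp)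
    (Filter.Eventually.of_forall fun x => Real.rpow_nonneg (frob_nonneg _) _)]
  refine lintegral_congr fun x => ?_
  rw [strain, ENNReal.ofReal_rpow_of_nonneg (frob_nonneg _) hp]

/-- The weighted Korn inequality on the torus, in terms of real integrals. -/
lemma exists_integral_sq_mul_le {p : ℝ} {r : ℝ≥0∞} (hp : 6 / 5 ≤ p)
    (hr : AdmissibleExponent p r) : ∃ K : ℝ≥0, ∀ (w : E3 → E3) (ρ : E3 → ℝ) (M : ℝ≥0),
      ContDiff ℝ 1 w → IsPeriodic w → AEStronglyMeasurable ρ torusMeasure → (∀ x, 0 ≤ ρ x) →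
      eLpNorm ρ r torusMeasure ≤ M →
      ∫ x, ‖w x - ∫ y, w y ∂torusMeasure‖ ^ 2 * ρ x ∂torusMeasure ≤
        K * M * (∫ x, frob (symGrad w x) ^ p ∂torusMeasure) ^ (2 / p) := by
  obtain ⟨K, hK⟩ := exists_lintegral_sq_mul_le hp hr
  refine ⟨K, fun w ρ M hw hwp hρ hρ0 hM => ?_⟩
  have hY : 0 ≤ ∫ x, frob (symGrad w x) ^ p ∂torusMeasure :=
    integral_nonneg fun _ => Real.rpow_nonneg (frob_nonneg _) _
  have h1 := hK w ρ hw hwp hρ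
  rw [lintegral_strain_rpow hw (by linarith),
    ENNReal.ofReal_rpow_of_nonneg hY (div_nonneg two_pos.le (by linarith))] at h1
  have hwc := hw.continuous
  have hm : AEStronglyMeasurable (fun x => ‖w x - ∫ y, w y ∂torusMeasure‖ ^ 2 * ρ x)
      torusMeasure :=
    AEStronglyMeasurable.mul (Continuous.aestronglyMeasurable (by fun_prop)) hρ
  rw [integral_eq_lintegral_of_nonneg_ae
    (Filter.Eventually.of_forall fun x => mul_nonneg (sq_nonneg _) (hρ0 x)) hm]
  have e : ∀ x, ENNReal.ofReal (‖w x - ∫ y, w y ∂torusMeasure‖ ^ 2 * ρ x) =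
      ‖w x - ∫ y, w y ∂torusMeasure‖ₑ ^ 2 * ‖ρ x‖ₑ := fun x => by
    rw [ENNReal.ofReal_mul (sq_nonneg _), ENNReal.ofReal_pow (norm_nonneg _), ofReal_norm,
      Real.enorm_of_nonneg (hρ0 x)]
  simp only [e]
  refine ENNReal.toReal_le_of_le_ofReal (by positivity) (h1.trans ?_)
  rw [ENNReal.ofReal_mul (by positivity), ENNReal.ofReal_mul (by positivity),
    ENNReal.ofReal_coe_nnreal, ENNReal.ofReal_coe_nnreal]
  gcongr

variable {μ p : ℝ} {f : ℝ → E3 → E3 → ℝ} {u : ℝ → E3 → E3} {π : ℝ → E3 → ℝ}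

lemma integral_mul_density {t : ℝ} {g : E3 → ℝ}
    (hg : Integrable (fun z : E3 × E3 => g z.1 * f t z.1 z.2) phaseMeasure) :
    ∫ z, g z.1 * f t z.1 z.2 ∂phaseMeasure = ∫ x, g x * density f t x ∂torusMeasure := by
  rw [phaseMeasure, integral_prod _ hg]
  simp only [integral_const_mul, density]

namespace IsRegularSolution

lemma modulatedEnergy_nonneg (h : IsRegularSolution μ p f u π) {t : ℝ} (ht : 0 ≤ t) :
    0 ≤ modulatedEnergy f u t := by
  have h1 : 0 ≤ ∫ z, ‖z.2 - particleMean f t‖ ^ 2 * f t z.1 z.2 ∂phaseMeasure :=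
    integral_nonneg fun _ => mul_nonneg (sq_nonneg _) (h.nonneg_f t ht _ _)
  have h2 : 0 ≤ ∫ x, ‖u t x - fluidMean u t‖ ^ 2 ∂torusMeasure :=
    integral_nonneg fun _ => sq_nonneg _
  rw [modulatedEnergy]
  positivity

lemma dissipation_nonneg (h : IsRegularSolution μ p f u π) (hμ : 0 ≤ μ) {t : ℝ} (ht : 0 ≤ t) :
    0 ≤ dissipation μ p f u t :=
  add_nonneg (mul_nonneg hμ (integral_nonneg fun _ => Real.rpow_nonneg (frob_nonneg _) _))
    (integral_nonneg fun _ => mul_nonneg (sq_nonneg _) (h.nonneg_f t ht _ _))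

lemma density_nonneg (h : IsRegularSolution μ p f u π) {t : ℝ} (ht : 0 ≤ t) (x : E3) :
    0 ≤ density f t x := integral_nonneg fun v => h.nonneg_f t ht x v

lemma aestronglyMeasurable_density (h : IsRegularSolution μ p f u π) {t : ℝ} (ht : 0 ≤ t) :
    AEStronglyMeasurable (density f t) torusMeasure :=
  ((h.continuous_f_slice ht).stronglyMeasurable.integral_prod_right).aestronglyMeasurable

/-- The modulated energy is controlled by the relative velocity and by the fluctuations of the
fluid velocity. -/
lemma modulatedEnergy_le (h : IsRegularSolution μ p f u π) {t : ℝ} (ht : 0 ≤ t)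
    (hmass : ∫ z, f 0 z.1 z.2 ∂phaseMeasure = 1) :
    modulatedEnergy f u t ≤ ∫ z, ‖u t z.1 - z.2‖ ^ 2 * f t z.1 z.2 ∂phaseMeasure +
      ∫ x, ‖u t x - fluidMean u t‖ ^ 2 * density f t x ∂torusMeasure +
      1 / 2 * ∫ x, ‖u t x - fluidMean u t‖ ^ 2 ∂torusMeasure := by
  have huc := h.continuous_u_slice ht
  obtain ⟨U, hU⟩ := (h.periodic_u t ht).exists_norm_le huc
  -- The variance about `v_c` is that about `u_c` minus `|u_c - v_c|²`. Half of this gain more than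
  -- absorbs the `¼|u_c - v_c|²` in the energy.
  have hV := h.integral_norm_sub_sq ht hmass (particleMean f t)
  have hW := h.integral_norm_sub_sq ht hmass (fluidMean u t)
  have hi1 : Integrable (fun z : E3 × E3 => ‖u t z.1 - z.2‖ ^ 2 * f t z.1 z.2) phaseMeasure := by
    refine h.integrable_phase_of_le ht (by fun_prop) (C := 2 * U ^ 2 + 2) fun z => ?_
    rw [abs_of_nonneg (sq_nonneg _)]
    have h1 : ‖u t z.1 - z.2‖ ≤ U + ‖z.2‖ := (norm_sub_le _ _).trans (add_le_add (hU _) le_rfl)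
    nlinarith [norm_nonneg (u t z.1 - z.2), sq_nonneg (U - ‖z.2‖), sq_nonneg (U * ‖z.2‖)]
  have hi2 : Integrable (fun z : E3 × E3 => ‖u t z.1 - fluidMean u t‖ ^ 2 * f t z.1 z.2)
      phaseMeasure := by
    refine h.integrable_phase_of_le ht (by fun_prop) (C := (U + ‖fluidMean u t‖) ^ 2) fun z => ?_
    rw [abs_of_nonneg (sq_nonneg _)]
    have h1 : ‖u t z.1 - fluidMean u t‖ ≤ U + ‖fluidMean u t‖ :=
      (norm_sub_le _ _).trans (add_le_add (hU _) le_rfl)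
    have h2 := pow_le_pow_left₀ (norm_nonneg _) h1 2
    nlinarith [mul_nonneg (sq_nonneg (U + ‖fluidMean u t‖)) (sq_nonneg ‖z.2‖)]
  have hle : ∫ z, ‖z.2 - fluidMean u t‖ ^ 2 * f t z.1 z.2 ∂phaseMeasure ≤
      2 * ∫ z, ‖u t z.1 - z.2‖ ^ 2 * f t z.1 z.2 ∂phaseMeasure +
      2 * ∫ z, ‖u t z.1 - fluidMean u t‖ ^ 2 * f t z.1 z.2 ∂phaseMeasure := by
    rw [← integral_const_mul, ← integral_const_mul,
      ← integral_add (hi1.const_mul 2) (hi2.const_mul 2)]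
    refine integral_mono hW.1 ((hi1.const_mul 2).add (hi2.const_mul 2)) fun z => ?_
    have h1 : ‖z.2 - fluidMean u t‖ ≤ ‖u t z.1 - z.2‖ + ‖u t z.1 - fluidMean u t‖ := by
      rw [norm_sub_rev (u t z.1) z.2]
      exact norm_sub_le_norm_sub_add_norm_sub _ _ _
    have h2 : ‖z.2 - fluidMean u t‖ ^ 2 ≤
        2 * ‖u t z.1 - z.2‖ ^ 2 + 2 * ‖u t z.1 - fluidMean u t‖ ^ 2 := by
      nlinarith [norm_nonneg (z.2 - fluidMean u t),
        sq_nonneg (‖u t z.1 - z.2‖ - ‖u t z.1 - fluidMean u t‖)]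
    have h3 := mul_le_mul_of_nonneg_right h2 (h.nonneg_f t ht z.1 z.2)
    simp only []
    linarith
  rw [integral_mul_density (g := fun x => ‖u t x - fluidMean u t‖ ^ 2) hi2] at hle
  have hid := norm_sub_sq_real (fluidMean u t) (particleMean f t)
  have hVV := real_inner_self_eq_norm_sq (particleMean f t)
  have hpos := sq_nonneg ‖fluidMean u t - particleMean f t‖
  rw [modulatedEnergy]
  linarith [hV.2, hW.2]

/-- The coercivity of the dissipation. -/
lemma exists_modulatedEnergy_le (h : IsRegularSolution μ p f u π) (hp : 6 / 5 ≤ p)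
    (hmass : ∫ z, f 0 z.1 z.2 ∂phaseMeasure = 1) {r : ℝ≥0∞} (hr : AdmissibleExponent p r)
    (hρ : DensityBounded f r) : ∃ K : ℝ, 0 ≤ K ∧ ∀ᵐ t ∂(volume.restrict (Ioi (0 : ℝ))),
      modulatedEnergy f u t ≤ ∫ z, ‖u t z.1 - z.2‖ ^ 2 * f t z.1 z.2 ∂phaseMeasure +
        K * (∫ x, frob (symGrad (u t) x) ^ p ∂torusMeasure) ^ (2 / p) := by
  obtain ⟨K, hK⟩ := exists_integral_sq_mul_le hp hr
  obtain ⟨M, hM⟩ := hρ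
  refine ⟨K * M + 1 / 2 * K, by positivity, ?_⟩
  filter_upwards [hM, ae_restrict_mem measurableSet_Ioi] with t htM ht
  have ht0 : (0 : ℝ) < t := ht
  have h1 := h.modulatedEnergy_le ht0.le hmass
  have h2 := hK (u t) (density f t) M (h.contDiff_u_slice ht0) (h.periodic_u t ht0.le)
    (h.aestronglyMeasurable_density ht0.le) (h.density_nonneg ht0.le) htM
  -- The unweighted fluctuation is the same inequality with weight `1`, of `L^r` norm at most one on
  -- a probability space.
  have h3 := hK (u t) (fun _ => 1) 1 (h.contDiff_u_slice ht0) (h.periodic_u t ht0.le)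
    aestronglyMeasurable_const (fun _ => zero_le_one) (by
      simpa using eLpNorm_le_of_ae_bound (p := r) (μ := torusMeasure) (f := fun _ => (1 : ℝ))
        (C := 1) (Filter.Eventually.of_forall fun _ => by simp))
  simp only [mul_one, NNReal.coe_one] at h3
  rw [fluidMean] at h1
  linarith

/-- The integrated differential inequality for the modulated energy. -/
lemma exists_decrement (h : IsRegularSolution μ p f u π) (hμ : 0 < μ) (hp : 6 / 5 ≤ p)
    (hmass : ∫ z, f 0 z.1 z.2 ∂phaseMeasure = 1) {r : ℝ≥0∞} (hr : AdmissibleExponent p r)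
    (hρ : DensityBounded f r) {a : ℝ} (ha : 1 ≤ a) (hap : p / 2 ≤ a) :
    ∃ c : ℝ, 0 < c ∧ ∀ s t, 0 < s → s ≤ t →
      modulatedEnergy f u t + c * (t - s) * modulatedEnergy f u t ^ a ≤ modulatedEnergy f u s := by
  obtain ⟨K, hK0, hK⟩ := h.exists_modulatedEnergy_le hp hmass hr hρ
  have hE := h.continuousOn_modulatedEnergy hmass
  have hanti : ∀ s t, 0 < s → s ≤ t → modulatedEnergy f u t ≤ modulatedEnergy f u s := by
    intro s t hs hst
    have h1 := (h.modulatedEnergy_sub (by linarith) hmass hs hst).2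
    have h2 : 0 ≤ ∫ τ in s..t, dissipation μ p f u τ :=
      intervalIntegral.integral_nonneg hst fun τ hτ =>
        h.dissipation_nonneg hμ.le (hs.le.trans hτ.1)
    linarith
  -- Monotonicity down to time zero is the case `c = 0` of the passage to the limit.
  have hE0 : ∀ t, 0 ≤ t → modulatedEnergy f u t ≤ modulatedEnergy f u 0 := fun t ht => by
    simpa using decrement_from_zero (c := 0) (a := 1) hE
      (fun s t hs hst => by simpa using hanti s t hs hst) le_rfl ht
  set E₀ := modulatedEnergy f u 0
  have hE0' : 0 ≤ E₀ := h.modulatedEnergy_nonneg le_rfl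
  set κ := 2 * E₀ ^ (a - 1) + E₀ ^ (a - p / 2) * (2 * K) ^ (p / 2) / μ + 1 with hκ
  have hκ0 : 0 < κ := by positivity
  refine ⟨1 / κ, by positivity, fun s t hs hst => ?_⟩
  obtain ⟨hint, heq⟩ := h.modulatedEnergy_sub (by linarith) hmass hs hst
  -- Since `E` is nonincreasing, its value at the right endpoint bounds the dissipation from below
  -- at almost every `τ` in `[s,t]`.
  have hle : ∫ _ in s..t, 1 / κ * modulatedEnergy f u t ^ a ≤
      ∫ τ in s..t, dissipation μ p f u τ := by
    refine intervalIntegral.integral_mono_ae_restrict hst intervalIntegrable_const hint ?_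
    filter_upwards [ae_restrict_of_ae_restrict_of_subset
      (fun τ hτ => hs.trans_le hτ.1 : Icc s t ⊆ Ioi 0) hK,
      ae_restrict_mem measurableSet_Icc] with τ hKτ hτ
    have hτ0 : 0 ≤ τ := hs.le.trans hτ.1
    have h1 := rpow_le_of_le_add (by linarith) hμ ha hap (h.modulatedEnergy_nonneg hτ0)
      (hE0 τ hτ0) (integral_nonneg fun _ => mul_nonneg (sq_nonneg _) (h.nonneg_f τ hτ0 _ _)) hK0
      (integral_nonneg fun _ => Real.rpow_nonneg (frob_nonneg _) _) hKτ
    have h2 : modulatedEnergy f u t ^ a ≤ modulatedEnergy f u τ ^ a :=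
      Real.rpow_le_rpow (h.modulatedEnergy_nonneg (hs.le.trans hst))
        (hanti τ t (hs.trans_le hτ.1) hτ.2) (by linarith)
    rw [one_div, inv_mul_le_iff₀ hκ0]
    exact h2.trans h1
  rw [intervalIntegral.integral_const, smul_eq_mul, ← heq] at hle
  linarith

end IsRegularSolution

end VlasovPowerLaw

theorem theorem1p2 (μ p : ℝ) (hμ : 0 < μ) (hp : 6 / 5 ≤ p)
    (f : ℝ → E3 → E3 → ℝ) (u : ℝ → E3 → E3) (π : ℝ → E3 → ℝ)
    (hsol : IsRegularSolution μ p f u π)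
    (hmass : ∫ z, f 0 z.1 z.2 ∂phaseMeasure = 1)
    (r : ℝ≥0∞) (hr : AdmissibleExponent p r) (hρ : DensityBounded f r) :
    ∃ C₀ : ℝ, 0 < C₀ ∧ ∀ t : ℝ, 0 ≤ t →
      (2 < p →
        modulatedEnergy f u t ≤
            (modulatedEnergy f u 0 ^ ((2 - p) / 2) + C₀ * (p / 2 - 1) * t) ^ (-(2 / (p - 2))) ∧
        -- for `E(0) = 0` the bound means `E(t) = 0`, as `0 ^ ((2 - p) / 2) = ∞`
        (modulatedEnergy f u 0 = 0 → modulatedEnergy f u t = 0)) ∧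
      (p ≤ 2 →
        modulatedEnergy f u t ≤ modulatedEnergy f u 0 * Real.exp (-(C₀ * t))) := by
  have hE := hsol.continuousOn_modulatedEnergy hmass
  have hpos : ∀ t, 0 ≤ t → 0 ≤ modulatedEnergy f u t := fun t ht => hsol.modulatedEnergy_nonneg ht
  -- The exponent is `a = max(1, p/2)`; `C₀ = c/2` because the barrier decays at half the rate.
  rcases lt_or_ge 2 p with h2 | h2
  · obtain ⟨c, hc, hdec⟩ := hsol.exists_decrement hμ hp hmass hr hρ (a := p / 2) (by linarith)
      le_rfl
    exact ⟨c / 2, by linarith, fun t ht => ⟨fun _ => ⟨algebraic_decay_of_decrement h2 hE hpos hc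
      hdec ht, fun h0 => le_antisymm ((antitone_of_decrement hE hpos hc hdec ht).trans h0.le)
        (hpos t ht)⟩, fun h => absurd h h2.not_ge⟩⟩
  · obtain ⟨c, hc, hdec⟩ := hsol.exists_decrement hμ hp hmass hr hρ (a := 1) le_rfl (by linarith)
    exact ⟨c / 2, by linarith, fun t ht => ⟨fun h => absurd h h2.not_gt,
      fun _ => exp_decay_of_decrement hE hpos hc hdec ht⟩⟩
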